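/- Let $k$ be a field and $B$ a Hopf algebra over $k$ with bijective antipode $S$. Let $X$ be an anti-Yetter–Drinfeld module over $B$: a left $B$-module and left $B$-comodule with $$(bx)_{(-1)}\otimes (bx)_{(0)}=b_{(1)}x_{(-1)}S^{-1}(b_{(3)})\otimes b_{(2)}x_{(0)}\qquad(b\in B,\ x\in X).$$ Coalgebras are coassociative but not necessarily counital. A $B$-module coalgebra is a coalgebra $C$ that is a left $B$-module with $\Delta(bc)=b_{(1)}c_{(1)}\otimes b_{(2)}c_{(2)}$. A coalgebra $C$ is H-counital if the complex $C\to C^{\otimes 2}\to C^{\otimes 3}\to\cdots$ with differential $C^{\otimes n+1}\to C^{\otimes n+2}$ equal to $\sum_{j=0}^{n}(-1)^j\,\mathrm{id}^{\otimes j}\otimes\Delta\otimes\mathrm{id}^{\otimes n-j}$ is exact (including injectivity of the first map). For a $B$-module coalgebra $C$ and a $C$-bicomodule $M$ which is a left $B$-module with $B$-linear coactions (for the diagonal actions), let $\mathrm{CH}^{\mathrm{tw}}_n(C,M;X)=X\otimes M\otimes C^{\otimes n}$ with differential $\sum_{j=0}^{n+1}(-1)^j\partial_j$, where $$\partial_0(x\otimes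 m\otimes c^1\otimes\cdots\otimes c^n)=x\otimes m_{(0)}\otimes m_{(1)}\otimes c^1\otimes\cdots\otimes c^n,$$ $\partial_j$ applies $\Delta$ to $c^j$ for $1\le j\le n$, and $$\partial_{n+1}(x\otimes m\otimes c^1\otimes\cdots\otimes c^n)=x_{(0)}\otimes m_{(0)}\otimes c^1\otimes\cdots\otimes c^n\otimes x_{(-1)}m_{(-1)}.$$ Let $B$ act on $\mathrm{CH}^{\mathrm{tw}}_n(C,M;X)$ by $$b(x\otimes m\otimes c^1\otimes\cdots\otimes c^n)=b_{(n+2)}x\otimes b_{(1)}m\otimes b_{(2)}c^1\otimes\cdots\otimes b_{(n+1)}c^n .$$ The differential induces a differential on the graded $k$-module $k\otimes_B\mathrm{CH}^{\mathrm{tw}}_*(C,M;X)$, where $k$ is a $B$-module through the counit. Write $\mathrm{CH}^{\mathrm{tw}}_*(C;X)=\mathrm{CH}^{\mathrm{tw}}_*(C,C;X)$. **Theorem.** Let $0\to K\to C\to C/K\to 0$ be a short exact sequence of $B$-module coalgebras (the maps are $B$-linear and compatible with the comultiplications), with $K$, $C$ and $C/K$ all H-counital. Assume that $X$ has finite projective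 dimension as a $B$-module and that $C$ and $C/K$ are projective $B$-modules. Regard $K$ as a $C$-bicomodule through $K\to C$. Then the map of cochain complexes $$k\otimes_B\mathrm{CH}^{\mathrm{tw}}_*(K;X)\longrightarrow k\otimes_B\mathrm{CH}^{\mathrm{tw}}_*(C,K;X)$$ induced by the inclusion $K\to C$ is injective in each degree and is a quasi-isomorphism. -/

import Mathlib

open scoped TensorProduct
open CategoryTheory

set_option linter.unusedSectionVars false

universe u v

namespace HopfExcision

noncomputable section

/-! ### Coalgebras without counit -/

/-- A coassociative, not necessarily counital, `k`-coalgebra. -/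
class NUCoalgebra (k : Type u) (C : Type v) [Field k] [AddCommGroup C] [Module k C] where
  comul : C →ₗ[k] C ⊗[k] C
  coassoc : (TensorProduct.assoc k C C C).toLinearMap ∘ₗ comul.rTensor C ∘ₗ comul =
    comul.lTensor C ∘ₗ comul

section Tower

variable (k : Type u) (M C : Type v) [Field k] [AddCommGroup M] [Module k M]
  [AddCommGroup C] [Module k C]

/-- `tower k M C n` is `M ⊗ C ⊗ ⋯ ⊗ C` with `n` factors `C`, bracketed to the left. -/
def tower : ℕ → ModuleCat.{v} k
  | 0 => ModuleCat.of k M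
  | n + 1 => ModuleCat.of k (tower n ⊗[k] C)

variable {k M C}

/-- Comultiplication in the last factor, `v ⊗ c ↦ (v ⊗ c₍₁₎) ⊗ c₍₂₎`. -/
def splitLast (V : Type v) [AddCommGroup V] [Module k V] (Δ : C →ₗ[k] C ⊗[k] C) :
    V ⊗[k] C →ₗ[k] (V ⊗[k] C) ⊗[k] C :=
  (TensorProduct.assoc k V C C).symm.toLinearMap ∘ₗ Δ.lTensor V

/-- One step of the recursion for an alternating sum of faces: from `d : V → V ⊗ C` to
`v ⊗ c ↦ d v ⊗ c + s (v ⊗ c₍₁₎) ⊗ c₍₂₎`. -/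
def faceStep (V : Type v) [AddCommGroup V] [Module k V] (Δ : C →ₗ[k] C ⊗[k] C) (s : k)
    (d : V →ₗ[k] V ⊗[k] C) : V ⊗[k] C →ₗ[k] (V ⊗[k] C) ⊗[k] C :=
  d.rTensor C + s • splitLast V Δ

/-- The alternating sum `∑_{j=0}^{n} (-1)^j ∂_j : M ⊗ C^{⊗n} → M ⊗ C^{⊗(n+1)}`, where `∂_0` is the
right coaction on `M` and `∂_j`, for `1 ≤ j ≤ n`, is the comultiplication of the `j`-th factor
`C`. -/
def faceSum (ρ : M →ₗ[k] M ⊗[k] C) (Δ : C →ₗ[k] C ⊗[k] C) :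
    (n : ℕ) → (tower k M C n →ₗ[k] tower k M C (n + 1))
  | 0 => ρ
  | n + 1 => faceStep (tower k M C n) Δ ((-1) ^ (n + 1)) (faceSum ρ Δ n)

/-- The left coaction carried by the first factor:
`m ⊗ c¹ ⊗ ⋯ ⊗ cⁿ ↦ m₍₋₁₎ ⊗ (m₍₀₎ ⊗ c¹ ⊗ ⋯ ⊗ cⁿ)`. -/
def towerCoact (l : M →ₗ[k] C ⊗[k] M) : (n : ℕ) → (tower k M C n →ₗ[k] C ⊗[k] tower k M C n)
  | 0 => l
  | n + 1 => ((TensorProduct.assoc k C (tower k M C n) C).toLinearMap ∘ₗ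
      (towerCoact l n).rTensor C : tower k M C n ⊗[k] C →ₗ[k] C ⊗[k] (tower k M C n ⊗[k] C))

/-- The map `id_M ⊗ f ⊗ ⋯ ⊗ f`. -/
def towerMap {D : Type v} [AddCommGroup D] [Module k D] (f : D →ₗ[k] C) :
    (n : ℕ) → (tower k M D n →ₗ[k] tower k M C n)
  | 0 => (LinearMap.id : M →ₗ[k] M)
  | n + 1 => (TensorProduct.map (towerMap f n) f :
      tower k M D n ⊗[k] D →ₗ[k] tower k M C n ⊗[k] C)

end Tower

/-- The bar complex `CB_*(C)`, with `CB_n(C) = C^{⊗(n+1)}` and differential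
`∑_{j=0}^{n} (-1)^j ∂_j`, where `∂_j` comultiplies the `j`-th factor, is acyclic:
`C → C ⊗ C → C ⊗ C ⊗ C → ⋯` is exact, including injectivity of the first map. -/
def HCounital (k : Type u) (C : Type v) [Field k] [AddCommGroup C] [Module k C]
    [NUCoalgebra k C] : Prop :=
  Function.Injective (faceSum (NUCoalgebra.comul (k := k) (C := C)) NUCoalgebra.comul 0) ∧
    ∀ n : ℕ, Function.Exact
      (faceSum (NUCoalgebra.comul (k := k) (C := C)) NUCoalgebra.comul n)
      (faceSum (NUCoalgebra.comul (k := k) (C := C)) NUCoalgebra.comul (n + 1))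

/-! ### Actions of a bialgebra -/

section Actions

variable {k : Type u} {B : Type v} [Field k] [Ring B]

/-- `b ↦ φ(b₍₁₎) ψ(b₍₂₎)`. -/
def conv [Bialgebra k B] {A : Type*} [Semiring A] [Algebra k A] (φ ψ : B →ₗ[k] A) : B →ₗ[k] A :=
  LinearMap.mul' k A ∘ₗ TensorProduct.map φ ψ ∘ₗ Coalgebra.comul

variable {V W : Type*} [AddCommMonoid V] [Module k V] [AddCommMonoid W] [Module k W]

/-- `α` acting on the left factor of `V ⊗ W`. -/
def onLeft [Algebra k B] (W : Type*) [AddCommMonoid W] [Module k W]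
    (α : B →ₗ[k] Module.End k V) : B →ₗ[k] Module.End k (V ⊗[k] W) :=
  LinearMap.rTensorHom W ∘ₗ α

/-- `β` acting on the right factor of `V ⊗ W`. -/
def onRight [Algebra k B] (V : Type*) [AddCommMonoid V] [Module k V]
    (β : B →ₗ[k] Module.End k W) : B →ₗ[k] Module.End k (V ⊗[k] W) :=
  LinearMap.lTensorHom V ∘ₗ β

/-- The diagonal action `b (v ⊗ w) = b₍₁₎ v ⊗ b₍₂₎ w`. -/
def diag [Bialgebra k B] (α : B →ₗ[k] Module.End k V) (β : B →ₗ[k] Module.End k W) :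
    B →ₗ[k] Module.End k (V ⊗[k] W) :=
  conv (onLeft W α) (onRight V β)

/-- The opposite diagonal action `b (v ⊗ w) = b₍₂₎ v ⊗ b₍₁₎ w`. -/
def diagOp [Bialgebra k B] (α : B →ₗ[k] Module.End k V) (β : B →ₗ[k] Module.End k W) :
    B →ₗ[k] Module.End k (V ⊗[k] W) :=
  conv (onRight V β) (onLeft W α)

/-- The action map `b ↦ L_b` of a `B`-module. -/
def smulAct (k : Type u) (B : Type v) [Field k] [Ring B] [Algebra k B] (V : Type*)
    [AddCommMonoid V] [Module k V] [Module B V] [IsScalarTower k B V] :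
    B →ₗ[k] Module.End k V :=
  (Algebra.lsmul k k V).toLinearMap

/-- The kernel of `V → k ⊗_B V`, spanned by the elements `b v - ε(b) v`. -/
def coinvKer [Bialgebra k B] {V : Type*} [AddCommGroup V] [Module k V] (α : B →ₗ[k] Module.End k V) : Submodule k V :=
  Submodule.span k {y | ∃ (b : B) (v : V), y = α b v - Coalgebra.counit (R := k) b • v}

/-- `k ⊗_B V`, where `k` is a right `B`-module through the counit and `B` acts on `V` by `α`. -/
abbrev Coinv [Bialgebra k B] {V : Type*} [AddCommGroup V] [Module k V]
    (α : B →ₗ[k] Module.End k V) : Type _ := V ⧸ coinvKer α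

/-- The diagonal action of `B` on `M ⊗ C^{⊗n}`. -/
def towerAct [Bialgebra k B] {M C : Type v} [AddCommGroup M] [Module k M] [AddCommGroup C]
    [Module k C] (α : B →ₗ[k] Module.End k M) (β : B →ₗ[k] Module.End k C) :
    (n : ℕ) → (B →ₗ[k] Module.End k (tower k M C n))
  | 0 => α
  | n + 1 => (diag (towerAct α β n) β : B →ₗ[k] Module.End k (tower k M C n ⊗[k] C))

end Actions

/-! ### Module coalgebras, equivariant bicomodules, anti-Yetter-Drinfeld modules -/

section Structures

variable (k : Type u) (B : Type v) [Field k] [Ring B]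

/-- A left `B`-module `C`, which is a coalgebra, is a `B`-module coalgebra if its comultiplication
is `B`-linear. -/
class ModuleCoalgebra [Bialgebra k B] (C : Type v) [AddCommGroup C] [Module k C] [Module B C]
    [IsScalarTower k B C] [NUCoalgebra k C] : Prop where
  comul_smul : ∀ (b : B) (c : C), NUCoalgebra.comul (k := k) (b • c) =
    diag (smulAct k B C) (smulAct k B C) b (NUCoalgebra.comul (k := k) c)

/-- Morphisms of `B`-module coalgebras. -/
structure ModuleCoalgebraHom [Algebra k B] (C D : Type v)
    [AddCommGroup C] [Module k C] [Module B C] [IsScalarTower k B C] [NUCoalgebra k C]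
    [AddCommGroup D] [Module k D] [Module B D] [IsScalarTower k B D] [NUCoalgebra k D]
    extends C →ₗ[B] D where
  map_comul : ∀ c : C, NUCoalgebra.comul (k := k) (toLinearMap c) =
    TensorProduct.map (toLinearMap.restrictScalars k) (toLinearMap.restrictScalars k)
      (NUCoalgebra.comul (k := k) c)

/-- The underlying `k`-linear map. -/
def ModuleCoalgebraHom.lin {k : Type u} {B : Type v} [Field k] [Ring B] [Algebra k B]
    {C D : Type v}
    [AddCommGroup C] [Module k C] [Module B C] [IsScalarTower k B C] [NUCoalgebra k C]
    [AddCommGroup D] [Module k D] [Module B D] [IsScalarTower k B D] [NUCoalgebra k D]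
    (f : ModuleCoalgebraHom k B C D) : C →ₗ[k] D :=
  f.toLinearMap.restrictScalars k

/-- A `B`-equivariant `C`-bicomodule structure on the left `B`-module `M`. -/
structure EquivariantBicomodule [Bialgebra k B] (C M : Type v)
    [AddCommGroup C] [Module k C] [Module B C] [IsScalarTower k B C] [NUCoalgebra k C]
    [AddCommGroup M] [Module k M] [Module B M] [IsScalarTower k B M] where
  coactL : M →ₗ[k] C ⊗[k] M
  coactR : M →ₗ[k] M ⊗[k] C
  coassocL : (TensorProduct.assoc k C C M).toLinearMap ∘ₗ NUCoalgebra.comul.rTensor M ∘ₗ coactL =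
    coactL.lTensor C ∘ₗ coactL
  coassocR : (TensorProduct.assoc k M C C).toLinearMap ∘ₗ coactR.rTensor C ∘ₗ coactR =
    NUCoalgebra.comul.lTensor M ∘ₗ coactR
  coactLR : (TensorProduct.assoc k C M C).toLinearMap ∘ₗ coactL.rTensor C ∘ₗ coactR =
    coactR.lTensor C ∘ₗ coactL
  coactL_smul : ∀ (b : B) (m : M),
    coactL (b • m) = diag (smulAct k B C) (smulAct k B M) b (coactL m)
  coactR_smul : ∀ (b : B) (m : M),
    coactR (b • m) = diag (smulAct k B M) (smulAct k B C) b (coactR m)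

/-- `C` as a bicomodule over itself. -/
def EquivariantBicomodule.self [Bialgebra k B] (C : Type v)
    [AddCommGroup C] [Module k C] [Module B C] [IsScalarTower k B C] [NUCoalgebra k C]
    [ModuleCoalgebra k B C] : EquivariantBicomodule k B C C where
  coactL := NUCoalgebra.comul
  coactR := NUCoalgebra.comul
  coassocL := NUCoalgebra.coassoc
  coassocR := NUCoalgebra.coassoc
  coactLR := NUCoalgebra.coassoc
  coactL_smul := ModuleCoalgebra.comul_smul
  coactR_smul := ModuleCoalgebra.comul_smul

/-- A left `B`-comodule structure on `X`. -/
structure LeftComodule [Bialgebra k B] (X : Type v) [AddCommGroup X] [Module k X] where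
  coact : X →ₗ[k] B ⊗[k] X
  coassoc : (TensorProduct.assoc k B B X).toLinearMap ∘ₗ
      (Coalgebra.comul (R := k) (A := B)).rTensor X ∘ₗ coact = coact.lTensor B ∘ₗ coact
  counit_coact : ∀ x : X, TensorProduct.lid k X
    ((Coalgebra.counit (R := k) (A := B)).rTensor X (coact x)) = x

/-- The inverse `S⁻¹` of a bijective antipode. -/
def antipodeInv [HopfAlgebra k B] (hS : Function.Bijective (HopfAlgebra.antipode k (A := B))) :
    B →ₗ[k] B :=
  (LinearEquiv.ofBijective (HopfAlgebra.antipode k (A := B)) hS).symm.toLinearMap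

/-- Left multiplication `b ↦ (y ↦ b y)`. -/
def mulL [Algebra k B] : B →ₗ[k] Module.End k B := LinearMap.mul k B

/-- `b ↦ (y ↦ y S⁻¹(b))`. -/
def mulRInv [HopfAlgebra k B] (hS : Function.Bijective (HopfAlgebra.antipode k (A := B))) :
    B →ₗ[k] Module.End k B := (LinearMap.mul k B).flip ∘ₗ antipodeInv k B hS

/-- The map `b ↦ (y ⊗ x ↦ b₍₁₎ y S⁻¹(b₍₃₎) ⊗ b₍₂₎ x)` of `B` into the endomorphisms
of `B ⊗ X`. -/
def aydAct [HopfAlgebra k B] (hS : Function.Bijective (HopfAlgebra.antipode k (A := B)))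
    (X : Type v) [AddCommGroup X] [Module k X] [Module B X] [IsScalarTower k B X] :
    B →ₗ[k] Module.End k (B ⊗[k] X) :=
  conv (diag (mulL k B) (smulAct k B X)) (onLeft X (mulRInv k B hS))

/-- An anti-Yetter-Drinfeld module structure on the left `B`-module `X`: a left coaction with
`(b x)₍₋₁₎ ⊗ (b x)₍₀₎ = b₍₁₎ x₍₋₁₎ S⁻¹(b₍₃₎) ⊗ b₍₂₎ x₍₀₎`. -/
structure AntiYetterDrinfeld [HopfAlgebra k B]
    (hS : Function.Bijective (HopfAlgebra.antipode k (A := B)))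
    (X : Type v) [AddCommGroup X] [Module k X] [Module B X] [IsScalarTower k B X]
    extends LeftComodule k B X where
  coact_smul : ∀ (b : B) (x : X), coact (b • x) = aydAct k B hS X b (coact x)

end Structures

/-! ### Elementary facts on convolution -/

section ConvFacts

variable {k : Type u} {B : Type v} [Field k] [Ring B]

theorem conv_assoc [Bialgebra k B] {A : Type*} [Semiring A] [Algebra k A] (f g h : B →ₗ[k] A) :
    conv (conv f g) h = conv f (conv g h) := by
  have := _root_.mul_assoc (WithConv.toConv f) (WithConv.toConv g) (WithConv.toConv h)
  exact congrArg WithConv.ofConv this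

variable {V W V' W' : Type*} [AddCommMonoid V] [Module k V] [AddCommMonoid W] [Module k W]
  [AddCommMonoid V'] [Module k V'] [AddCommMonoid W'] [Module k W']

theorem conv_tw [Bialgebra k B] {φ ψ : B →ₗ[k] Module.End k V} {φ' ψ' : B →ₗ[k] Module.End k W}
    (f : V →ₗ[k] W) (h1 : ∀ b, f ∘ₗ φ b = φ' b ∘ₗ f) (h2 : ∀ b, f ∘ₗ ψ b = ψ' b ∘ₗ f) (b : B) :
    f ∘ₗ conv φ ψ b = conv φ' ψ' b ∘ₗ f := by
  simp only [conv, LinearMap.comp_apply]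
  induction (Coalgebra.comul (R := k) b) with
  | zero => simp
  | add x y hx hy => simp only [map_add, LinearMap.comp_add, LinearMap.add_comp, hx, hy]
  | tmul p q =>
    simp only [TensorProduct.map_tmul, LinearMap.mul'_apply, Module.End.mul_eq_comp]
    rw [← LinearMap.comp_assoc, h1, LinearMap.comp_assoc, h2, LinearMap.comp_assoc]

theorem onLeft_conv [Bialgebra k B] (α β : B →ₗ[k] Module.End k V) :
    onLeft W (conv α β) = conv (onLeft W α) (onLeft W β) := by
  ext1 b
  simp only [conv, onLeft, LinearMap.comp_apply]
  induction (Coalgebra.comul (R := k) b) with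
  | zero => simp
  | add x y hx hy => simp only [map_add, hx, hy]
  | tmul p q =>
    simp only [TensorProduct.map_tmul, LinearMap.mul'_apply, LinearMap.comp_apply]
    exact LinearMap.rTensor_mul W _ _

theorem onRight_conv [Bialgebra k B] (α β : B →ₗ[k] Module.End k W) :
    onRight V (conv α β) = conv (onRight V α) (onRight V β) := by
  ext1 b
  simp only [conv, onRight, LinearMap.comp_apply]
  induction (Coalgebra.comul (R := k) b) with
  | zero => simp
  | add x y hx hy => simp only [map_add, hx, hy]
  | tmul p q =>
    simp only [TensorProduct.map_tmul, LinearMap.mul'_apply, LinearMap.comp_apply]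
    exact LinearMap.lTensor_mul V _ _

theorem diag_tw [Bialgebra k B] {α : B →ₗ[k] Module.End k V} {β : B →ₗ[k] Module.End k W}
    {α' : B →ₗ[k] Module.End k V'} {β' : B →ₗ[k] Module.End k W'} {f : V →ₗ[k] V'}
    {g : W →ₗ[k] W'} (h1 : ∀ b, f ∘ₗ α b = α' b ∘ₗ f) (h2 : ∀ b, g ∘ₗ β b = β' b ∘ₗ g) (b : B) :
    TensorProduct.map f g ∘ₗ diag α β b = diag α' β' b ∘ₗ TensorProduct.map f g := by
  refine conv_tw _ (fun c => ?_) (fun c => ?_) b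
  · ext v w; simpa [onLeft] using congrArg (· ⊗ₜ[k] g w) (LinearMap.congr_fun (h1 c) v)
  · ext v w; simpa [onRight] using congrArg (f v ⊗ₜ[k] ·) (LinearMap.congr_fun (h2 c) w)

theorem diagOp_tw [Bialgebra k B] {α : B →ₗ[k] Module.End k V} {β : B →ₗ[k] Module.End k W}
    {α' : B →ₗ[k] Module.End k V'} {β' : B →ₗ[k] Module.End k W'} {f : V →ₗ[k] V'}
    {g : W →ₗ[k] W'} (h1 : ∀ b, f ∘ₗ α b = α' b ∘ₗ f) (h2 : ∀ b, g ∘ₗ β b = β' b ∘ₗ g) (b : B) :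
    TensorProduct.map f g ∘ₗ diagOp α β b = diagOp α' β' b ∘ₗ TensorProduct.map f g := by
  refine conv_tw _ (fun c => ?_) (fun c => ?_) b
  · ext v w; simpa [onRight] using congrArg (f v ⊗ₜ[k] ·) (LinearMap.congr_fun (h2 c) w)
  · ext v w; simpa [onLeft] using congrArg (· ⊗ₜ[k] g w) (LinearMap.congr_fun (h1 c) v)

theorem diag_assoc [Bialgebra k B] (α : B →ₗ[k] Module.End k V) (β : B →ₗ[k] Module.End k W)
    (γ : B →ₗ[k] Module.End k V') (b : B) :
    (TensorProduct.assoc k V W V').toLinearMap ∘ₗ diag (diag α β) γ b =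
      diag α (diag β γ) b ∘ₗ (TensorProduct.assoc k V W V').toLinearMap := by
  simp only [diag, onLeft_conv, onRight_conv]
  rw [conv_assoc]
  refine conv_tw _ (fun c => ?_) (fun c => conv_tw _ (fun c => ?_) (fun c => ?_) c) b <;>
  · apply TensorProduct.ext_threefold
    intro x y z
    simp [onLeft, onRight]

end ConvFacts

/-! ### Elementary facts on the tower -/

section TowerFacts

variable {k : Type u} [Field k] {C V : Type v} [AddCommGroup C] [Module k C]
  [AddCommGroup V] [Module k V] {Δ : C →ₗ[k] C ⊗[k] C}

theorem step_coassoc (l : V →ₗ[k] C ⊗[k] V)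
    (h : (TensorProduct.assoc k C C V).toLinearMap ∘ₗ Δ.rTensor V ∘ₗ l = l.lTensor C ∘ₗ l) :
    (TensorProduct.assoc k C C (V ⊗[k] C)).toLinearMap ∘ₗ Δ.rTensor (V ⊗[k] C) ∘ₗ
      ((TensorProduct.assoc k C V C).toLinearMap ∘ₗ l.rTensor C) =
    ((TensorProduct.assoc k C V C).toLinearMap ∘ₗ l.rTensor C).lTensor C ∘ₗ
      ((TensorProduct.assoc k C V C).toLinearMap ∘ₗ l.rTensor C) := by
  have e1 : (TensorProduct.assoc k C C (V ⊗[k] C)).toLinearMap ∘ₗ Δ.rTensor (V ⊗[k] C) ∘ₗ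
      (TensorProduct.assoc k C V C).toLinearMap =
      (TensorProduct.assoc k C V C).toLinearMap.lTensor C ∘ₗ
      (TensorProduct.assoc k C (C ⊗[k] V) C).toLinearMap ∘ₗ
      ((TensorProduct.assoc k C C V).toLinearMap ∘ₗ Δ.rTensor V).rTensor C := by
    apply TensorProduct.ext_threefold
    intro x y z
    simp only [LinearMap.comp_apply, LinearEquiv.coe_coe, TensorProduct.assoc_tmul,
      LinearMap.rTensor_tmul]
    induction Δ x with
    | zero => simp
    | add p q hp hq => simp only [TensorProduct.add_tmul, map_add, hp, hq]
    | tmul p q => simp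
  have e2 : (TensorProduct.assoc k C V C).toLinearMap.lTensor C ∘ₗ
      (TensorProduct.assoc k C (C ⊗[k] V) C).toLinearMap ∘ₗ (l.lTensor C).rTensor C =
      ((TensorProduct.assoc k C V C).toLinearMap ∘ₗ l.rTensor C).lTensor C ∘ₗ
      (TensorProduct.assoc k C V C).toLinearMap := by
    apply TensorProduct.ext_threefold
    intro x y z
    simp
  calc _ = ((TensorProduct.assoc k C C (V ⊗[k] C)).toLinearMap ∘ₗ Δ.rTensor (V ⊗[k] C) ∘ₗ
      (TensorProduct.assoc k C V C).toLinearMap) ∘ₗ l.rTensor C := rfl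
    _ = (TensorProduct.assoc k C V C).toLinearMap.lTensor C ∘ₗ
      (TensorProduct.assoc k C (C ⊗[k] V) C).toLinearMap ∘ₗ
      (((TensorProduct.assoc k C C V).toLinearMap ∘ₗ Δ.rTensor V) ∘ₗ l).rTensor C := by
        rw [e1, LinearMap.rTensor_comp _ _ l]; rfl
    _ = ((TensorProduct.assoc k C V C).toLinearMap.lTensor C ∘ₗ
      (TensorProduct.assoc k C (C ⊗[k] V) C).toLinearMap ∘ₗ (l.lTensor C).rTensor C) ∘ₗ
        l.rTensor C := by
        rw [LinearMap.comp_assoc, h, LinearMap.rTensor_comp]; rfl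
    _ = _ := by rw [e2]; rfl

theorem step_coact_face (s : k) (l : V →ₗ[k] C ⊗[k] V) (d : V →ₗ[k] V ⊗[k] C)
    (h : ((TensorProduct.assoc k C V C).toLinearMap ∘ₗ l.rTensor C) ∘ₗ d = d.lTensor C ∘ₗ l) :
    ((TensorProduct.assoc k C (V ⊗[k] C) C).toLinearMap ∘ₗ
      ((TensorProduct.assoc k C V C).toLinearMap ∘ₗ l.rTensor C).rTensor C) ∘ₗ
      faceStep V Δ s d =
    (faceStep V Δ s d).lTensor C ∘ₗ ((TensorProduct.assoc k C V C).toLinearMap ∘ₗ l.rTensor C) := by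
  have e1 : ((TensorProduct.assoc k C (V ⊗[k] C) C).toLinearMap ∘ₗ
      ((TensorProduct.assoc k C V C).toLinearMap ∘ₗ l.rTensor C).rTensor C) ∘ₗ d.rTensor C =
      (d.rTensor C).lTensor C ∘ₗ
        ((TensorProduct.assoc k C V C).toLinearMap ∘ₗ l.rTensor C) := by
    rw [LinearMap.comp_assoc, ← LinearMap.rTensor_comp, h]
    apply TensorProduct.ext'
    intro v c
    simp only [LinearMap.comp_apply, LinearEquiv.coe_coe, LinearMap.rTensor_tmul]
    induction l v with
    | zero => simp
    | add p q hp hq => simp only [TensorProduct.add_tmul, map_add, hp, hq]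
    | tmul p q => simp
  have e2 : ((TensorProduct.assoc k C (V ⊗[k] C) C).toLinearMap ∘ₗ
      ((TensorProduct.assoc k C V C).toLinearMap ∘ₗ l.rTensor C).rTensor C) ∘ₗ splitLast V Δ =
      (splitLast V Δ).lTensor C ∘ₗ
        ((TensorProduct.assoc k C V C).toLinearMap ∘ₗ l.rTensor C) := by
    apply TensorProduct.ext'
    intro v c
    simp only [LinearMap.comp_apply, LinearEquiv.coe_coe, LinearMap.rTensor_tmul, splitLast,
      LinearMap.lTensor_tmul]
    have a : ∀ t : C ⊗[k] V, ∀ r : C ⊗[k] C, (LinearMap.lTensor C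
        (TensorProduct.assoc k V C C).symm.toLinearMap) (TensorProduct.assoc k C V (C ⊗[k] C)
          (t ⊗ₜ[k] r)) = TensorProduct.assoc k C (V ⊗[k] C) C
          (((TensorProduct.assoc k C V C).toLinearMap.rTensor C)
          ((TensorProduct.assoc k (C ⊗[k] V) C C).symm (t ⊗ₜ[k] r))) := by
      intro t r
      induction t with
      | zero => simp
      | add p q hp hq => simp only [TensorProduct.add_tmul, map_add, hp, hq]
      | tmul p q =>
        induction r with
        | zero => simp
        | add p q hp hq => simp only [TensorProduct.tmul_add, map_add, hp, hq]
        | tmul p q => simp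
    have b : ∀ t : C ⊗[k] V, (LinearMap.lTensor C ((TensorProduct.assoc k V C C).symm.toLinearMap
        ∘ₗ Δ.lTensor V)) (TensorProduct.assoc k C V C (t ⊗ₜ[k] c)) = (LinearMap.lTensor C
        (TensorProduct.assoc k V C C).symm.toLinearMap) (TensorProduct.assoc k C V (C ⊗[k] C)
          (t ⊗ₜ[k] Δ c)) := by
      intro t
      induction t with
      | zero => simp
      | add p q hp hq => simp only [TensorProduct.add_tmul, map_add, hp, hq]
      | tmul p q => simp
    rw [b, a]
    congr 1
    induction Δ c with
    | zero => simp
    | add p q hp hq => simp only [TensorProduct.tmul_add, map_add, hp, hq]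
    | tmul p q => simp
  simp only [faceStep, LinearMap.comp_add, LinearMap.comp_smul, LinearMap.lTensor_add,
    LinearMap.lTensor_smul, LinearMap.add_comp, LinearMap.smul_comp, e1, e2]

theorem splitLast_nat {W : Type v} [AddCommGroup W] [Module k W] (d : V →ₗ[k] W) :
    (d.rTensor C).rTensor C ∘ₗ splitLast V Δ = splitLast W Δ ∘ₗ d.rTensor C := by
  apply TensorProduct.ext'
  intro v c
  simp only [LinearMap.comp_apply, LinearEquiv.coe_coe, LinearMap.rTensor_tmul, splitLast,
    LinearMap.lTensor_tmul]
  induction Δ c with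
  | zero => simp
  | add p q hp hq => simp only [TensorProduct.tmul_add, map_add, hp, hq]
  | tmul p q => simp

theorem splitLast_coassoc
    (hΔ : (TensorProduct.assoc k C C C).toLinearMap ∘ₗ Δ.rTensor C ∘ₗ Δ = Δ.lTensor C ∘ₗ Δ) :
    (splitLast V Δ).rTensor C ∘ₗ splitLast V Δ = splitLast (V ⊗[k] C) Δ ∘ₗ splitLast V Δ := by
  apply TensorProduct.ext'
  intro v c
  have h := LinearMap.congr_fun hΔ c
  simp only [LinearMap.comp_apply, LinearEquiv.coe_coe] at h
  simp only [LinearMap.comp_apply, LinearEquiv.coe_coe, splitLast, LinearMap.lTensor_tmul]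
  let g : C ⊗[k] (C ⊗[k] C) →ₗ[k] ((V ⊗[k] C) ⊗[k] C) ⊗[k] C :=
    (TensorProduct.assoc k (V ⊗[k] C) C C).symm.toLinearMap ∘ₗ
      (TensorProduct.assoc k V C (C ⊗[k] C)).symm.toLinearMap ∘ₗ
      TensorProduct.mk k V (C ⊗[k] (C ⊗[k] C)) v
  have a : ∀ t : C ⊗[k] C, (LinearMap.rTensor C ((TensorProduct.assoc k V C C).symm.toLinearMap ∘ₗ
      Δ.lTensor V)) ((TensorProduct.assoc k V C C).symm (v ⊗ₜ[k] t)) =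
      g (TensorProduct.assoc k C C C (Δ.rTensor C t)) := by
    intro t
    induction t with
    | zero => simp
    | add p q hp hq => simp only [TensorProduct.tmul_add, map_add, hp, hq]
    | tmul p q =>
      simp only [TensorProduct.assoc_symm_tmul, LinearMap.rTensor_tmul, LinearMap.comp_apply,
        LinearMap.lTensor_tmul, LinearEquiv.coe_coe]
      induction Δ p with
      | zero => simp
      | add p q hp hq => simp only [TensorProduct.tmul_add, TensorProduct.add_tmul, map_add, hp, hq]
      | tmul p q => simp [g]
  have b : ∀ t : C ⊗[k] C, (TensorProduct.assoc k (V ⊗[k] C) C C).symm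
      ((Δ.lTensor (V ⊗[k] C)) ((TensorProduct.assoc k V C C).symm (v ⊗ₜ[k] t))) =
      g (Δ.lTensor C t) := by
    intro t
    induction t with
    | zero => simp
    | add p q hp hq => simp only [TensorProduct.tmul_add, map_add, hp, hq]
    | tmul p q =>
      simp only [TensorProduct.assoc_symm_tmul, LinearMap.lTensor_tmul]
      induction Δ q with
      | zero => simp
      | add p q hp hq => simp only [TensorProduct.tmul_add, map_add, hp, hq]
      | tmul p q => simp [g]
  rw [a, b, h]

theorem faceStep_sq (s : k)
    (hΔ : (TensorProduct.assoc k C C C).toLinearMap ∘ₗ Δ.rTensor C ∘ₗ Δ = Δ.lTensor C ∘ₗ Δ)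
    (d : V →ₗ[k] V ⊗[k] C) (h : faceStep V Δ s d ∘ₗ d = 0) :
    faceStep (V ⊗[k] C) Δ (-s) (faceStep V Δ s d) ∘ₗ faceStep V Δ s d = 0 := by
  have h1 : (faceStep V Δ s d).rTensor C ∘ₗ d.rTensor C = 0 := by
    rw [← LinearMap.rTensor_comp, h, LinearMap.rTensor_zero]
  have h2 : (faceStep V Δ s d).rTensor C ∘ₗ splitLast V Δ =
      splitLast (V ⊗[k] C) Δ ∘ₗ faceStep V Δ s d := by
    simp only [faceStep, LinearMap.rTensor_add, LinearMap.rTensor_smul, LinearMap.add_comp,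
      LinearMap.comp_add, LinearMap.smul_comp, LinearMap.comp_smul, splitLast_coassoc hΔ,
      splitLast_nat]
  calc _ = (faceStep V Δ s d).rTensor C ∘ₗ (d.rTensor C + s • splitLast V Δ) +
        (-s) • (splitLast (V ⊗[k] C) Δ ∘ₗ faceStep V Δ s d) := rfl
    _ = 0 := by
      rw [LinearMap.comp_add, h1, LinearMap.comp_smul, h2, zero_add, ← add_smul, add_neg_cancel,
        zero_smul]

variable {M : Type v} [AddCommGroup M] [Module k M]

theorem faceSum_sq
    (hΔ : (TensorProduct.assoc k C C C).toLinearMap ∘ₗ Δ.rTensor C ∘ₗ Δ = Δ.lTensor C ∘ₗ Δ)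
    (ρ : M →ₗ[k] M ⊗[k] C)
    (hρ : (TensorProduct.assoc k M C C).toLinearMap ∘ₗ ρ.rTensor C ∘ₗ ρ = Δ.lTensor M ∘ₗ ρ)
    (n : ℕ) : faceSum ρ Δ (n + 1) ∘ₗ faceSum ρ Δ n = 0 := by
  induction n with
  | zero =>
    change faceStep M Δ ((-1) ^ (0 + 1)) ρ ∘ₗ ρ = 0
    have : splitLast M Δ ∘ₗ ρ = ρ.rTensor C ∘ₗ ρ := by
      rw [splitLast, LinearMap.comp_assoc, ← hρ, ← LinearMap.comp_assoc,
        LinearEquiv.symm_comp, LinearMap.id_comp]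
    rw [faceStep, LinearMap.add_comp, LinearMap.smul_comp, this]
    calc _ = (1 : k) • (ρ.rTensor C ∘ₗ ρ) + (-1 : k) ^ (0 + 1) • (ρ.rTensor C ∘ₗ ρ) := by
          rw [one_smul]
      _ = 0 := by
          rw [← add_smul]
          simp
  | succ n ih =>
    have := faceStep_sq (V := tower k M C n) ((-1) ^ (n + 1)) hΔ (faceSum ρ Δ n) ih
    have e : (-1 : k) ^ (n + 1 + 1) = - (-1) ^ (n + 1) := by rw [pow_succ]; simp
    change faceStep _ Δ ((-1) ^ (n + 1 + 1)) _ ∘ₗ _ = 0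
    rw [e]
    exact this

theorem towerCoact_coassoc (l : M →ₗ[k] C ⊗[k] M)
    (h : (TensorProduct.assoc k C C M).toLinearMap ∘ₗ Δ.rTensor M ∘ₗ l = l.lTensor C ∘ₗ l)
    (n : ℕ) :
    (TensorProduct.assoc k C C (tower k M C n)).toLinearMap ∘ₗ Δ.rTensor (tower k M C n) ∘ₗ
      towerCoact l n = (towerCoact l n).lTensor C ∘ₗ towerCoact l n := by
  induction n with
  | zero => exact h
  | succ n ih => exact step_coassoc (V := tower k M C n) (towerCoact l n) ih

theorem towerCoact_face (l : M →ₗ[k] C ⊗[k] M) (ρ : M →ₗ[k] M ⊗[k] C)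
    (h : (TensorProduct.assoc k C M C).toLinearMap ∘ₗ l.rTensor C ∘ₗ ρ = ρ.lTensor C ∘ₗ l)
    (n : ℕ) :
    towerCoact l (n + 1) ∘ₗ faceSum ρ Δ n = (faceSum ρ Δ n).lTensor C ∘ₗ towerCoact l n := by
  induction n with
  | zero => exact h
  | succ n ih =>
    exact step_coact_face (V := tower k M C n) ((-1) ^ (n + 1)) (towerCoact l n) (faceSum ρ Δ n) ih

variable {B : Type v} [Ring B] [Bialgebra k B]

theorem splitLast_tw {α : B →ₗ[k] Module.End k V} {β : B →ₗ[k] Module.End k C}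
    (hΔ : ∀ b, Δ ∘ₗ β b = diag β β b ∘ₗ Δ) (b : B) :
    splitLast V Δ ∘ₗ diag α β b = diag (diag α β) β b ∘ₗ splitLast V Δ := by
  have h1 : Δ.lTensor V ∘ₗ diag α β b = diag α (diag β β) b ∘ₗ Δ.lTensor V :=
    diag_tw (f := LinearMap.id) (fun _ => rfl) hΔ b
  have h2 := diag_assoc α β β b
  rw [splitLast, LinearMap.comp_assoc, h1, ← LinearMap.comp_assoc, ← LinearMap.comp_assoc]
  congr 1
  rw [LinearEquiv.toLinearMap_symm_comp_eq, ← LinearMap.comp_assoc, h2, LinearMap.comp_assoc,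
    LinearEquiv.comp_symm, LinearMap.comp_id]

theorem faceSum_tw {α : B →ₗ[k] Module.End k M} {β : B →ₗ[k] Module.End k C}
    (hΔ : ∀ b, Δ ∘ₗ β b = diag β β b ∘ₗ Δ) {ρ : M →ₗ[k] M ⊗[k] C}
    (hρ : ∀ b, ρ ∘ₗ α b = diag α β b ∘ₗ ρ) (n : ℕ) (b : B) :
    faceSum ρ Δ n ∘ₗ towerAct α β n b = towerAct α β (n + 1) b ∘ₗ faceSum ρ Δ n := by
  induction n generalizing b with
  | zero => exact hρ b
  | succ n ih =>
    change faceStep (tower k M C n) Δ ((-1) ^ (n + 1)) (faceSum ρ Δ n) ∘ₗ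
      diag (towerAct α β n) β b = diag (diag (towerAct α β n) β) β b ∘ₗ
      faceStep (tower k M C n) Δ ((-1) ^ (n + 1)) (faceSum ρ Δ n)
    have h1 : (faceSum ρ Δ n).rTensor C ∘ₗ diag (towerAct α β n) β b =
        diag (diag (towerAct α β n) β) β b ∘ₗ (faceSum ρ Δ n).rTensor C :=
      diag_tw (g := LinearMap.id) ih (fun _ => rfl) b
    have h2 := splitLast_tw (α := towerAct α β n) hΔ b
    simp only [faceStep, LinearMap.comp_add, LinearMap.add_comp, LinearMap.comp_smul,
      LinearMap.smul_comp]
    exact congrArg₂ (· + ·) h1 (congrArg _ h2)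

theorem towerCoact_tw {α : B →ₗ[k] Module.End k M} {β : B →ₗ[k] Module.End k C}
    {l : M →ₗ[k] C ⊗[k] M} (hl : ∀ b, l ∘ₗ α b = diag β α b ∘ₗ l) (n : ℕ) (b : B) :
    towerCoact l n ∘ₗ towerAct α β n b = diag β (towerAct α β n) b ∘ₗ towerCoact l n := by
  induction n generalizing b with
  | zero => exact hl b
  | succ n ih =>
    change ((TensorProduct.assoc k C (tower k M C n) C).toLinearMap ∘ₗ
      (towerCoact l n).rTensor C) ∘ₗ diag (towerAct α β n) β b =
      diag β (diag (towerAct α β n) β) b ∘ₗ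
      ((TensorProduct.assoc k C (tower k M C n) C).toLinearMap ∘ₗ (towerCoact l n).rTensor C)
    have h1 : (towerCoact l n).rTensor C ∘ₗ diag (towerAct α β n) β b =
        diag (diag β (towerAct α β n)) β b ∘ₗ (towerCoact l n).rTensor C :=
      diag_tw (g := LinearMap.id) ih (fun _ => rfl) b
    rw [LinearMap.comp_assoc, h1, ← LinearMap.comp_assoc, diag_assoc, LinearMap.comp_assoc]

theorem towerMap_tw {D : Type v} [AddCommGroup D] [Module k D] {α : B →ₗ[k] Module.End k M}
    {β : B →ₗ[k] Module.End k D} {β' : B →ₗ[k] Module.End k C} {f : D →ₗ[k] C}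
    (hf : ∀ b, f ∘ₗ β b = β' b ∘ₗ f) (n : ℕ) (b : B) :
    towerMap (M := M) f n ∘ₗ towerAct α β n b = towerAct α β' n b ∘ₗ towerMap f n := by
  induction n generalizing b with
  | zero => rfl
  | succ n ih => exact diag_tw ih hf b

theorem towerMap_face {D : Type v} [AddCommGroup D] [Module k D] {f : D →ₗ[k] C}
    {Δ' : D →ₗ[k] D ⊗[k] D} (hf : Δ ∘ₗ f = TensorProduct.map f f ∘ₗ Δ') (ρ : M →ₗ[k] M ⊗[k] D)
    (n : ℕ) : towerMap f (n + 1) ∘ₗ faceSum ρ Δ' n =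
      faceSum (f.lTensor M ∘ₗ ρ) Δ n ∘ₗ towerMap f n := by
  induction n with
  | zero => rfl
  | succ n ih =>
    have h1 : TensorProduct.map (towerMap f (n + 1)) f ∘ₗ (faceSum ρ Δ' n).rTensor D =
      (faceSum (f.lTensor M ∘ₗ ρ) Δ n).rTensor C ∘ₗ TensorProduct.map (towerMap f n) f := by
      apply TensorProduct.ext'
      intro v c
      simpa using congrArg (· ⊗ₜ[k] f c) (LinearMap.congr_fun ih v)
    have h2 : TensorProduct.map (TensorProduct.map (towerMap (M := M) f n) f) f ∘ₗ
        splitLast (tower k M D n) Δ' =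
      splitLast (tower k M C n) Δ ∘ₗ TensorProduct.map (towerMap f n) f := by
      apply TensorProduct.ext'
      intro v c
      have := LinearMap.congr_fun hf c
      simp only [LinearMap.comp_apply] at this
      simp only [LinearMap.comp_apply, splitLast, LinearMap.lTensor_tmul, TensorProduct.map_tmul,
        this]
      induction Δ' c with
      | zero => simp
      | add p q hp hq => simp only [TensorProduct.tmul_add, map_add, hp, hq]
      | tmul p q => simp
    change TensorProduct.map (towerMap f (n + 1)) f ∘ₗ
      faceStep (tower k M D n) Δ' ((-1) ^ (n + 1)) (faceSum ρ Δ' n) =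
      faceStep (tower k M C n) Δ ((-1) ^ (n + 1)) (faceSum (f.lTensor M ∘ₗ ρ) Δ n) ∘ₗ
      TensorProduct.map (towerMap f n) f
    simp only [faceStep, LinearMap.add_comp, LinearMap.smul_comp]
    refine (LinearMap.comp_add _ _ _).trans (congrArg₂ (· + ·) h1 ?_)
    exact (LinearMap.comp_smul _ _ _).trans (congrArg (fun g => (-1 : k) ^ (n + 1) • g) h2)

theorem towerMap_coact {D : Type v} [AddCommGroup D] [Module k D] {f : D →ₗ[k] C}
    (l : M →ₗ[k] D ⊗[k] M) (n : ℕ) :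
    TensorProduct.map f (towerMap f n) ∘ₗ towerCoact l n =
      towerCoact (f.rTensor M ∘ₗ l) n ∘ₗ towerMap f n := by
  induction n with
  | zero => rfl
  | succ n ih =>
    change TensorProduct.map f (TensorProduct.map (towerMap f n) f) ∘ₗ
      ((TensorProduct.assoc k D (tower k M D n) D).toLinearMap ∘ₗ (towerCoact l n).rTensor D) =
      ((TensorProduct.assoc k C (tower k M C n) C).toLinearMap ∘ₗ
        (towerCoact (f.rTensor M ∘ₗ l) n).rTensor C) ∘ₗ TensorProduct.map (towerMap f n) f
    apply TensorProduct.ext'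
    intro v c
    have := LinearMap.congr_fun ih v
    simp only [LinearMap.comp_apply] at this
    simp only [LinearMap.comp_apply, LinearMap.rTensor_tmul, TensorProduct.map_tmul, ← this]
    induction towerCoact l n v with
    | zero => simp
    | add p q hp hq => simp only [TensorProduct.add_tmul, map_add, hp, hq]
    | tmul p q => simp

end TowerFacts

/-! ### The twisted Cartier-Hochschild complex -/

section Twist

variable {k : Type u} [Field k] {B : Type v} [Ring B]

/-- `(y ⊗ x) ⊗ (c ⊗ u) ↦ x ⊗ (u ⊗ y c)`. -/
def shuffle [Algebra k B] (X C U : Type v) [AddCommGroup X] [Module k X] [AddCommGroup C]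
    [Module k C] [Module B C] [IsScalarTower k B C] [AddCommGroup U] [Module k U] :
    (B ⊗[k] X) ⊗[k] (C ⊗[k] U) →ₗ[k] X ⊗[k] (U ⊗[k] C) :=
  (TensorProduct.assoc k X U C).toLinearMap ∘ₗ
    (TensorProduct.comm k C (X ⊗[k] U)).toLinearMap ∘ₗ
    (TensorProduct.lift (smulAct k B C)).rTensor (X ⊗[k] U) ∘ₗ
    (TensorProduct.tensorTensorTensorComm k B X C U).toLinearMap

theorem shuffle_tmul [Algebra k B] {X C U : Type v} [AddCommGroup X] [Module k X] [AddCommGroup C]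
    [Module k C] [Module B C] [IsScalarTower k B C] [AddCommGroup U] [Module k U]
    (y : B) (x : X) (c : C) (w : U) :
    shuffle (k := k) X C U ((y ⊗ₜ x) ⊗ₜ (c ⊗ₜ w)) = x ⊗ₜ (w ⊗ₜ (y • c)) := rfl

theorem antipodeInv_mul_comul [HopfAlgebra k B]
    (hS : Function.Bijective (HopfAlgebra.antipode k (A := B))) (b : B) :
    LinearMap.mul' k B (TensorProduct.comm k B B
      ((antipodeInv k B hS).lTensor B (Coalgebra.comul (R := k) b))) =
      algebraMap k B (Coalgebra.counit (R := k) b) := by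
  apply hS.1
  have hinv : ∀ r, HopfAlgebra.antipode k (antipodeInv k B hS r) = r :=
    fun r => (LinearEquiv.ofBijective _ hS).apply_symm_apply r
  have : ∀ t : B ⊗[k] B, HopfAlgebra.antipode k (LinearMap.mul' k B (TensorProduct.comm k B B
      ((antipodeInv k B hS).lTensor B t))) =
      LinearMap.mul' k B ((HopfAlgebra.antipode k).rTensor B t) := by
    intro t
    induction t with
    | zero => simp
    | add p q hp hq => simp only [map_add, hp, hq]
    | tmul p q =>
      simp [HopfAlgebra.antipode_mul_antidistrib, hinv]
  rw [this, HopfAlgebra.mul_antipode_rTensor_comul_apply, Algebra.algebraMap_eq_smul_one, map_smul,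
    HopfAlgebra.antipode_one]

theorem conv_middle [Bialgebra k B] {Z : Type*} [AddCommMonoid Z] [Module k Z] {Y : Type*}
    [AddCommMonoid Y] [Module k Y] (g : Z →ₗ[k] Y) (P Q R : B →ₗ[k] Module.End k Z)
    (hPQ : ∀ p q, P p ∘ₗ Q q = Q q ∘ₗ P p)
    (hg : ∀ q, g ∘ₗ Q q = Coalgebra.counit (R := k) q • g) (b : B) :
    g ∘ₗ conv P (conv Q R) b = g ∘ₗ conv P R b := by
  have h1 : ∀ p q, g ∘ₗ P p ∘ₗ conv Q R q = g ∘ₗ P p ∘ₗ R q := by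
    intro p q
    have : ∀ t : B ⊗[k] B, g ∘ₗ P p ∘ₗ LinearMap.mul' k (Module.End k Z)
        (TensorProduct.map Q R t) = g ∘ₗ P p ∘ₗ
        R (TensorProduct.lid k B ((Coalgebra.counit (R := k)).rTensor B t)) := by
      intro t
      induction t with
      | zero => simp
      | add x y hx hy => simp only [map_add, LinearMap.comp_add, hx, hy]
      | tmul x y =>
        simp only [TensorProduct.map_tmul, LinearMap.mul'_apply, Module.End.mul_eq_comp,
          LinearMap.rTensor_tmul, TensorProduct.lid_tmul, map_smul, LinearMap.comp_smul]
        rw [← LinearMap.comp_assoc (R y) (Q x) (P p), hPQ, LinearMap.comp_assoc,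
          ← LinearMap.comp_assoc _ _ g, hg, LinearMap.smul_comp]
    have := this (Coalgebra.comul (R := k) q)
    rw [Coalgebra.rTensor_counit_comul] at this
    simpa [conv] using this
  simp only [conv, LinearMap.comp_apply] at h1 ⊢
  induction (Coalgebra.comul (R := k) b) with
  | zero => simp
  | add x y hx hy => simp only [map_add, LinearMap.comp_add, hx, hy]
  | tmul p q => simpa [Module.End.mul_eq_comp] using h1 p q

theorem coinv_mkQ [Bialgebra k B] {V : Type*} [AddCommGroup V] [Module k V]
    (α : B →ₗ[k] Module.End k V) (b : B) :
    (coinvKer α).mkQ ∘ₗ α b = Coalgebra.counit (R := k) b • (coinvKer α).mkQ := by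
  ext v
  simp only [LinearMap.comp_apply, LinearMap.smul_apply, ← map_smul]
  rw [← sub_eq_zero, ← map_sub, Submodule.mkQ_apply, Submodule.Quotient.mk_eq_zero]
  exact Submodule.subset_span ⟨b, v, rfl⟩

theorem shuffle_coinv [HopfAlgebra k B]
    (hS : Function.Bijective (HopfAlgebra.antipode k (A := B)))
    {X C U : Type v} [AddCommGroup X] [Module k X] [Module B X] [IsScalarTower k B X]
    [AddCommGroup C] [Module k C] [Module B C] [IsScalarTower k B C] [AddCommGroup U] [Module k U]
    (α : B →ₗ[k] Module.End k U) (b : B) :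
    (coinvKer (diagOp (smulAct k B X) (diag α (smulAct k B C)))).mkQ ∘ₗ shuffle X C U ∘ₗ
      diagOp (aydAct k B hS X) (diag (smulAct k B C) α) b =
    Coalgebra.counit (R := k) b •
      ((coinvKer (diagOp (smulAct k B X) (diag α (smulAct k B C)))).mkQ ∘ₗ shuffle X C U) := by
  let P1 : B →ₗ[k] Module.End k ((B ⊗[k] X) ⊗[k] (C ⊗[k] U)) :=
    onRight (B ⊗[k] X) (onLeft U (smulAct k B C))
  let P2 : B →ₗ[k] Module.End k ((B ⊗[k] X) ⊗[k] (C ⊗[k] U)) := onRight (B ⊗[k] X) (onRight C α)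
  let L : B →ₗ[k] Module.End k ((B ⊗[k] X) ⊗[k] (C ⊗[k] U)) :=
    onLeft (C ⊗[k] U) (onLeft X (mulL k B))
  let PX : B →ₗ[k] Module.End k ((B ⊗[k] X) ⊗[k] (C ⊗[k] U)) :=
    onLeft (C ⊗[k] U) (onRight B (smulAct k B X))
  let R : B →ₗ[k] Module.End k ((B ⊗[k] X) ⊗[k] (C ⊗[k] U)) :=
    onLeft (C ⊗[k] U) (onLeft X (mulRInv k B hS))
  have e : diagOp (aydAct k B hS X) (diag (smulAct k B C) α) =
      conv P1 (conv (conv P2 (conv L PX)) R) := by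
    simp only [diagOp, aydAct, diag, onLeft_conv, onRight_conv, conv_assoc, P1, P2, L, PX, R]
  have hQ : ∀ q, shuffle X C U ∘ₗ conv P2 (conv L PX) q =
      diagOp (smulAct k B X) (diag α (smulAct k B C)) q ∘ₗ shuffle X C U := by
    intro q
    have : diagOp (smulAct k B X) (diag α (smulAct k B C)) =
      conv (onRight X (onLeft C α)) (conv (onRight X (onRight U (smulAct k B C)))
        (onLeft (U ⊗[k] C) (smulAct k B X))) := by
      simp only [diagOp, diag, onRight_conv, conv_assoc]
    rw [this]
    refine conv_tw _ (fun c => ?_) (fun c => conv_tw _ (fun c => ?_) (fun c => ?_) c) q <;>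
    · ext y x w z
      simp [P2, L, PX, onLeft, onRight, shuffle_tmul, mulL, smulAct, mul_smul]
  set π := (coinvKer (diagOp (smulAct k B X) (diag α (smulAct k B C)))).mkQ with hπ
  have hg : ∀ q, (π ∘ₗ shuffle X C U) ∘ₗ conv P2 (conv L PX) q =
      Coalgebra.counit (R := k) q • (π ∘ₗ shuffle X C U) := by
    intro q
    rw [LinearMap.comp_assoc, hQ, ← LinearMap.comp_assoc, hπ, coinv_mkQ, LinearMap.smul_comp]
  have hPQ : ∀ p q, P1 p ∘ₗ conv P2 (conv L PX) q = conv P2 (conv L PX) q ∘ₗ P1 p := by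
    intro p q
    refine conv_tw _ (fun c => ?_) (fun c => conv_tw _ (fun c => ?_) (fun c => ?_) c) q <;>
    · ext y x w z
      simp [P1, P2, L, PX, onLeft, onRight]
  have hfin : shuffle X C U ∘ₗ conv P1 R b = Coalgebra.counit (R := k) b • shuffle X C U := by
    ext y x w z
    have key : ∀ t : B ⊗[k] B, shuffle X C U ((LinearMap.mul' k (Module.End k _)
        (TensorProduct.map P1 R t)) ((y ⊗ₜ[k] x) ⊗ₜ[k] (w ⊗ₜ[k] z))) =
        x ⊗ₜ[k] (z ⊗ₜ[k] (y • LinearMap.mul' k B (TensorProduct.comm k B B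
      ((antipodeInv k B hS).lTensor B t)) • w)) := by
      intro t
      induction t with
      | zero => simp
      | add p q hp hq => simp only [map_add, LinearMap.add_apply, hp, hq, add_smul, smul_add,
          TensorProduct.tmul_add]
      | tmul p q =>
        simp [P1, R, onLeft, onRight, shuffle_tmul, mulRInv, smulAct, mul_smul]
    have := key (Coalgebra.comul (R := k) b)
    rw [antipodeInv_mul_comul] at this
    simp only [TensorProduct.AlgebraTensorModule.curry_apply, LinearMap.restrictScalars_self,
      TensorProduct.curry_apply, LinearMap.comp_apply, LinearMap.smul_apply]
    refine this.trans ?_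
    rw [shuffle_tmul, algebraMap_smul, smul_comm]
    simp
  have := conv_middle (π ∘ₗ shuffle X C U) P1 (conv P2 (conv L PX)) R hPQ hg b
  rw [e, ← LinearMap.comp_assoc, this, LinearMap.comp_assoc, hfin, LinearMap.comp_smul]

end Twist

section Complex

variable {k : Type u} [Field k] {B : Type v} [Ring B]

theorem diag_smul_tmul [Bialgebra k B] {C : Type v} [AddCommGroup C] [Module k C] [Module B C]
    [IsScalarTower k B C] (y : B) (t : C ⊗[k] C) :
    diag (smulAct k B C) (smulAct k B C) y t =
      TensorProduct.map (TensorProduct.lift (smulAct k B C)) (TensorProduct.lift (smulAct k B C))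
        (TensorProduct.tensorTensorTensorComm k B B C C (Coalgebra.comul (R := k) y ⊗ₜ[k] t)) := by
  simp only [diag, conv, LinearMap.comp_apply]
  induction Coalgebra.comul (R := k) y with
  | zero => simp
  | add p q hp hq => simp only [map_add, TensorProduct.add_tmul, LinearMap.add_apply, hp, hq]
  | tmul p q =>
    induction t with
    | zero => simp
    | add r s hr hs => simp only [map_add, TensorProduct.tmul_add, hr, hs]
    | tmul r s => simp [onLeft, onRight]

/-- A twisted last face `x ⊗ u ↦ x₍₀₎ ⊗ (u₍₀₎ ⊗ x₍₋₁₎ u₍₋₁₎)`, for a left `B`-coaction `r` and a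
left `C`-coaction `l`. -/
def twist [Algebra k B] {X C U : Type v} [AddCommGroup X] [Module k X]
    [AddCommGroup C] [Module k C] [Module B C] [IsScalarTower k B C] [AddCommGroup U] [Module k U]
    (r : X →ₗ[k] B ⊗[k] X) (l : U →ₗ[k] C ⊗[k] U) : X ⊗[k] U →ₗ[k] X ⊗[k] (U ⊗[k] C) :=
  shuffle X C U ∘ₗ TensorProduct.map r l

theorem twist_nat [Algebra k B] {X C D U U' : Type v} [AddCommGroup X] [Module k X]
    [AddCommGroup C] [Module k C] [Module B C] [IsScalarTower k B C]
    [AddCommGroup D] [Module k D] [Module B D] [IsScalarTower k B D] [AddCommGroup U] [Module k U]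
    [AddCommGroup U'] [Module k U']
    (r : X →ₗ[k] B ⊗[k] X) {l : U →ₗ[k] D ⊗[k] U} {l' : U' →ₗ[k] C ⊗[k] U'} {f : D →ₗ[k] C}
    {g : U →ₗ[k] U'} (hf : ∀ (b : B) (c : D), f (b • c) = b • f c)
    (h : TensorProduct.map f g ∘ₗ l = l' ∘ₗ g) :
    twist r l' ∘ₗ g.lTensor X = (TensorProduct.map g f).lTensor X ∘ₗ twist r l := by
  apply TensorProduct.ext'
  intro x w
  have := LinearMap.congr_fun h w
  simp only [LinearMap.comp_apply] at this
  simp only [twist, LinearMap.comp_apply, LinearMap.lTensor_tmul, TensorProduct.map_tmul, ← this]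
  induction r x with
  | zero => simp
  | add p q hp hq => simp only [TensorProduct.add_tmul, map_add, hp, hq]
  | tmul p q =>
    induction l w with
    | zero => simp
    | add p q hp hq => simp only [TensorProduct.tmul_add, map_add, hp, hq]
    | tmul c z => simp [shuffle_tmul, hf]

theorem twist_twist [Bialgebra k B] {X C U : Type v} [AddCommGroup X] [Module k X]
    [AddCommGroup C] [Module k C] [Module B C] [IsScalarTower k B C] [AddCommGroup U] [Module k U]
    {Δ : C →ₗ[k] C ⊗[k] C}
    (hΔ : ∀ (b : B) c, Δ (b • c) = diag (smulAct k B C) (smulAct k B C) b (Δ c))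
    {r : X →ₗ[k] B ⊗[k] X}
    (hr : (TensorProduct.assoc k B B X).toLinearMap ∘ₗ
      (Coalgebra.comul (R := k) (A := B)).rTensor X ∘ₗ r = r.lTensor B ∘ₗ r)
    {l : U →ₗ[k] C ⊗[k] U}
    (hl : (TensorProduct.assoc k C C U).toLinearMap ∘ₗ Δ.rTensor U ∘ₗ l = l.lTensor C ∘ₗ l) :
    (splitLast U Δ).lTensor X ∘ₗ twist r l =
      twist r ((TensorProduct.assoc k C U C).toLinearMap ∘ₗ l.rTensor C) ∘ₗ twist r l := by
  let G : (B ⊗[k] (B ⊗[k] X)) ⊗[k] (C ⊗[k] (C ⊗[k] U)) →ₗ[k] X ⊗[k] ((U ⊗[k] C) ⊗[k] C) :=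
    (TensorProduct.rightComm k U C C).toLinearMap.lTensor X ∘ₗ
    (TensorProduct.assoc k X (U ⊗[k] C) C).toLinearMap ∘ₗ
    (shuffle X C U).rTensor C ∘ₗ
    (TensorProduct.assoc k (B ⊗[k] X) (C ⊗[k] U) C).symm.toLinearMap ∘ₗ
    shuffle (B ⊗[k] X) C (C ⊗[k] U)
  have hG : ∀ (y y' : B) (x : X) (c c' : C) (w : U), G ((y ⊗ₜ (y' ⊗ₜ x)) ⊗ₜ (c ⊗ₜ (c' ⊗ₜ w))) =
      x ⊗ₜ ((w ⊗ₜ (y • c)) ⊗ₜ (y' • c')) := by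
    intros; simp [G, shuffle_tmul]
  have h1 : ∀ (z : B ⊗[k] X) (t : C ⊗[k] U),
      (splitLast U Δ).lTensor X (shuffle X C U (z ⊗ₜ t)) =
      G (TensorProduct.assoc k B B X ((Coalgebra.comul (R := k) (A := B)).rTensor X z) ⊗ₜ
        TensorProduct.assoc k C C U (Δ.rTensor U t)) := by
    intro z t
    induction z with
    | zero => simp
    | add p q hp hq => simp only [TensorProduct.add_tmul, map_add, hp, hq]
    | tmul y x =>
      induction t with
      | zero => simp
      | add p q hp hq => simp only [TensorProduct.tmul_add, map_add, hp, hq]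
      | tmul c w =>
        simp only [shuffle_tmul, LinearMap.lTensor_tmul, splitLast, LinearMap.comp_apply, hΔ,
          LinearMap.rTensor_tmul, diag_smul_tmul]
        induction Coalgebra.comul (R := k) y with
        | zero => simp
        | add p q hp hq => simp only [TensorProduct.add_tmul, TensorProduct.tmul_add, map_add,
            hp, hq]
        | tmul p q =>
          induction Δ c with
          | zero => simp
          | add p q hp hq => simp only [TensorProduct.add_tmul, TensorProduct.tmul_add, map_add,
              hp, hq]
          | tmul c c' => simp [hG, smulAct]
  have h2 : ∀ (z : B ⊗[k] X) (t : C ⊗[k] U),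
      twist r ((TensorProduct.assoc k C U C).toLinearMap ∘ₗ l.rTensor C)
        (shuffle X C U (z ⊗ₜ t)) = G (r.lTensor B z ⊗ₜ l.lTensor C t) := by
    intro z t
    induction z with
    | zero => simp
    | add p q hp hq => simp only [TensorProduct.add_tmul, map_add, hp, hq]
    | tmul y x =>
      induction t with
      | zero => simp
      | add p q hp hq => simp only [TensorProduct.tmul_add, map_add, hp, hq]
      | tmul c w =>
        simp only [shuffle_tmul, LinearMap.lTensor_tmul, twist, LinearMap.comp_apply,
          LinearMap.rTensor_tmul, TensorProduct.map_tmul]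
        induction r x with
        | zero => simp
        | add p q hp hq => simp only [TensorProduct.add_tmul, TensorProduct.tmul_add, map_add,
            hp, hq]
        | tmul p q =>
          induction l w with
          | zero => simp
          | add p q hp hq => simp only [TensorProduct.add_tmul, TensorProduct.tmul_add, map_add,
              hp, hq]
          | tmul c w => simp [hG, shuffle_tmul]
  apply TensorProduct.ext'
  intro x w
  have a := LinearMap.congr_fun hr x
  have b := LinearMap.congr_fun hl w
  simp only [LinearMap.comp_apply, LinearEquiv.coe_coe] at a b
  rw [LinearMap.comp_apply, LinearMap.comp_apply]
  have e : twist r l (x ⊗ₜ w) = shuffle X C U (r x ⊗ₜ l w) := rfl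
  rw [e, h1, h2, a, b]

variable [Bialgebra k B] {X C M : Type v}
  [AddCommGroup X] [Module k X] [Module B X] [IsScalarTower k B X]
  [AddCommGroup C] [Module k C] [Module B C] [IsScalarTower k B C] [NUCoalgebra k C]
  [AddCommGroup M] [Module k M] [Module B M] [IsScalarTower k B M]

/-- The last face `x ⊗ m ⊗ c¹ ⊗ ⋯ ⊗ cⁿ ↦ x₍₀₎ ⊗ m₍₀₎ ⊗ c¹ ⊗ ⋯ ⊗ cⁿ ⊗ x₍₋₁₎ m₍₋₁₎`. -/
def lastFace (P : LeftComodule k B X) (N : EquivariantBicomodule k B C M) (n : ℕ) :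
    X ⊗[k] tower k M C n →ₗ[k] X ⊗[k] tower k M C (n + 1) :=
  twist P.coact (towerCoact N.coactL n)

/-- The differential of `CH^tw_*(C, M; X)`, where `CH^tw_n(C, M; X) = X ⊗ (M ⊗ C^{⊗n})`.
It is `∑_{j=0}^{n+1} (-1)^j ∂_j`, where
`∂_0 (x ⊗ m ⊗ c¹ ⊗ ⋯ ⊗ cⁿ) = x ⊗ m₍₀₎ ⊗ m₍₁₎ ⊗ c¹ ⊗ ⋯ ⊗ cⁿ`,
`∂_j` comultiplies `c^j` for `1 ≤ j ≤ n`, and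
`∂_{n+1} (x ⊗ m ⊗ c¹ ⊗ ⋯ ⊗ cⁿ) = x₍₀₎ ⊗ m₍₀₎ ⊗ c¹ ⊗ ⋯ ⊗ cⁿ ⊗ x₍₋₁₎ m₍₋₁₎`. -/
def chtwD (P : LeftComodule k B X) (N : EquivariantBicomodule k B C M) (n : ℕ) :
    X ⊗[k] tower k M C n →ₗ[k] X ⊗[k] tower k M C (n + 1) :=
  (faceSum N.coactR NUCoalgebra.comul n).lTensor X +
    (-1 : k) ^ (n + 1) • lastFace P N n

/-- The action of `B` on `CH^tw_n(C, M; X)`: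
`b (x ⊗ m ⊗ c¹ ⊗ ⋯ ⊗ cⁿ) = b₍ₙ₊₂₎ x ⊗ b₍₁₎ m ⊗ b₍₂₎ c¹ ⊗ ⋯ ⊗ b₍ₙ₊₁₎ cⁿ`. -/
def chtwAct (k : Type u) [Field k] (B X C M : Type v) [Ring B] [Bialgebra k B]
    [AddCommGroup X] [Module k X] [Module B X] [IsScalarTower k B X]
    [AddCommGroup C] [Module k C] [Module B C] [IsScalarTower k B C]
    [AddCommGroup M] [Module k M] [Module B M] [IsScalarTower k B M] (n : ℕ) :
    B →ₗ[k] Module.End k (X ⊗[k] tower k M C n) :=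
  diagOp (smulAct k B X) (towerAct (smulAct k B M) (smulAct k B C) n)

theorem faceStep_lTensor {V : Type v} [AddCommGroup V] [Module k V] (Δ : C →ₗ[k] C ⊗[k] C) (s : k)
    (d : V →ₗ[k] V ⊗[k] C) : (faceStep V Δ s d).lTensor X =
      (d.rTensor C).lTensor X + s • (splitLast V Δ).lTensor X := by
  rw [faceStep, LinearMap.lTensor_add, LinearMap.lTensor_smul]

theorem sign_sq {V W Z : Type*} [AddCommMonoid V] [Module k V] [AddCommMonoid W] [Module k W]
    [AddCommMonoid Z] [Module k Z] {A0 T0 : V →ₗ[k] W} {A1 T1 D E : W →ₗ[k] Z} (s s' : k)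
    (hs : s' = -s) (h0 : A1 ∘ₗ A0 = 0) (h3 : A1 = D + s • E) (h1 : T1 ∘ₗ A0 = D ∘ₗ T0)
    (h2 : E ∘ₗ T0 = T1 ∘ₗ T0) : (A1 + s' • T1) ∘ₗ (A0 + s • T0) = 0 := by
  have : A1 ∘ₗ T0 = D ∘ₗ T0 + s • (T1 ∘ₗ T0) := by
    rw [h3, LinearMap.add_comp, LinearMap.smul_comp, h2]
  simp only [LinearMap.add_comp, LinearMap.comp_add, LinearMap.smul_comp, LinearMap.comp_smul,
    h0, h1, this, hs]
  module

theorem chtwD_sq [ModuleCoalgebra k B C] (P : LeftComodule k B X)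
    (N : EquivariantBicomodule k B C M) (n : ℕ) : chtwD P N (n + 1) ∘ₗ chtwD P N n = 0 := by
  have h0 : (faceSum N.coactR NUCoalgebra.comul (n + 1)).lTensor X ∘ₗ
      (faceSum N.coactR NUCoalgebra.comul n).lTensor X = 0 := by
    rw [← LinearMap.lTensor_comp, faceSum_sq NUCoalgebra.coassoc N.coactR N.coassocR,
      LinearMap.lTensor_zero]
  have h1 : twist P.coact (towerCoact N.coactL (n + 1)) ∘ₗ
      (faceSum N.coactR NUCoalgebra.comul n).lTensor X =
      ((faceSum N.coactR NUCoalgebra.comul n).rTensor C).lTensor X ∘ₗ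
        twist P.coact (towerCoact N.coactL n) :=
    twist_nat (f := LinearMap.id) P.coact (fun _ _ => rfl)
      (towerCoact_face N.coactL N.coactR N.coactLR n).symm
  have h2 : (splitLast (tower k M C n) NUCoalgebra.comul).lTensor X ∘ₗ
      twist P.coact (towerCoact N.coactL n) =
      twist P.coact (towerCoact N.coactL (n + 1)) ∘ₗ twist P.coact (towerCoact N.coactL n) :=
    twist_twist (ModuleCoalgebra.comul_smul (k := k) (B := B)) P.coassoc
      (towerCoact_coassoc N.coactL N.coassocL n)
  have h3 : (faceSum N.coactR NUCoalgebra.comul (n + 1)).lTensor X =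
      ((faceSum N.coactR NUCoalgebra.comul n).rTensor C).lTensor X +
      (-1 : k) ^ (n + 1) • (splitLast (tower k M C n) NUCoalgebra.comul).lTensor X :=
    faceStep_lTensor _ _ _
  have e : (-1 : k) ^ (n + 1 + 1) = - (-1) ^ (n + 1) := by rw [pow_succ]; simp
  exact sign_sq ((-1) ^ (n + 1)) _ e h0 h3 h1 h2

end Complex

section Coinvariants

variable {k : Type u} [Field k] {B : Type v} [Ring B] [HopfAlgebra k B]
  {hS : Function.Bijective (HopfAlgebra.antipode k (A := B))} {X C M : Type v}
  [AddCommGroup X] [Module k X] [Module B X] [IsScalarTower k B X]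
  [AddCommGroup C] [Module k C] [Module B C] [IsScalarTower k B C] [NUCoalgebra k C]
  [AddCommGroup M] [Module k M] [Module B M] [IsScalarTower k B M]

theorem twist_coinv {U : Type v} [AddCommGroup U] [Module k U] {r : X →ₗ[k] B ⊗[k] X}
    (hr : ∀ b, r ∘ₗ smulAct k B X b = aydAct k B hS X b ∘ₗ r) {l : U →ₗ[k] C ⊗[k] U}
    {α : B →ₗ[k] Module.End k U} (hl : ∀ b, l ∘ₗ α b = diag (smulAct k B C) α b ∘ₗ l) (b : B) :
    (coinvKer (diagOp (smulAct k B X) (diag α (smulAct k B C)))).mkQ ∘ₗ twist r l ∘ₗ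
      diagOp (smulAct k B X) α b = Coalgebra.counit (R := k) b •
      ((coinvKer (diagOp (smulAct k B X) (diag α (smulAct k B C)))).mkQ ∘ₗ twist r l) := by
  have h1 : twist r l ∘ₗ diagOp (smulAct k B X) α b = shuffle X C U ∘ₗ
      diagOp (aydAct k B hS X) (diag (smulAct k B C) α) b ∘ₗ TensorProduct.map r l := by
    rw [twist, LinearMap.comp_assoc, diagOp_tw hr hl]
  have h2 := shuffle_coinv hS (X := X) (C := C) α b
  rw [h1, ← LinearMap.comp_assoc, ← LinearMap.comp_assoc, LinearMap.comp_assoc _ _ (Submodule.mkQ _),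
    h2, LinearMap.smul_comp]
  rfl

theorem coinv_le {V W : Type*} [AddCommGroup V] [Module k V] [AddCommGroup W] [Module k W]
    {α : B →ₗ[k] Module.End k V} {β : B →ₗ[k] Module.End k W} {f : V →ₗ[k] W}
    (h : ∀ b, (coinvKer β).mkQ ∘ₗ f ∘ₗ α b =
      Coalgebra.counit (R := k) b • ((coinvKer β).mkQ ∘ₗ f)) :
    coinvKer α ≤ (coinvKer β).comap f := by
  refine Submodule.span_le.2 ?_
  rintro _ ⟨b, v, rfl⟩
  have := LinearMap.congr_fun (h b) v
  simp only [LinearMap.comp_apply, LinearMap.smul_apply, ← map_smul] at this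
  rw [← sub_eq_zero, ← map_sub, ← map_sub, Submodule.mkQ_apply,
    Submodule.Quotient.mk_eq_zero] at this
  exact this

theorem coinv_le_of_tw {V W : Type*} [AddCommGroup V] [Module k V] [AddCommGroup W] [Module k W]
    {α : B →ₗ[k] Module.End k V} {β : B →ₗ[k] Module.End k W} {f : V →ₗ[k] W}
    (h : ∀ b, f ∘ₗ α b = β b ∘ₗ f) : coinvKer α ≤ (coinvKer β).comap f := by
  refine coinv_le fun b => ?_
  rw [h, ← LinearMap.comp_assoc, coinv_mkQ, LinearMap.smul_comp]

theorem comap_add_smul {V W : Type*} [AddCommGroup V] [Module k V] [AddCommGroup W] [Module k W]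
    {f g : V →ₗ[k] W} {p : Submodule k V} {q : Submodule k W} (s : k) (hf : p ≤ q.comap f)
    (hg : p ≤ q.comap g) : p ≤ q.comap (f + s • g) :=
  fun _ hx => q.add_mem (hf hx) (q.smul_mem s (hg hx))

theorem face_tw [ModuleCoalgebra k B C] (N : EquivariantBicomodule k B C M) (n : ℕ) (b : B) :
    (faceSum N.coactR NUCoalgebra.comul n).lTensor X ∘ₗ chtwAct k B X C M n b =
      chtwAct k B X C M (n + 1) b ∘ₗ (faceSum N.coactR NUCoalgebra.comul n).lTensor X :=
  diagOp_tw (f := LinearMap.id) (fun _ => rfl)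
    (faceSum_tw (fun b => LinearMap.ext (ModuleCoalgebra.comul_smul (k := k) b))
      (fun b => LinearMap.ext (N.coactR_smul b)) n) b

theorem lastFace_coinv (P : AntiYetterDrinfeld k B hS X)
    (N : EquivariantBicomodule k B C M) (n : ℕ) (b : B) :
    (coinvKer (chtwAct k B X C M (n + 1))).mkQ ∘ₗ lastFace P.toLeftComodule N n ∘ₗ
      chtwAct k B X C M n b = Coalgebra.counit (R := k) b •
      ((coinvKer (chtwAct k B X C M (n + 1))).mkQ ∘ₗ lastFace P.toLeftComodule N n) :=
  twist_coinv (U := tower k M C n) (fun b => LinearMap.ext (P.coact_smul b))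
    (towerCoact_tw (fun b => LinearMap.ext (N.coactL_smul b)) n) b

theorem chtwD_coinv [ModuleCoalgebra k B C] (P : AntiYetterDrinfeld k B hS X)
    (N : EquivariantBicomodule k B C M) (n : ℕ) :
    coinvKer (chtwAct k B X C M n) ≤
      (coinvKer (chtwAct k B X C M (n + 1))).comap (chtwD P.toLeftComodule N n) :=
  comap_add_smul _ (coinv_le_of_tw (face_tw N n)) (coinv_le (lastFace_coinv P N n))

/-- The complex `k ⊗_B CH^tw_*(C, M; X)` with the induced differential. -/
def coinvCHtw [ModuleCoalgebra k B C] (P : AntiYetterDrinfeld k B hS X)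
    (N : EquivariantBicomodule k B C M) : CochainComplex (ModuleCat.{v} k) ℕ :=
  CochainComplex.of (fun n => ModuleCat.of k (Coinv (chtwAct k B X C M n)))
    (fun n => ModuleCat.ofHom (Submodule.mapQ _ _ (chtwD P.toLeftComodule N n)
      (chtwD_coinv P N n)))
    (fun n => by
      rw [← ModuleCat.ofHom_comp, ← Submodule.mapQ_comp]
      ext x y
      have := LinearMap.congr_fun (chtwD_sq P.toLeftComodule N n) (x ⊗ₜ[k] y)
      simp only [LinearMap.comp_apply, LinearMap.zero_apply] at this
      simp [this])

end Coinvariants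

/-! ### Restriction along a morphism and the canonical map -/

section Push

variable {k : Type u} [Field k] {B : Type v} [Ring B]

variable {C D M : Type v}
  [AddCommGroup C] [Module k C] [AddCommGroup D] [Module k D] [AddCommGroup M] [Module k M]

/-- A `B`-equivariant `D`-bicomodule is a `C`-bicomodule through a morphism `f : D → C`. -/
def EquivariantBicomodule.push [Bialgebra k B]
    [Module B C] [IsScalarTower k B C] [NUCoalgebra k C]
    [Module B D] [IsScalarTower k B D] [NUCoalgebra k D]
    [Module B M] [IsScalarTower k B M]
    (f : ModuleCoalgebraHom k B D C) (N : EquivariantBicomodule k B D M) :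
    EquivariantBicomodule k B C M where
  coactL := f.lin.rTensor M ∘ₗ N.coactL
  coactR := f.lin.lTensor M ∘ₗ N.coactR
  coassocL := by
    have hf : NUCoalgebra.comul ∘ₗ f.lin = TensorProduct.map f.lin f.lin ∘ₗ NUCoalgebra.comul :=
      LinearMap.ext f.map_comul
    have e : (TensorProduct.assoc k C C M).toLinearMap ∘ₗ
        (TensorProduct.map f.lin f.lin).rTensor M =
        TensorProduct.map f.lin (f.lin.rTensor M) ∘ₗ
          (TensorProduct.assoc k D D M).toLinearMap := by
      apply TensorProduct.ext_threefold; intro x y z; simp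
    calc _ = (TensorProduct.assoc k C C M).toLinearMap ∘ₗ
          (NUCoalgebra.comul ∘ₗ f.lin).rTensor M ∘ₗ N.coactL := by
          rw [LinearMap.rTensor_comp]; rfl
      _ = ((TensorProduct.assoc k C C M).toLinearMap ∘ₗ
          (TensorProduct.map f.lin f.lin).rTensor M) ∘ₗ
          NUCoalgebra.comul.rTensor M ∘ₗ N.coactL := by
          rw [hf, LinearMap.rTensor_comp]; rfl
      _ = TensorProduct.map f.lin (f.lin.rTensor M) ∘ₗ
          ((TensorProduct.assoc k D D M).toLinearMap ∘ₗ
          NUCoalgebra.comul.rTensor M ∘ₗ N.coactL) := by rw [e]; rfl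
      _ = _ := by
          rw [N.coassocL, ← LinearMap.comp_assoc, ← LinearMap.comp_assoc]
          congr 1
          ext x y; simp
  coassocR := by
    have hf : NUCoalgebra.comul ∘ₗ f.lin = TensorProduct.map f.lin f.lin ∘ₗ NUCoalgebra.comul :=
      LinearMap.ext f.map_comul
    have e : (TensorProduct.assoc k M C C).toLinearMap ∘ₗ
        (f.lin.lTensor M ∘ₗ N.coactR).rTensor C ∘ₗ f.lin.lTensor M =
        (TensorProduct.map f.lin f.lin).lTensor M ∘ₗ
          (TensorProduct.assoc k M D D).toLinearMap ∘ₗ N.coactR.rTensor D := by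
      apply TensorProduct.ext'
      intro x y
      simp only [LinearMap.comp_apply, LinearMap.lTensor_tmul, LinearMap.rTensor_tmul]
      induction N.coactR x with
      | zero => simp
      | add p q hp hq => simp only [TensorProduct.add_tmul, map_add, hp, hq]
      | tmul p q => simp
    calc _ = ((TensorProduct.assoc k M C C).toLinearMap ∘ₗ
        (f.lin.lTensor M ∘ₗ N.coactR).rTensor C ∘ₗ f.lin.lTensor M) ∘ₗ N.coactR := rfl
      _ = (TensorProduct.map f.lin f.lin).lTensor M ∘ₗ
          ((TensorProduct.assoc k M D D).toLinearMap ∘ₗ N.coactR.rTensor D ∘ₗ N.coactR) := by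
          rw [e]; rfl
      _ = ((TensorProduct.map f.lin f.lin).lTensor M ∘ₗ NUCoalgebra.comul.lTensor M) ∘ₗ
          N.coactR := by rw [N.coassocR]; rfl
      _ = _ := by rw [← LinearMap.lTensor_comp, ← hf, LinearMap.lTensor_comp]; rfl
  coactLR := by
    have e : (TensorProduct.assoc k C M C).toLinearMap ∘ₗ
        (f.lin.rTensor M ∘ₗ N.coactL).rTensor C ∘ₗ f.lin.lTensor M =
        TensorProduct.map f.lin (f.lin.lTensor M) ∘ₗ
          (TensorProduct.assoc k D M D).toLinearMap ∘ₗ N.coactL.rTensor D := by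
      apply TensorProduct.ext'
      intro x y
      simp only [LinearMap.comp_apply, LinearMap.lTensor_tmul, LinearMap.rTensor_tmul]
      induction N.coactL x with
      | zero => simp
      | add p q hp hq => simp only [TensorProduct.add_tmul, map_add, hp, hq]
      | tmul p q => simp
    calc _ = ((TensorProduct.assoc k C M C).toLinearMap ∘ₗ
        (f.lin.rTensor M ∘ₗ N.coactL).rTensor C ∘ₗ f.lin.lTensor M) ∘ₗ N.coactR := rfl
      _ = TensorProduct.map f.lin (f.lin.lTensor M) ∘ₗ
          ((TensorProduct.assoc k D M D).toLinearMap ∘ₗ N.coactL.rTensor D ∘ₗ N.coactR) := by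
          rw [e]; rfl
      _ = _ := by
          rw [N.coactLR, ← LinearMap.comp_assoc, ← LinearMap.comp_assoc]
          congr 1
          ext x y; simp
  coactL_smul b m := by
    have hf : ∀ b, f.lin ∘ₗ smulAct k B D b = smulAct k B C b ∘ₗ f.lin :=
      fun b => LinearMap.ext fun c => f.map_smul b c
    have := LinearMap.congr_fun (diag_tw (g := LinearMap.id) (β := smulAct k B M) (β' := smulAct k B M) hf
      (fun _ => rfl) b) (N.coactL m)
    simp only [LinearMap.comp_apply, N.coactL_smul]
    exact this
  coactR_smul b m := by
    have hf : ∀ b, f.lin ∘ₗ smulAct k B D b = smulAct k B C b ∘ₗ f.lin :=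
      fun b => LinearMap.ext fun c => f.map_smul b c
    have := LinearMap.congr_fun (diag_tw (f := LinearMap.id) (α := smulAct k B M)
      (α' := smulAct k B M)
      (fun _ => rfl) hf b) (N.coactR m)
    simp only [LinearMap.comp_apply, N.coactR_smul]
    exact this

variable [HopfAlgebra k B] [Module B C] [IsScalarTower k B C] [NUCoalgebra k C]
  [ModuleCoalgebra k B C] [Module B D] [IsScalarTower k B D] [NUCoalgebra k D]
  [ModuleCoalgebra k B D] [Module B M] [IsScalarTower k B M]
  {hS : Function.Bijective (HopfAlgebra.antipode k (A := B))} {X : Type v}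
  [AddCommGroup X] [Module k X] [Module B X] [IsScalarTower k B X]

theorem add_smul_comm {V W V' W' : Type*} [AddCommMonoid V] [Module k V] [AddCommMonoid W]
    [Module k W] [AddCommMonoid V'] [Module k V'] [AddCommMonoid W'] [Module k W']
    {F : V →ₗ[k] V'} {G : W →ₗ[k] W'} {a t : V →ₗ[k] W} {a' t' : V' →ₗ[k] W'} (s : k)
    (ha : G ∘ₗ a = a' ∘ₗ F) (ht : G ∘ₗ t = t' ∘ₗ F) :
    G ∘ₗ (a + s • t) = (a' + s • t') ∘ₗ F := by
  rw [LinearMap.comp_add, LinearMap.comp_smul, ha, ht, LinearMap.add_comp, LinearMap.smul_comp]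

theorem chtwMap_comm (P : LeftComodule k B X) (f : ModuleCoalgebraHom k B D C)
    (N : EquivariantBicomodule k B D M) (n : ℕ) :
    (towerMap (M := M) f.lin (n + 1)).lTensor X ∘ₗ chtwD P N n =
      chtwD P (N.push f) n ∘ₗ (towerMap f.lin n).lTensor X := by
  refine add_smul_comm _ ?_ ?_
  · rw [← LinearMap.lTensor_comp, ← LinearMap.lTensor_comp]
    exact congrArg _ (towerMap_face (LinearMap.ext f.map_comul) N.coactR n)
  · exact (twist_nat P.coact (fun b c => f.map_smul b c) (towerMap_coact N.coactL n)).symm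

theorem chtwMap_tw (f : ModuleCoalgebraHom k B D C) (n : ℕ) (b : B) :
    (towerMap (M := M) f.lin n).lTensor X ∘ₗ chtwAct k B X D M n b =
      chtwAct k B X C M n b ∘ₗ (towerMap f.lin n).lTensor X :=
  diagOp_tw (f := LinearMap.id) (fun _ => rfl)
    (towerMap_tw (fun b => LinearMap.ext fun c => f.map_smul b c) n) b

/-- The chain map `k ⊗_B CH^tw_*(D, M; X) → k ⊗_B CH^tw_*(C, M; X)` induced by
`x ⊗ m ⊗ d¹ ⊗ ⋯ ⊗ dⁿ ↦ x ⊗ m ⊗ f(d¹) ⊗ ⋯ ⊗ f(dⁿ)`. -/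
def coinvCHtwMap (P : AntiYetterDrinfeld k B hS X) (f : ModuleCoalgebraHom k B D C)
    (N : EquivariantBicomodule k B D M) : coinvCHtw P N ⟶ coinvCHtw P (N.push f) :=
  CochainComplex.ofHom
    (fun n => ModuleCat.ofHom (Submodule.mapQ (coinvKer (chtwAct k B X D M n))
      (coinvKer (chtwAct k B X C M n)) ((towerMap (M := M) f.lin n).lTensor X)
      (coinv_le_of_tw (chtwMap_tw f n))))
    (fun n => by
      simp only [coinvCHtw, CochainComplex.of_d]
      rw [← ModuleCat.ofHom_comp, ← ModuleCat.ofHom_comp, ← Submodule.mapQ_comp,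
        ← Submodule.mapQ_comp]
      simp only [chtwMap_comm])

end Push

end

end HopfExcision

/-! Write i : K → C and p : C → Q for the two maps, where Q = C/K. Since Q is B-projective, the
sequence splits B-linearly: there are r : C → K and σ : Q → C with ri = 1, pσ = 1 and ir + σp = 1.
Thus K is a summand of C, hence projective, and r induces a degreewise retraction of the map in
question, which is therefore injective.

For the quasi-isomorphism, filter CH^tw(C, K; X) by the chains F_a whose last a tensor factors lie
in K; in degree n ≤ a all n factors C must lie in K, so F_a is then CH^tw(K; X). F_a is a subcomplex
because Δ(K) ⊂ K ⊗ K and because the last face appends x₍₋₁₎m₍₋₁₎, which lies in K. On the graded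
piece F_a/F_{a+1} = X ⊗ K ⊗ C^{⊗(n-a-1)} ⊗ Q ⊗ K^{⊗a} the last face and the comultiplications of the
trailing factors K vanish, since they lengthen the tail in K. What remains is id ⊗ d ⊗ id, with d
the differential of V ⊗ C^{⊗*} ⊗ Q for V = K; the coaction of X has disappeared
(`toTailQuot_chtwD`). The splitting allows F_a to be handled as the image of an idempotent, ir on
the last a factors (`tailProj`), which is B-equivariant and hence survives coinvariants.

Two facts make the coinvariants of the graded pieces exact.

(1) V ⊗ C^{⊗*} ⊗ Q is exact (`quotFace_exact`). Replace the factors C by Q, starting from the right.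
The kernel of V ⊗ C^{⊗(j+1)} ⊗ Q^{⊗*} → V ⊗ C^{⊗j} ⊗ Q^{⊗(*+1)} is (V ⊗ C^{⊗j} ⊗ K) ⊗ Q^{⊗*}. All
faces acting left of the factors Q die there, so it is, up to sign and shift, a vector space
tensored with the bar complex of Q, which is acyclic by H-counitality (`genFace_zero_exact`). The
same holds for V ⊗ Q^{⊗*} at the end of the process, because the coaction of V takes values in V ⊗
K.

(2) Y ↦ k ⊗_B (X ⊗ Y) preserves the exactness of such complexes. If one of the two factors of Z ⊗ Y
is projective, the antipode or its inverse gives a section of Z ⊗ Y → k ⊗_B (Z ⊗ Y), natural in the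
other factor, so that coinvariants inherit exactness from the tensor product over k
(`mkQ_splitRight`, `mkQ_splitLeft`). For projective X this is the claim. Since K is projective, the
terms Y are flat in the sense of `CoinvFlat`, and dimension shifting extends the claim to X of
finite projective dimension (`coinv_exact_of_shortExact`).

Consequently a chain whose differential lies in CH^tw(K; X), modulo coinvariants, can be moved by
boundaries from F_0 down to F_n in its own degree n, which is CH^tw(K; X) (`exists_sub_chtwD_mem`).
Together with injectivity this gives the quasi-isomorphism. -/

namespace HopfExcision

noncomputable section

/-! ### Alternating sums of faces over a general base -/

section GeneralFace

variable {k : Type u} [Field k] {V V' V'' C C' C'' : Type v}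
  [AddCommGroup V] [Module k V] [AddCommGroup V'] [Module k V'] [AddCommGroup V''] [Module k V'']
  [AddCommGroup C] [Module k C] [AddCommGroup C'] [Module k C'] [AddCommGroup C''] [Module k C'']

/-- The map `g ⊗ f ⊗ ⋯ ⊗ f`. -/
def towerMap₂ (g : V →ₗ[k] V') (f : C →ₗ[k] C') :
    (n : ℕ) → (tower k V C n →ₗ[k] tower k V' C' n)
  | 0 => g
  | n + 1 => (TensorProduct.map (towerMap₂ g f n) f :
      tower k V C n ⊗[k] C →ₗ[k] tower k V' C' n ⊗[k] C')

theorem towerMap₂_comp (g' : V' →ₗ[k] V'') (f' : C' →ₗ[k] C'') (g : V →ₗ[k] V') (f : C →ₗ[k] C')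
    (n : ℕ) : towerMap₂ g' f' n ∘ₗ towerMap₂ g f n = towerMap₂ (g' ∘ₗ g) (f' ∘ₗ f) n := by
  induction n with
  | zero => rfl
  | succ n ih =>
    have := TensorProduct.map_comp (towerMap₂ g' f' n) f' (towerMap₂ g f n) f
    rw [ih] at this
    exact this.symm

theorem towerMap₂_id (n : ℕ) :
    towerMap₂ (LinearMap.id : V →ₗ[k] V) (LinearMap.id : C →ₗ[k] C) n = LinearMap.id := by
  induction n with
  | zero => rfl
  | succ n ih =>
    change TensorProduct.map (towerMap₂ LinearMap.id LinearMap.id n) LinearMap.id = LinearMap.id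
    rw [ih]
    exact TensorProduct.map_id

theorem towerMap₂_injective {g : V →ₗ[k] V'} (hg : Function.Injective g) (n : ℕ) :
    Function.Injective (towerMap₂ g (LinearMap.id : C →ₗ[k] C) n) := by
  induction n with
  | zero => exact hg
  | succ n ih => exact Module.Flat.rTensor_preserves_injective_linearMap _ ih

theorem towerMap₂_exact {g : V →ₗ[k] V'} {g' : V' →ₗ[k] V''} (hg : Function.Exact g g') (n : ℕ) :
    Function.Exact (towerMap₂ g (LinearMap.id : C →ₗ[k] C) n) (towerMap₂ g' LinearMap.id n) := by
  induction n with
  | zero => exact hg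
  | succ n ih => exact Module.Flat.rTensor_exact C ih

/-- Alternating sums of faces on `V ⊗ C^{⊗n}`, where the first face is `d : V → V ⊗ C` and the sign
of the comultiplication of the first factor `C` is `s`. -/
def genFace (Δ : C →ₗ[k] C ⊗[k] C) (s : k) (d : V →ₗ[k] V ⊗[k] C) :
    (n : ℕ) → (tower k V C n →ₗ[k] tower k V C (n + 1))
  | 0 => d
  | n + 1 => faceStep (tower k V C n) Δ (s * (-1) ^ n) (genFace Δ s d n)

theorem faceSum_eq_genFace (Δ : C →ₗ[k] C ⊗[k] C) (d : V →ₗ[k] V ⊗[k] C) (n : ℕ) :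
    faceSum d Δ n = genFace Δ (-1) d n := by
  induction n with
  | zero => rfl
  | succ n ih =>
    change faceStep _ Δ _ (faceSum d Δ n) = faceStep _ Δ _ (genFace Δ (-1) d n)
    rw [ih, pow_succ']

theorem map_faceStep {Δ : C →ₗ[k] C ⊗[k] C} {Δ' : C' →ₗ[k] C' ⊗[k] C'} {g : V →ₗ[k] V'}
    {f : C →ₗ[k] C'} (hf : Δ' ∘ₗ f = TensorProduct.map f f ∘ₗ Δ) {d : V →ₗ[k] V ⊗[k] C}
    {d' : V' →ₗ[k] V' ⊗[k] C'} (h : TensorProduct.map g f ∘ₗ d = d' ∘ₗ g) (s : k) :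
    TensorProduct.map (TensorProduct.map g f) f ∘ₗ faceStep V Δ s d =
      faceStep V' Δ' s d' ∘ₗ TensorProduct.map g f := by
  apply TensorProduct.ext'
  intro v c
  have h1 := LinearMap.congr_fun hf c
  have h2 := LinearMap.congr_fun h v
  simp only [LinearMap.comp_apply] at h1 h2
  simp only [LinearMap.comp_apply, faceStep, splitLast, LinearMap.add_apply, LinearMap.smul_apply,
    LinearMap.lTensor_tmul, LinearMap.rTensor_tmul, TensorProduct.map_tmul, h1, map_add, map_smul,
    h2]
  congr 2
  induction Δ c with
  | zero => simp
  | add p q hp hq => simp only [TensorProduct.tmul_add, map_add, hp, hq]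
  | tmul p q => simp

theorem towerMap₂_genFace {Δ : C →ₗ[k] C ⊗[k] C} {Δ' : C' →ₗ[k] C' ⊗[k] C'} {g : V →ₗ[k] V'}
    {f : C →ₗ[k] C'} (hf : Δ' ∘ₗ f = TensorProduct.map f f ∘ₗ Δ) {d : V →ₗ[k] V ⊗[k] C}
    {d' : V' →ₗ[k] V' ⊗[k] C'} (h : TensorProduct.map g f ∘ₗ d = d' ∘ₗ g) (s : k) (n : ℕ) :
    towerMap₂ g f (n + 1) ∘ₗ genFace Δ s d n = genFace Δ' s d' n ∘ₗ towerMap₂ g f n := by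
  induction n with
  | zero => exact h
  | succ n ih => exact map_faceStep hf ih _

/-- `(V ⊗ C) ⊗ C^{⊗n} ≃ V ⊗ C^{⊗(n+1)}`. -/
def towerShift (k : Type u) [Field k] (V C : Type v) [AddCommGroup V] [Module k V]
    [AddCommGroup C] [Module k C] :
    (n : ℕ) → (tower k (V ⊗[k] C) C n ≃ₗ[k] tower k V C (n + 1))
  | 0 => LinearEquiv.refl k (V ⊗[k] C)
  | n + 1 => (TensorProduct.congr (towerShift k V C n) (LinearEquiv.refl k C) :
      tower k (V ⊗[k] C) C n ⊗[k] C ≃ₗ[k] tower k V C (n + 1) ⊗[k] C)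

theorem towerShift_map (g : V →ₗ[k] V') (f : C →ₗ[k] C') (n : ℕ) :
    (towerShift k V' C' n).toLinearMap ∘ₗ towerMap₂ (TensorProduct.map g f) f n =
      towerMap₂ g f (n + 1) ∘ₗ (towerShift k V C n).toLinearMap := by
  induction n with
  | zero => rfl
  | succ n ih =>
    change TensorProduct.map (towerShift k V' C' n).toLinearMap LinearMap.id ∘ₗ
      TensorProduct.map (towerMap₂ (TensorProduct.map g f) f n) f =
      TensorProduct.map (towerMap₂ g f (n + 1)) f ∘ₗ
        TensorProduct.map (towerShift k V C n).toLinearMap LinearMap.id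
    rw [← TensorProduct.map_comp, ← TensorProduct.map_comp]
    exact congrArg (fun t => TensorProduct.map t f) ih

/-- Taking V ⊗ C as the new base absorbs the first comultiplication into the first face, so the
remaining signs start from -s. This is what makes induction over varying bases possible, and why the
sign is a parameter of `genFace`. -/
theorem towerShift_genFace (Δ : C →ₗ[k] C ⊗[k] C) (s : k) (d : V →ₗ[k] V ⊗[k] C) (n : ℕ) :
    (towerShift k V C (n + 1)).toLinearMap ∘ₗ genFace Δ (-s) (faceStep V Δ s d) n =
      genFace Δ s d (n + 1) ∘ₗ (towerShift k V C n).toLinearMap := by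
  induction n with
  | zero =>
    change TensorProduct.map LinearMap.id LinearMap.id ∘ₗ faceStep V Δ s d =
      faceStep V Δ (s * (-1) ^ 0) d
    rw [TensorProduct.map_id, pow_zero, mul_one]
    rfl
  | succ n ih =>
    have := map_faceStep (f := LinearMap.id) (Δ := Δ) (Δ' := Δ)
      (by rw [TensorProduct.map_id]; rfl) ih (-s * (-1) ^ n)
    have e : s * (-1) ^ (n + 1) = -s * (-1) ^ n := by ring
    change _ = faceStep (tower k V C (n + 1)) Δ (s * (-1) ^ (n + 1)) _ ∘ₗ _
    rw [e]
    exact this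

/-- `V ⊗ (C ⊗ C^{⊗n}) ≃ V ⊗ C^{⊗(n+1)}`. -/
def towerAssoc (k : Type u) [Field k] (V C : Type v) [AddCommGroup V] [Module k V]
    [AddCommGroup C] [Module k C] :
    (n : ℕ) → (V ⊗[k] tower k C C n ≃ₗ[k] tower k V C (n + 1))
  | 0 => LinearEquiv.refl k (V ⊗[k] C)
  | n + 1 => ((TensorProduct.assoc k V (tower k C C n) C).symm ≪≫ₗ
      TensorProduct.congr (towerAssoc k V C n) (LinearEquiv.refl k C) :
      V ⊗[k] (tower k C C n ⊗[k] C) ≃ₗ[k] tower k V C (n + 1) ⊗[k] C)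

/-- Inductive step for `towerAssoc_genFace`: comultiplying a further factor on the right commutes
with the regrouping `e`, and the common sign s passes through. -/
theorem assoc_faceStep (Δ : C →ₗ[k] C ⊗[k] C) (s s' : k) {T T' : Type v} [AddCommGroup T]
    [Module k T] [AddCommGroup T'] [Module k T'] {e : V ⊗[k] T →ₗ[k] T'} {d : T →ₗ[k] T ⊗[k] C}
    {d' : T' →ₗ[k] T' ⊗[k] C}
    (h : d' ∘ₗ e = s • ((TensorProduct.map e LinearMap.id ∘ₗ
      (TensorProduct.assoc k V T C).symm.toLinearMap) ∘ₗ d.lTensor V)) :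
    faceStep T' Δ (s * s') d' ∘ₗ (TensorProduct.map e LinearMap.id ∘ₗ
      (TensorProduct.assoc k V T C).symm.toLinearMap) =
    s • ((TensorProduct.map (TensorProduct.map e LinearMap.id ∘ₗ
      (TensorProduct.assoc k V T C).symm.toLinearMap) LinearMap.id ∘ₗ
      (TensorProduct.assoc k V (T ⊗[k] C) C).symm.toLinearMap) ∘ₗ
        (faceStep T Δ s' d).lTensor V) := by
  refine LinearMap.cancel_right (TensorProduct.assoc k V T C).surjective |>.1 ?_
  apply TensorProduct.ext_threefold
  intro w t c
  have h1 := LinearMap.congr_fun h (w ⊗ₜ t)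
  simp only [LinearMap.comp_apply, LinearMap.smul_apply, LinearMap.lTensor_tmul] at h1
  have hA : ∀ y : T ⊗[k] C, (TensorProduct.map e LinearMap.id ((TensorProduct.assoc k V T C).symm
      (w ⊗ₜ y))) ⊗ₜ[k] c = TensorProduct.map (TensorProduct.map e LinearMap.id ∘ₗ
      (TensorProduct.assoc k V T C).symm.toLinearMap) LinearMap.id
      ((TensorProduct.assoc k V (T ⊗[k] C) C).symm (w ⊗ₜ (y ⊗ₜ c))) := fun y => by simp
  have hB : ∀ y : C ⊗[k] C, (TensorProduct.assoc k T' C C).symm (e (w ⊗ₜ t) ⊗ₜ y) =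
      TensorProduct.map (TensorProduct.map e LinearMap.id ∘ₗ
      (TensorProduct.assoc k V T C).symm.toLinearMap) LinearMap.id
      ((TensorProduct.assoc k V (T ⊗[k] C) C).symm (w ⊗ₜ ((TensorProduct.assoc k T C C).symm
        (t ⊗ₜ y)))) := fun y => by
    induction y with
    | zero => simp
    | add p q hp hq => simp only [TensorProduct.tmul_add, map_add, hp, hq]
    | tmul p q => simp
  simp only [LinearMap.comp_apply, LinearMap.smul_apply, LinearMap.lTensor_tmul, faceStep,
    LinearMap.add_apply, LinearEquiv.coe_coe, TensorProduct.assoc_tmul, splitLast,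
    TensorProduct.assoc_symm_tmul, TensorProduct.map_tmul, LinearMap.rTensor_tmul, h1,
    LinearMap.id_apply]
  rw [← TensorProduct.smul_tmul', hA, hB, TensorProduct.tmul_add, map_add, map_add, smul_add,
    TensorProduct.tmul_smul, map_smul, map_smul, mul_smul]

/-- With zero first face V is inert, and what is left is V tensored with the bar complex, up to the
global sign s and a shift by one. -/
theorem towerAssoc_genFace (Δ : C →ₗ[k] C ⊗[k] C) (s : k) (n : ℕ) :
    genFace Δ s (0 : V →ₗ[k] V ⊗[k] C) (n + 1) ∘ₗ (towerAssoc k V C n).toLinearMap =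
      s • ((towerAssoc k V C (n + 1)).toLinearMap ∘ₗ (faceSum Δ Δ n).lTensor V) := by
  induction n with
  | zero =>
    apply TensorProduct.ext'
    intro w c
    change faceStep V Δ (s * (-1) ^ 0) 0 (w ⊗ₜ c) = s • TensorProduct.map LinearMap.id LinearMap.id
      ((TensorProduct.assoc k V C C).symm (w ⊗ₜ Δ c))
    rw [TensorProduct.map_id]
    simp [faceStep, splitLast]
    rfl
  | succ n ih =>
    have e : s * (-1) ^ (n + 1) = s * ((-1) ^ (n + 1)) := rfl
    exact assoc_faceStep Δ s _ ih
-- Tensoring the exact bar complex with V over a field keeps it exact; the nonzero sign s is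
-- harmless.
theorem genFace_zero_exact {Δ : C →ₗ[k] C ⊗[k] C} (h0 : Function.Injective (faceSum Δ Δ 0))
    (h : ∀ n, Function.Exact (faceSum Δ Δ n) (faceSum Δ Δ (n + 1))) {s : k} (hs : s ≠ 0) (n : ℕ) :
    Function.Exact (genFace Δ s (0 : V →ₗ[k] V ⊗[k] C) n) (genFace Δ s 0 (n + 1)) := by
  have key : ∀ n t, genFace Δ s (0 : V →ₗ[k] V ⊗[k] C) (n + 1) (towerAssoc k V C n t) =
      s • towerAssoc k V C (n + 1) ((faceSum Δ Δ n).lTensor V t) :=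
    fun n t => LinearMap.congr_fun (towerAssoc_genFace Δ s n) t
  have key0 : ∀ n t, genFace Δ s (0 : V →ₗ[k] V ⊗[k] C) (n + 1) (towerAssoc k V C n t) = 0 ↔
      (faceSum Δ Δ n).lTensor V t = 0 := fun n t => by
    rw [key, smul_eq_zero_iff_right hs, LinearEquiv.map_eq_zero_iff]
  intro y
  obtain ⟨t, rfl⟩ := (towerAssoc k V C n).surjective y
  rw [key0]
  -- For n = 0 the incoming map is the zero face, so exactness means injectivity of id ⊗ Δ.
  cases n with
  | zero =>
    rw [(injective_iff_map_eq_zero' _).1 (Module.Flat.lTensor_preserves_injective_linearMap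
      (M := V) (faceSum Δ Δ 0) h0)]
    constructor
    · rintro rfl
      exact ⟨0, by simp⟩
    · rintro ⟨x, hx⟩
      exact (LinearEquiv.map_eq_zero_iff (towerAssoc k V C 0)).1 (hx.symm.trans rfl)
  | succ n =>
    rw [Module.Flat.lTensor_exact V (h n) t]
    constructor
    · rintro ⟨x, rfl⟩
      refine ⟨towerAssoc k V C n (s⁻¹ • x), ?_⟩
      rw [key, map_smul, map_smul, smul_smul, mul_inv_cancel₀ hs, one_smul]
    · rintro ⟨x, hx⟩
      obtain ⟨x, rfl⟩ := (towerAssoc k V C n).surjective x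
      rw [key, ← map_smul, ← map_smul] at hx
      exact ⟨s • x, (towerAssoc k V C (n + 1)).injective hx⟩

end GeneralFace

/-! ### Exactness of `V ⊗ C^{⊗*} ⊗ Q` -/

section QuotientExact

variable {k : Type u} [Field k] {V K C Q : Type v}
  [AddCommGroup V] [Module k V] [AddCommGroup K] [Module k K]
  [AddCommGroup C] [Module k C] [AddCommGroup Q] [Module k Q]
  {ΔK : K →ₗ[k] K ⊗[k] K} {ΔC : C →ₗ[k] C ⊗[k] C} {ΔQ : Q →ₗ[k] Q ⊗[k] Q}
  {i : K →ₗ[k] C} {p : C →ₗ[k] Q} {σ : Q →ₗ[k] C}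

/-- A cochain whose boundary ends in `K`, and whose image in `V ⊗ Q^{⊗(n+1)}` comes from
`U ⊂ V`, is modulo boundaries in the kernel of `V ⊗ C^{⊗(n+1)} → V ⊗ Q^{⊗(n+1)}`. -/
theorem exists_sub_genFace_mem_ker {U : Type v} [AddCommGroup U] [Module k U]
    (hp : ΔQ ∘ₗ p = TensorProduct.map p p ∘ₗ ΔC) (hσ : p ∘ₗ σ = LinearMap.id)
    (h0 : Function.Injective (faceSum ΔQ ΔQ 0))
    (hQ : ∀ n, Function.Exact (faceSum ΔQ ΔQ n) (faceSum ΔQ ΔQ (n + 1)))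
    {s : k} (hs : s ≠ 0) {d : V →ₗ[k] V ⊗[k] C} {ι : U →ₗ[k] V} (hι : Function.Injective ι)
    (hd : p.lTensor V ∘ₗ d ∘ₗ ι = 0) (n : ℕ) (z : tower k V C (n + 1))
    (hz : p.lTensor (tower k V C (n + 1)) (genFace ΔC s d (n + 1) z) = 0)
    (u : tower k U Q (n + 1))
    (hu : towerMap₂ LinearMap.id p (n + 1) z = towerMap₂ ι LinearMap.id (n + 1) u) :
    ∃ y : tower k V C n, towerMap₂ LinearMap.id p (n + 1) (z - genFace ΔC s d n y) = 0 := by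
  have h1 := fun n => towerMap₂_genFace (g := (LinearMap.id : V →ₗ[k] V)) hp
    (d := d) (d' := p.lTensor V ∘ₗ d) rfl s n
  have h2 := fun n => towerMap₂_genFace (g := ι) (f := (LinearMap.id : Q →ₗ[k] Q)) (Δ := ΔQ)
    (Δ' := ΔQ) (by rw [TensorProduct.map_id]; rfl) (d := 0) (d' := p.lTensor V ∘ₗ d)
    (by rw [LinearMap.comp_zero, LinearMap.comp_assoc, hd]) s n
  -- By `hd` the first face restricted to U is zero after projection to Q. That u is a cocycle may
  -- be tested in V ⊗ Q^{⊗(n+2)}, as ι is injective; there its boundary is the image of the boundary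
  -- of z, which dies because its last factor is already killed by p.
  have h3 : genFace ΔQ s (0 : U →ₗ[k] U ⊗[k] Q) (n + 1) u = 0 := by
    apply towerMap₂_injective hι (n + 1 + 1)
    have e1 := LinearMap.congr_fun (h1 (n + 1)) z
    have e2 := LinearMap.congr_fun (h2 (n + 1)) u
    simp only [LinearMap.comp_apply] at e1 e2
    rw [e2, ← hu, ← e1, map_zero]
    have : ∀ x : tower k V C (n + 1) ⊗[k] C, towerMap₂ (LinearMap.id : V →ₗ[k] V) p (n + 1 + 1) x =
        (towerMap₂ (LinearMap.id : V →ₗ[k] V) p (n + 1)).rTensor Q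
          (p.lTensor (tower k V C (n + 1)) x) := fun x =>
      (LinearMap.congr_fun (LinearMap.rTensor_comp_lTensor _ _ _) x).symm
    refine (this _).trans ?_
    rw [hz, map_zero]
    rfl
  obtain ⟨h, rfl⟩ := (genFace_zero_exact h0 hQ hs n u).1 h3
  -- A primitive h of u is lifted factor by factor along σ. That σ is not comultiplicative does not
  -- matter, since the boundaries are compared only after projection to Q.
  refine ⟨towerMap₂ ι σ n h, ?_⟩
  have e1 := LinearMap.congr_fun (h1 n) (towerMap₂ ι σ n h)
  have e2 := LinearMap.congr_fun (h2 n) h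
  have e3 := LinearMap.congr_fun (towerMap₂_comp LinearMap.id p ι σ n) h
  simp only [LinearMap.comp_apply] at e1 e2 e3
  rw [map_sub, hu, e1, e3, e2, hσ, LinearMap.id_comp, sub_self]

/-- The faces in d do not touch the last factor, which stays in K, and the comultiplication sends K
into K ⊗ K; in both cases p kills the last factor. This is the vanishing needed for the base V ⊗ C
with U = V ⊗ K, and it also shows that chains ending in K are preserved. -/
theorem faceStep_comp_lTensor (hi : ΔC ∘ₗ i = TensorProduct.map i i ∘ₗ ΔK) (hpi : p ∘ₗ i = 0)
    (s : k) (d : V →ₗ[k] V ⊗[k] C) :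
    p.lTensor (V ⊗[k] C) ∘ₗ faceStep V ΔC s d ∘ₗ i.lTensor V = 0 := by
  apply TensorProduct.ext'
  intro w c
  have h1 := LinearMap.congr_fun hi c
  have h2 := LinearMap.congr_fun hpi
  simp only [LinearMap.comp_apply, LinearMap.zero_apply] at h1 h2
  simp only [LinearMap.comp_apply, faceStep, splitLast, LinearMap.add_apply, LinearMap.smul_apply,
    LinearMap.lTensor_tmul, LinearMap.rTensor_tmul, h1, map_add, map_smul, h2,
    TensorProduct.tmul_zero, zero_add, LinearMap.zero_apply]
  induction ΔK c with
  | zero => simp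
  | add p q hp hq =>
    simp only [TensorProduct.tmul_add, map_add, smul_add, hp, hq, add_zero]
  | tmul p q => simp [h2]

/-- Induction on the number of factors, with V and the sign varying: once z dies in V ⊗ Q^{⊗(n+1)},
a boundary is subtracted so that it dies in (V ⊗ C) ⊗ Q^{⊗n}, and so on until only its last factor
needs to be projected. -/
theorem exists_sub_genFace_last (hi : ΔC ∘ₗ i = TensorProduct.map i i ∘ₗ ΔK)
    (hp : ΔQ ∘ₗ p = TensorProduct.map p p ∘ₗ ΔC) (hσ : p ∘ₗ σ = LinearMap.id)
    (hinj : Function.Injective i) (hex : Function.Exact i p)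
    (h0 : Function.Injective (faceSum ΔQ ΔQ 0))
    (hQ : ∀ n, Function.Exact (faceSum ΔQ ΔQ n) (faceSum ΔQ ΔQ (n + 1)))
    (n : ℕ) : ∀ {V : Type v} [AddCommGroup V] [Module k V] {s : k} (_ : s ≠ 0)
    {d : V →ₗ[k] V ⊗[k] C}
    (_ : ∀ n, genFace ΔC s d (n + 1) ∘ₗ genFace ΔC s d n = 0) (z : tower k V C (n + 1))
    (_ : p.lTensor (tower k V C (n + 1)) (genFace ΔC s d (n + 1) z) = 0)
    (_ : towerMap₂ LinearMap.id p (n + 1) z = 0),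
    ∃ y : tower k V C n, p.lTensor (tower k V C n) (z - genFace ΔC s d n y) = 0 := by
  induction n with
  | zero =>
    intro V _ _ s hs d hd z hz h
    -- With a single factor C the hypothesis is already the conclusion.
    refine ⟨0, ?_⟩
    rw [map_zero, sub_zero]
    exact h
  | succ n ih =>
    intro V _ _ s hs d hd z hz h
    have hpi : p ∘ₗ i = 0 := hex.linearMap_comp_eq_zero
    have hsh : ∀ m t, towerShift k V C (m + 1) (genFace ΔC (-s) (faceStep V ΔC s d) m t) =
        genFace ΔC s d (m + 1) (towerShift k V C m t) :=
      fun m => LinearMap.congr_fun (towerShift_genFace ΔC s d m)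
    have hlast : ∀ m (t : tower k (V ⊗[k] C) C (m + 1)),
        (towerShift k V C m).toLinearMap.rTensor Q (p.lTensor (tower k (V ⊗[k] C) C m) t) =
        p.lTensor (tower k V C (m + 1)) (towerShift k V C (m + 1) t) := by
      intro m t
      refine (LinearMap.congr_fun (LinearMap.rTensor_comp_lTensor _ _ _) t).trans
        (LinearMap.congr_fun (LinearMap.lTensor_comp_rTensor _ _ _) t).symm
    have hlast0 : ∀ m (t : tower k (V ⊗[k] C) C (m + 1)),
        p.lTensor (tower k (V ⊗[k] C) C m) t = 0 ↔
        p.lTensor (tower k V C (m + 1)) (towerShift k V C (m + 1) t) = 0 := by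
      intro m t
      rw [← hlast, (injective_iff_map_eq_zero' _).1
        (Module.Flat.rTensor_preserves_injective_linearMap (M := Q) _
          (towerShift k V C m).injective)]
    have hd' : ∀ m, genFace ΔC (-s) (faceStep V ΔC s d) (m + 1) ∘ₗ
        genFace ΔC (-s) (faceStep V ΔC s d) m = 0 := by
      intro m
      ext1 t
      apply (towerShift k V C (m + 1 + 1)).injective
      rw [LinearMap.comp_apply, hsh, hsh, LinearMap.zero_apply, map_zero]
      exact LinearMap.congr_fun (hd (m + 1)) _
    obtain ⟨z, rfl⟩ := (towerShift k V C (n + 1)).surjective z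
    rw [← hsh, ← hlast0] at hz
    -- The image of z in (V ⊗ C) ⊗ Q^{⊗(n+1)} dies once the C next to V is also projected to Q, so
    -- it comes from (V ⊗ K) ⊗ Q^{⊗(n+1)}.
    have h' : towerMap₂ (p.lTensor V) LinearMap.id (n + 1)
        (towerMap₂ (LinearMap.id : V ⊗[k] C →ₗ[k] V ⊗[k] C) p (n + 1) z) = 0 := by
      apply (towerShift k V Q (n + 1)).injective
      have e1 := LinearMap.congr_fun (towerMap₂_comp (p.lTensor V) (LinearMap.id : Q →ₗ[k] Q)
        (LinearMap.id : V ⊗[k] C →ₗ[k] V ⊗[k] C) p (n + 1)) z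
      have e2 := LinearMap.congr_fun
        (towerShift_map (LinearMap.id : V →ₗ[k] V) p (n + 1)) z
      simp only [LinearMap.comp_apply, LinearMap.comp_id, LinearMap.id_comp,
        LinearEquiv.coe_coe] at e1 e2
      rw [e1, map_zero]
      exact e2.trans h
    obtain ⟨w, hw⟩ := (towerMap₂_exact (Module.Flat.lTensor_exact V hex) (n + 1) _).1 h'
    have hs' : -s ≠ 0 := neg_ne_zero.2 hs
    -- Applied to the base V ⊗ C and U = V ⊗ K; the corrected chain satisfies the induction
    -- hypothesis over V ⊗ C.
    obtain ⟨y0, hy0⟩ := exists_sub_genFace_mem_ker hp hσ h0 hQ hs'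
      (Module.Flat.lTensor_preserves_injective_linearMap (M := V) i hinj)
      (faceStep_comp_lTensor hi hpi s d) n z hz w hw.symm
    obtain ⟨y1, hy1⟩ := ih hs' hd' _ (by
      have := LinearMap.congr_fun (hd' n) y0
      rw [LinearMap.comp_apply, LinearMap.zero_apply] at this
      rw [map_sub, this, sub_zero]
      exact hz) hy0
    refine ⟨towerShift k V C n (y0 + y1), ?_⟩
    rw [← hsh, ← map_sub]
    rw [sub_sub, ← map_add] at hy1
    exact (hlast0 _ _).1 hy1

/-- The process starts from V ⊗ Q^{⊗*}: by `hρ` the coaction vanishes after projection to Q, so U =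
V is allowed and no condition on the image of z is needed. -/
theorem exists_sub_faceSum_last (hi : ΔC ∘ₗ i = TensorProduct.map i i ∘ₗ ΔK)
    (hp : ΔQ ∘ₗ p = TensorProduct.map p p ∘ₗ ΔC) (hσ : p ∘ₗ σ = LinearMap.id)
    (hinj : Function.Injective i) (hex : Function.Exact i p)
    (h0 : Function.Injective (faceSum ΔQ ΔQ 0))
    (hQ : ∀ n, Function.Exact (faceSum ΔQ ΔQ n) (faceSum ΔQ ΔQ (n + 1)))
    {ρ : V →ₗ[k] V ⊗[k] C} (hρ : p.lTensor V ∘ₗ ρ = 0)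
    (hsq : ∀ n, faceSum ρ ΔC (n + 1) ∘ₗ faceSum ρ ΔC n = 0) (n : ℕ) (z : tower k V C (n + 1))
    (hz : p.lTensor (tower k V C (n + 1)) (faceSum ρ ΔC (n + 1) z) = 0) :
    ∃ y : tower k V C n, p.lTensor (tower k V C n) (z - faceSum ρ ΔC n y) = 0 := by
  simp only [faceSum_eq_genFace] at hsq hz ⊢
  have hs : (-1 : k) ≠ 0 := neg_ne_zero.2 one_ne_zero
  obtain ⟨y0, hy0⟩ := exists_sub_genFace_mem_ker hp hσ h0 hQ hs
    (ι := (LinearMap.id : V →ₗ[k] V)) (fun _ _ h => h) (d := ρ) hρ n z hz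
    (towerMap₂ LinearMap.id p (n + 1) z) (by rw [towerMap₂_id]; rfl)
  obtain ⟨y1, hy1⟩ := exists_sub_genFace_last hi hp hσ hinj hex h0 hQ n hs hsq _ (by
    have := LinearMap.congr_fun (hsq n) y0
    rw [LinearMap.comp_apply, LinearMap.zero_apply] at this
    rw [map_sub, this, sub_zero]
    exact hz) hy0
  refine ⟨y0 + y1, ?_⟩
  rw [sub_sub, ← map_add] at hy1
  exact hy1

/-- The complex `V ⊗ C^{⊗*} ⊗ Q`, shifted, with a zero term put in front. -/
def quotTower (k : Type u) [Field k] (V C Q : Type v) [AddCommGroup V] [Module k V]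
    [AddCommGroup C] [Module k C] [AddCommGroup Q] [Module k Q] : ℕ → ModuleCat.{v} k
  | 0 => ModuleCat.of k PUnit
  | n + 1 => ModuleCat.of k (tower k V C n ⊗[k] Q)

/-- `id ⊗ ⋯ ⊗ id ⊗ p`. -/
def toQuotTower (V : Type v) [AddCommGroup V] [Module k V] (p : C →ₗ[k] Q) :
    (n : ℕ) → (tower k V C n →ₗ[k] quotTower k V C Q n)
  | 0 => 0
  | n + 1 => (p.lTensor (tower k V C n) : tower k V C n ⊗[k] C →ₗ[k] tower k V C n ⊗[k] Q)

/-- `id ⊗ ⋯ ⊗ id ⊗ σ`. -/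
def ofQuotTower (V : Type v) [AddCommGroup V] [Module k V] (σ : Q →ₗ[k] C) :
    (n : ℕ) → (quotTower k V C Q n →ₗ[k] tower k V C n)
  | 0 => 0
  | n + 1 => (σ.lTensor (tower k V C n) : tower k V C n ⊗[k] Q →ₗ[k] tower k V C n ⊗[k] C)

theorem toQuotTower_ofQuotTower (hσ : p ∘ₗ σ = LinearMap.id) (n : ℕ) :
    toQuotTower V p n ∘ₗ ofQuotTower V σ n = LinearMap.id := by
  cases n with
  | zero => exact LinearMap.ext fun _ => rfl
  | succ n =>
    have := LinearMap.lTensor_comp (tower k V C n) p σ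
    rw [hσ, LinearMap.lTensor_id] at this
    exact this.symm

/-- The differential of `V ⊗ C^{⊗*} ⊗ Q`, induced by the one of `V ⊗ C^{⊗*}`. -/
def quotFace (ρ : V →ₗ[k] V ⊗[k] C) (Δ : C →ₗ[k] C ⊗[k] C) (p : C →ₗ[k] Q) (σ : Q →ₗ[k] C)
    (n : ℕ) : quotTower k V C Q n →ₗ[k] quotTower k V C Q (n + 1) :=
  toQuotTower V p (n + 1) ∘ₗ faceSum ρ Δ n ∘ₗ ofQuotTower V σ n

/-- Since 1 - σp = ir, a map that vanishes on V ⊗ K cannot distinguish c from σ(p(c)). Hence the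
differential defined through σ is the induced one. -/
theorem lTensor_comp_section {r : C →ₗ[k] K} (hsum : i ∘ₗ r + σ ∘ₗ p = LinearMap.id)
    {Z Z' : Type v} [AddCommGroup Z] [Module k Z] [AddCommGroup Z'] [Module k Z']
    {g : Z →ₗ[k] Z'} {f : V ⊗[k] C →ₗ[k] Z} (h : g ∘ₗ f ∘ₗ i.lTensor V = 0) :
    (g ∘ₗ f ∘ₗ σ.lTensor V) ∘ₗ p.lTensor V = g ∘ₗ f := by
  have h2 : σ.lTensor V ∘ₗ p.lTensor V = LinearMap.id - i.lTensor V ∘ₗ r.lTensor V := by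
    rw [← LinearMap.lTensor_comp, ← LinearMap.lTensor_comp, eq_sub_iff_add_eq',
      ← LinearMap.lTensor_add, hsum, LinearMap.lTensor_id]
  calc _ = (g ∘ₗ f) ∘ₗ (σ.lTensor V ∘ₗ p.lTensor V) := rfl
    _ = g ∘ₗ f - (g ∘ₗ f ∘ₗ i.lTensor V) ∘ₗ r.lTensor V := by
      rw [h2, LinearMap.comp_sub, LinearMap.comp_id]; rfl
    _ = _ := by rw [h, LinearMap.zero_comp, sub_zero]

theorem quotFace_toQuotTower (hi : ΔC ∘ₗ i = TensorProduct.map i i ∘ₗ ΔK) (hpi : p ∘ₗ i = 0)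
    {r : C →ₗ[k] K} (hsum : i ∘ₗ r + σ ∘ₗ p = LinearMap.id) {ρ : V →ₗ[k] V ⊗[k] C}
    (hρ : p.lTensor V ∘ₗ ρ = 0) (n : ℕ) :
    quotFace ρ ΔC p σ n ∘ₗ toQuotTower V p n = toQuotTower V p (n + 1) ∘ₗ faceSum ρ ΔC n := by
  cases n with
  | zero =>
    -- In degree zero the source of the quotient is zero; the other side vanishes because the
    -- coaction of V ends in K.
    refine (LinearMap.comp_zero _).trans ?_
    exact hρ.symm
  | succ n =>
    exact lTensor_comp_section hsum (faceStep_comp_lTensor (V := tower k V C n) hi hpi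
      ((-1) ^ (n + 1)) (faceSum ρ ΔC n))

/-- Lift along σ, apply `exists_sub_faceSum_last`, and project. For n = 0 the incoming term is zero,
so that exactness there is injectivity of the first genuine map. -/
theorem quotFace_exact (hi : ΔC ∘ₗ i = TensorProduct.map i i ∘ₗ ΔK)
    (hp : ΔQ ∘ₗ p = TensorProduct.map p p ∘ₗ ΔC) (hσ : p ∘ₗ σ = LinearMap.id)
    (hinj : Function.Injective i) (hex : Function.Exact i p)
    {r : C →ₗ[k] K} (hsum : i ∘ₗ r + σ ∘ₗ p = LinearMap.id)
    (h0 : Function.Injective (faceSum ΔQ ΔQ 0))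
    (hQ : ∀ n, Function.Exact (faceSum ΔQ ΔQ n) (faceSum ΔQ ΔQ (n + 1)))
    {ρ : V →ₗ[k] V ⊗[k] C} (hρ : p.lTensor V ∘ₗ ρ = 0)
    (hsq : ∀ n, faceSum ρ ΔC (n + 1) ∘ₗ faceSum ρ ΔC n = 0) (n : ℕ) :
    Function.Exact (quotFace ρ ΔC p σ n) (quotFace ρ ΔC p σ (n + 1)) := by
  have hq := fun n => LinearMap.congr_fun
    (quotFace_toQuotTower (σ := σ) hi hex.linearMap_comp_eq_zero hsum hρ n)
  have hs := fun n => LinearMap.congr_fun (toQuotTower_ofQuotTower (V := V) hσ n)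
  simp only [LinearMap.comp_apply, LinearMap.id_apply] at hq hs
  intro w
  rw [← hs (n + 1) w, hq]
  constructor
  · intro h
    obtain ⟨y, hy⟩ := exists_sub_faceSum_last hi hp hσ hinj hex h0 hQ hρ hsq n
      (ofQuotTower V σ (n + 1) w) h
    refine ⟨toQuotTower V p n y, ?_⟩
    have hy' : toQuotTower V p (n + 1) (ofQuotTower V σ (n + 1) w - faceSum ρ ΔC n y) = 0 := hy
    rw [map_sub, sub_eq_zero] at hy'
    rw [hq, hy']
  · rintro ⟨y, hy⟩
    rw [← hq, ← hy, ← hs n y, hq, hq]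
    have := LinearMap.congr_fun (hsq n) (ofQuotTower V σ n y)
    rw [LinearMap.comp_apply, LinearMap.zero_apply] at this
    rw [this, map_zero]

end QuotientExact

/-! ### Actions and convolution -/

section ActionFacts

variable {k : Type u} [Field k] {B : Type v} [Ring B]
  {V W : Type*} [AddCommGroup V] [Module k V] [AddCommGroup W] [Module k W]

/-- `α` is multiplicative, so that it makes `V` a `B`-module. -/
structure IsAct [Algebra k B] (α : B →ₗ[k] Module.End k V) : Prop where
  one : α 1 = 1
  mul : ∀ b c, α (b * c) = α b * α c

theorem isAct_smulAct [Algebra k B] (V : Type*) [AddCommGroup V] [Module k V] [Module B V]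
    [IsScalarTower k B V] : IsAct (smulAct k B V) :=
  ⟨map_one (Algebra.lsmul k k V), map_mul (Algebra.lsmul k k V)⟩

theorem IsAct.onLeft [Algebra k B] {α : B →ₗ[k] Module.End k V} (h : IsAct α) :
    IsAct (onLeft W α) where
  one := by simp [HopfExcision.onLeft, h.one, Module.End.one_eq_id]
  mul b c := by
    simp only [HopfExcision.onLeft, LinearMap.comp_apply, h.mul]
    exact LinearMap.rTensor_mul W _ _

theorem IsAct.onRight [Algebra k B] {β : B →ₗ[k] Module.End k W} (h : IsAct β) :
    IsAct (onRight V β) where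
  one := by simp [HopfExcision.onRight, h.one, Module.End.one_eq_id]
  mul b c := by
    simp only [HopfExcision.onRight, LinearMap.comp_apply, h.mul]
    exact LinearMap.lTensor_mul V _ _

theorem onLeft_tmul [Algebra k B] (α : B →ₗ[k] Module.End k V) (b : B) (x : V) (y : W) :
    HopfExcision.onLeft W α b (x ⊗ₜ y) = α b x ⊗ₜ y := rfl

theorem onRight_tmul [Algebra k B] (β : B →ₗ[k] Module.End k W) (b : B) (x : V) (y : W) :
    HopfExcision.onRight V β b (x ⊗ₜ y) = x ⊗ₜ β b y := rfl

theorem onLeft_comm_onRight [Algebra k B] (α : B →ₗ[k] Module.End k V)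
    (β : B →ₗ[k] Module.End k W) (b c : B) :
    onLeft W α b * onRight V β c = onRight V β c * onLeft W α b := by
  refine TensorProduct.ext' fun x y => ?_
  simp [onLeft, onRight]

variable [Bialgebra k B]

theorem IsAct.conv {φ ψ : B →ₗ[k] Module.End k V} (hφ : IsAct φ) (hψ : IsAct ψ)
    (hc : ∀ b c, φ b * ψ c = ψ c * φ b) : IsAct (conv φ ψ) where
  one := by
    simp [HopfExcision.conv, hφ.one, hψ.one, Algebra.TensorProduct.one_def]
  mul b c := by
    have key : ∀ s t : B ⊗[k] B, LinearMap.mul' k (Module.End k V)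
        (TensorProduct.map φ ψ (s * t)) = LinearMap.mul' k _ (TensorProduct.map φ ψ s) *
        LinearMap.mul' k _ (TensorProduct.map φ ψ t) := by
      intro s t
      induction s with
      | zero => simp
      | add x y hx hy => simp only [add_mul, map_add, hx, hy]
      | tmul p q =>
        induction t with
        | zero => simp
        | add x y hx hy => simp only [mul_add, map_add, hx, hy]
        | tmul p' q' =>
          simp only [Algebra.TensorProduct.tmul_mul_tmul, TensorProduct.map_tmul,
            LinearMap.mul'_apply, hφ.mul, hψ.mul]
          rw [mul_assoc, ← mul_assoc (φ p'), hc, mul_assoc, mul_assoc]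
    simp only [HopfExcision.conv, LinearMap.comp_apply, Bialgebra.comul_mul, key]

theorem IsAct.diag {α : B →ₗ[k] Module.End k V} {β : B →ₗ[k] Module.End k W} (hα : IsAct α)
    (hβ : IsAct β) : IsAct (diag α β) :=
  hα.onLeft.conv hβ.onRight (onLeft_comm_onRight α β)

theorem IsAct.diagOp {α : B →ₗ[k] Module.End k V} {β : B →ₗ[k] Module.End k W} (hα : IsAct α)
    (hβ : IsAct β) : IsAct (diagOp α β) :=
  hβ.onRight.conv hα.onLeft fun b c => (onLeft_comm_onRight α β c b).symm

theorem IsAct.towerAct {M C : Type v} [AddCommGroup M] [Module k M] [AddCommGroup C] [Module k C]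
    {α : B →ₗ[k] Module.End k M} {β : B →ₗ[k] Module.End k C} (hα : IsAct α) (hβ : IsAct β)
    (n : ℕ) : IsAct (towerAct α β n) := by
  induction n with
  | zero => exact hα
  | succ n ih => exact ih.diag hβ

/-- The counit is the unit for convolution, and g turns φ into the counit. -/
theorem comp_conv_of_counit {Z : Type*} [AddCommGroup Z] [Module k Z] (g : V →ₗ[k] Z)
    {φ : B →ₗ[k] Module.End k V} (ψ : B →ₗ[k] Module.End k V)
    (hg : ∀ b, g ∘ₗ φ b = Coalgebra.counit (R := k) b • g) (b : B) :
    g ∘ₗ conv φ ψ b = g ∘ₗ ψ b := by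
  have key : ∀ t : B ⊗[k] B, g ∘ₗ LinearMap.mul' k (Module.End k V) (TensorProduct.map φ ψ t) =
      g ∘ₗ ψ (TensorProduct.lid k B ((Coalgebra.counit (R := k)).rTensor B t)) := by
    intro t
    induction t with
    | zero => simp
    | add x y hx hy => simp only [map_add, LinearMap.comp_add, hx, hy]
    | tmul p q =>
      simp only [TensorProduct.map_tmul, LinearMap.mul'_apply, Module.End.mul_eq_comp,
        LinearMap.rTensor_tmul, TensorProduct.lid_tmul, map_smul, LinearMap.comp_smul]
      rw [← LinearMap.comp_assoc, hg, LinearMap.smul_comp]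
  have := key (Coalgebra.comul (R := k) b)
  rw [Coalgebra.rTensor_counit_comul] at this
  simpa [conv] using this

theorem conv_eq_of_counit (φ : B →ₗ[k] Module.End k V) {ψ : B →ₗ[k] Module.End k V}
    (hψ : ∀ b, ψ b = Coalgebra.counit (R := k) b • 1) : conv φ ψ = φ := by
  ext1 b
  have key : ∀ t : B ⊗[k] B, LinearMap.mul' k (Module.End k V) (TensorProduct.map φ ψ t) =
      φ (TensorProduct.rid k B ((Coalgebra.counit (R := k)).lTensor B t)) := by
    intro t
    induction t with
    | zero => simp
    | add x y hx hy => simp only [map_add, hx, hy]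
    | tmul p q => simp [hψ]
  have := key (Coalgebra.comul (R := k) b)
  rw [Coalgebra.lTensor_counit_comul] at this
  simpa [conv] using this

theorem coinvKer_le_ker {Z : Type*} [AddCommGroup Z] [Module k Z] {α : B →ₗ[k] Module.End k V}
    {g : V →ₗ[k] Z} (hg : ∀ b, g ∘ₗ α b = Coalgebra.counit (R := k) b • g) :
    coinvKer α ≤ LinearMap.ker g := by
  refine Submodule.span_le.2 ?_
  rintro _ ⟨b, w, rfl⟩
  have := LinearMap.congr_fun (hg b) w
  simp only [LinearMap.comp_apply, LinearMap.smul_apply] at this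
  simp [this]

theorem mem_coinvKer_map {α : B →ₗ[k] Module.End k V} {β : B →ₗ[k] Module.End k W}
    {f : V →ₗ[k] W} (h : ∀ b, f ∘ₗ α b = β b ∘ₗ f) {t : V} (ht : t ∈ coinvKer α) :
    f t ∈ coinvKer β := by
  suffices coinvKer α ≤ (coinvKer β).comap f from this ht
  refine Submodule.span_le.2 ?_
  rintro _ ⟨b, w, rfl⟩
  refine Submodule.subset_span ⟨b, f w, ?_⟩
  have := LinearMap.congr_fun (h b) w
  simp only [LinearMap.comp_apply] at this
  simp [this]

theorem exists_mem_coinvKer_lift {α : B →ₗ[k] Module.End k V} {β : B →ₗ[k] Module.End k W}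
    {f : V →ₗ[k] W} (h : ∀ b, f ∘ₗ α b = β b ∘ₗ f) (hf : Function.Surjective f) {t : W}
    (ht : t ∈ coinvKer β) : ∃ s ∈ coinvKer α, f s = t := by
  suffices coinvKer β ≤ (coinvKer α).map f from this ht
  refine Submodule.span_le.2 ?_
  rintro _ ⟨b, w, rfl⟩
  obtain ⟨w, rfl⟩ := hf w
  refine ⟨α b w - Coalgebra.counit (R := k) b • w, Submodule.subset_span ⟨b, w, rfl⟩, ?_⟩
  have := LinearMap.congr_fun (h b) w
  simp only [LinearMap.comp_apply] at this
  simp [this]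

end ActionFacts

/-! ### Moving the action across a tensor product with the antipode -/

section HopfActions

variable {k : Type u} [Field k] {B : Type v} [Ring B] [HopfAlgebra k B]
  {V W : Type*} [AddCommGroup V] [Module k V] [AddCommGroup W] [Module k W]

theorem IsAct.conv_antipode {α : B →ₗ[k] Module.End k V} (hα : IsAct α) (b : B) :
    HopfExcision.conv α (α ∘ₗ HopfAlgebra.antipode k) b = Coalgebra.counit (R := k) b • 1 := by
  have key : ∀ t : B ⊗[k] B, LinearMap.mul' k (Module.End k V)
      (TensorProduct.map α (α ∘ₗ HopfAlgebra.antipode k) t) =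
      α (LinearMap.mul' k B ((HopfAlgebra.antipode k).lTensor B t)) := by
    intro t
    induction t with
    | zero => simp
    | add x y hx hy => simp only [map_add, hx, hy]
    | tmul p q => simp [hα.mul]
  have := key (Coalgebra.comul (R := k) b)
  rw [HopfAlgebra.mul_antipode_lTensor_comul_apply, Algebra.algebraMap_eq_smul_one, map_smul,
    hα.one] at this
  exact this

/-- In `k ⊗_B (V ⊗ W)` one has `S(b) v ⊗ w = v ⊗ b w`. -/
theorem coinv_antipode {α : B →ₗ[k] Module.End k V} (hα : IsAct α) (β : B →ₗ[k] Module.End k W)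
    (b : B) : (coinvKer (diagOp α β)).mkQ ∘ₗ onLeft W α (HopfAlgebra.antipode k b) =
      (coinvKer (diagOp α β)).mkQ ∘ₗ onRight V β b := by
  -- The class of b₍₂₎S(b₍₃₎)v ⊗ b₍₁₎w is evaluated in two ways: the diagonal action of the first
  -- two legs is trivial in coinvariants, leaving S(b)v ⊗ w, while b₍₂₎S(b₍₃₎) collapses on V,
  -- leaving v ⊗ bw.
  have h1 := comp_conv_of_counit (coinvKer (diagOp α β)).mkQ
    (onLeft W α ∘ₗ HopfAlgebra.antipode k) (coinv_mkQ (diagOp α β)) b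
  rw [diagOp, conv_assoc, conv_eq_of_counit _ hα.onLeft.conv_antipode] at h1
  exact h1.symm

variable {hS : Function.Bijective (HopfAlgebra.antipode k (A := B))}

theorem antipode_antipodeInv (b : B) : HopfAlgebra.antipode k (antipodeInv k B hS b) = b :=
  (LinearEquiv.ofBijective _ hS).apply_symm_apply b

theorem antipodeInv_mul (b c : B) :
    antipodeInv k B hS (b * c) = antipodeInv k B hS c * antipodeInv k B hS b := by
  apply hS.1
  rw [antipode_antipodeInv, HopfAlgebra.antipode_mul_antidistrib, antipode_antipodeInv,
    antipode_antipodeInv]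

theorem coinv_antipodeInv {α : B →ₗ[k] Module.End k V} (hα : IsAct α) (β : B →ₗ[k] Module.End k W)
    (b : B) (w : V) (y : W) : (coinvKer (diagOp α β)).mkQ (w ⊗ₜ β (antipodeInv k B hS b) y) =
      (coinvKer (diagOp α β)).mkQ (α b w ⊗ₜ y) := by
  have := LinearMap.congr_fun (coinv_antipode hα β (antipodeInv k B hS b)) (w ⊗ₜ y)
  rw [antipode_antipodeInv] at this
  exact this.symm

end HopfActions

/-! ### Projective modules and coinvariants -/

section Projective

variable {k : Type u} [Field k] {B : Type v} [Ring B]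

/-- A projective module is a direct summand of a free one, equivariantly. -/
theorem exists_equivariant_section [Algebra k B] (P : Type v) [AddCommGroup P] [Module k P]
    [Module B P] [IsScalarTower k B P] [Module.Projective B P] :
    ∃ σ : P →ₗ[k] B ⊗[k] P, (∀ x, TensorProduct.lift (smulAct k B P) (σ x) = x) ∧
      ∀ (b : B) x, σ (smulAct k B P b x) = (mulL k B b).rTensor P (σ x) := by
  obtain ⟨s, hs⟩ := Module.projective_def.1 ‹Module.Projective B P›
  let g : (P →₀ B) →ₗ[k] B ⊗[k] P :=
    Finsupp.lsum k fun x => (TensorProduct.mk k B P).flip x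
  refine ⟨g ∘ₗ s.restrictScalars k, fun x => ?_, fun b x => ?_⟩
  · conv_rhs => rw [← hs x]
    simp only [LinearMap.comp_apply, LinearMap.restrictScalars_apply]
    induction s x using Finsupp.induction_linear with
    | zero => simp
    | add p q hp hq => simp only [map_add, hp, hq]
    | single y b => simp [g, smulAct]
  · have : s (smulAct k B P b x) = b • s x := s.map_smul b x
    simp only [LinearMap.comp_apply, LinearMap.restrictScalars_apply, this]
    induction s x using Finsupp.induction_linear with
    | zero => simp
    | add p q hp hq => simp only [map_add, smul_add, hp, hq]
    | single y c =>
      rw [Finsupp.smul_single, smul_eq_mul]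
      simp only [g, Finsupp.lsum_single]
      rfl

variable [HopfAlgebra k B]

/-- `z ⊗ y ↦ S(b) z ⊗ y'`, if `σ(y) = b ⊗ y'`. -/
def splitRight {Z Y : Type v} [AddCommGroup Z] [Module k Z] [AddCommGroup Y] [Module k Y]
    (ζ : B →ₗ[k] Module.End k Z) (σ : Y →ₗ[k] B ⊗[k] Y) : Z ⊗[k] Y →ₗ[k] Z ⊗[k] Y :=
  (TensorProduct.lift (ζ ∘ₗ HopfAlgebra.antipode k).flip).rTensor Y ∘ₗ
    (TensorProduct.assoc k Z B Y).symm.toLinearMap ∘ₗ σ.lTensor Z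

variable {Z Z' Y Y' : Type v} [AddCommGroup Z] [Module k Z] [AddCommGroup Y] [Module k Y]
  [AddCommGroup Z'] [Module k Z'] [AddCommGroup Y'] [Module k Y']
  {ζ : B →ₗ[k] Module.End k Z} {ζ' : B →ₗ[k] Module.End k Z'}
  {β : B →ₗ[k] Module.End k Y} {β' : B →ₗ[k] Module.End k Y'}

/-- S(b)z ⊗ y' and z ⊗ by' have the same class, and by' recovers y. Together with
`splitRight_diagOp` this makes `splitRight` a section of Z ⊗ Y → k ⊗_B (Z ⊗ Y), natural in Z by
`splitRight_nat`; in particular its kernel is exactly `coinvKer`. -/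
theorem mkQ_splitRight (hζ : IsAct ζ) {σ : Y →ₗ[k] B ⊗[k] Y}
    (hσ : ∀ y, TensorProduct.lift β (σ y) = y) :
    (coinvKer (diagOp ζ β)).mkQ ∘ₗ splitRight ζ σ = (coinvKer (diagOp ζ β)).mkQ := by
  refine TensorProduct.ext' fun z y => ?_
  have key : ∀ w : B ⊗[k] Y, (coinvKer (diagOp ζ β)).mkQ
      ((TensorProduct.lift (ζ ∘ₗ HopfAlgebra.antipode k).flip).rTensor Y
        ((TensorProduct.assoc k Z B Y).symm (z ⊗ₜ w))) =
      (coinvKer (diagOp ζ β)).mkQ (z ⊗ₜ TensorProduct.lift β w) := by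
    intro w
    induction w with
    | zero => simp
    | add p q hp hq => simp only [TensorProduct.tmul_add, map_add, hp, hq]
    | tmul b y => exact LinearMap.congr_fun (coinv_antipode hζ β b) (z ⊗ₜ y)
  have := key (σ y)
  rw [hσ] at this
  exact this

/-- S(c₍₁₎b)c₍₂₎z = S(b)S(c₍₁₎)c₍₂₎z = ε(c)S(b)z. -/
theorem splitRight_diagOp (hζ : IsAct ζ) {σ : Y →ₗ[k] B ⊗[k] Y}
    (hσ : ∀ b y, σ (β b y) = (mulL k B b).rTensor Y (σ y)) (c : B) :
    splitRight ζ σ ∘ₗ diagOp ζ β c = Coalgebra.counit (R := k) c • splitRight ζ σ := by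
  refine TensorProduct.ext' fun z y => ?_
  have key : ∀ t : B ⊗[k] B, splitRight ζ σ (LinearMap.mul' k (Module.End k (Z ⊗[k] Y))
      (TensorProduct.map (onRight Z β) (onLeft Y ζ) t) (z ⊗ₜ y)) =
      splitRight ζ σ
        (ζ (LinearMap.mul' k B ((HopfAlgebra.antipode k).rTensor B t)) z ⊗ₜ y) := by
    intro t
    induction t with
    | zero => simp
    | add p q hp hq =>
      simp only [map_add, LinearMap.add_apply, TensorProduct.add_tmul, hp, hq]
    | tmul p q =>
      simp only [TensorProduct.map_tmul, LinearMap.mul'_apply, Module.End.mul_apply,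
        onLeft_tmul, onRight_tmul, LinearMap.comp_apply, LinearMap.lTensor_tmul, splitRight, hσ,
        LinearEquiv.coe_coe]
      induction σ y with
      | zero => simp
      | add p q hp hq => simp only [TensorProduct.tmul_add, map_add, hp, hq]
      | tmul b w =>
        simp [mulL, HopfAlgebra.antipode_mul_antidistrib, hζ.mul]
  have := key (Coalgebra.comul (R := k) c)
  rw [HopfAlgebra.mul_antipode_rTensor_comul_apply, Algebra.algebraMap_eq_smul_one, map_smul,
    hζ.one] at this
  refine this.trans ?_
  simp [← TensorProduct.smul_tmul']

theorem splitRight_nat {f : Z →ₗ[k] Z'} (hf : ∀ b, f ∘ₗ ζ b = ζ' b ∘ₗ f)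
    (σ : Y →ₗ[k] B ⊗[k] Y) :
    splitRight ζ' σ ∘ₗ f.rTensor Y = f.rTensor Y ∘ₗ splitRight ζ σ := by
  refine TensorProduct.ext' fun z y => ?_
  have hf' : ∀ b z, f (ζ b z) = ζ' b (f z) := fun b => LinearMap.congr_fun (hf b)
  simp only [LinearMap.comp_apply, splitRight, LinearMap.rTensor_tmul, LinearMap.lTensor_tmul]
  induction σ y with
  | zero => simp
  | add p q hp hq => simp only [TensorProduct.tmul_add, map_add, hp, hq]
  | tmul b w => simp [hf']

/-- The functor `Z ↦ k ⊗_B (Z ⊗ Y)`, where `B` acts on `Y` by `β`, preserves injections. -/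
def CoinvFlat (β : B →ₗ[k] Module.End k Y) : Prop :=
  ∀ ⦃Z Z' : Type v⦄ [AddCommGroup Z] [Module k Z] [AddCommGroup Z'] [Module k Z']
    ⦃ζ : B →ₗ[k] Module.End k Z⦄ ⦃ζ' : B →ₗ[k] Module.End k Z'⦄ (_ : IsAct ζ) (_ : IsAct ζ')
    ⦃f : Z →ₗ[k] Z'⦄ (_ : Function.Injective f) (_ : ∀ b, f ∘ₗ ζ b = ζ' b ∘ₗ f) (t : Z ⊗[k] Y),
    f.rTensor Y t ∈ coinvKer (diagOp ζ' β) → t ∈ coinvKer (diagOp ζ β)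

/-- Vanishing in coinvariants is detected by `splitRight`, which takes values in Z ⊗ P and commutes
with f ⊗ id; the latter is injective over a field. -/
theorem coinvFlat_smulAct (P : Type v) [AddCommGroup P] [Module k P]
    [Module B P] [IsScalarTower k B P] [Module.Projective B P] :
    CoinvFlat (smulAct k B P) := by
  intro Z Z' _ _ _ _ ζ ζ' hζ hζ' f hf hfζ t ht
  obtain ⟨σ, h1, h2⟩ := exists_equivariant_section (k := k) (B := B) P
  have h3 := coinvKer_le_ker (splitRight_diagOp hζ' h2) ht
  have h4 := LinearMap.congr_fun (splitRight_nat hfζ σ) t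
  simp only [LinearMap.comp_apply, LinearMap.mem_ker] at h3 h4
  rw [h3] at h4
  have h5 : splitRight ζ σ t = 0 :=
    Module.Flat.rTensor_preserves_injective_linearMap (M := P) f hf (by rw [← h4, map_zero])
  have h6 := LinearMap.congr_fun (mkQ_splitRight hζ h1) t
  rw [LinearMap.comp_apply, h5, map_zero] at h6
  exact (Submodule.Quotient.mk_eq_zero _).1 h6.symm

theorem coinvFlat_of_subsingleton [Subsingleton Y] (β : B →ₗ[k] Module.End k Y) :
    CoinvFlat β := by
  intro Z Z' _ _ _ _ ζ ζ' hζ hζ' f hf hfζ t ht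
  rw [Subsingleton.elim t 0]
  exact zero_mem _

/-- In Z ⊗ (Y ⊗ Y') the legs of b act in the order b₍₃₎, b₍₁₎, b₍₂₎. This is also the action on (Z ⊗
Y') ⊗ Y, so Y' can be absorbed into Z, and flatness of the first factor suffices. -/
theorem CoinvFlat.diag {α : B →ₗ[k] Module.End k Y} (hα : CoinvFlat α)
    {β : B →ₗ[k] Module.End k Y'} (hβ : IsAct β) : CoinvFlat (diag α β) := by
  have key : ∀ ⦃Z : Type v⦄ [AddCommGroup Z] [Module k Z] (ζ : B →ₗ[k] Module.End k Z) (b : B),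
      ((TensorProduct.assoc k Z Y' Y).symm.toLinearMap ∘ₗ
        (TensorProduct.comm k Y Y').toLinearMap.lTensor Z) ∘ₗ diagOp ζ (HopfExcision.diag α β) b =
      diagOp (diagOp ζ β) α b ∘ₗ ((TensorProduct.assoc k Z Y' Y).symm.toLinearMap ∘ₗ
        (TensorProduct.comm k Y Y').toLinearMap.lTensor Z) := by
    intro Z _ _ ζ b
    simp only [HopfExcision.diag, HopfExcision.diagOp, onLeft_conv, onRight_conv, conv_assoc]
    refine conv_tw _ (fun c => ?_) (fun c => conv_tw _ (fun c => ?_) (fun c => ?_) c) b <;>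
    · ext x y z
      simp [onLeft, onRight]
  intro Z Z' _ _ _ _ ζ ζ' hζ hζ' f hf hfζ t ht
  have h1 := mem_coinvKer_map (key ζ') ht
  have h2 : ((TensorProduct.assoc k Z' Y' Y).symm.toLinearMap ∘ₗ
        (TensorProduct.comm k Y Y').toLinearMap.lTensor Z') (f.rTensor (Y ⊗[k] Y') t) =
      (f.rTensor Y').rTensor Y (((TensorProduct.assoc k Z Y' Y).symm.toLinearMap ∘ₗ
        (TensorProduct.comm k Y Y').toLinearMap.lTensor Z) t) := by
    refine LinearMap.congr_fun (f := (((TensorProduct.assoc k Z' Y' Y).symm.toLinearMap ∘ₗ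
        (TensorProduct.comm k Y Y').toLinearMap.lTensor Z') ∘ₗ f.rTensor (Y ⊗[k] Y')))
        (g := (f.rTensor Y').rTensor Y ∘ₗ (((TensorProduct.assoc k Z Y' Y).symm.toLinearMap ∘ₗ
        (TensorProduct.comm k Y Y').toLinearMap.lTensor Z))) ?_ t
    ext x y z
    simp
  rw [h2] at h1
  have h3 := hα (hζ.diagOp hβ) (hζ'.diagOp hβ)
    (Module.Flat.rTensor_preserves_injective_linearMap (M := Y') f hf)
    (diagOp_tw (g := LinearMap.id) hfζ (fun _ => rfl)) _ h1
  have h4 : ∀ b, ((TensorProduct.comm k Y' Y).toLinearMap.lTensor Z ∘ₗ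
      (TensorProduct.assoc k Z Y' Y).toLinearMap) ∘ₗ diagOp (HopfExcision.diagOp ζ β) α b =
      diagOp ζ (HopfExcision.diag α β) b ∘ₗ ((TensorProduct.comm k Y' Y).toLinearMap.lTensor Z ∘ₗ
      (TensorProduct.assoc k Z Y' Y).toLinearMap) := by
    intro b
    simp only [HopfExcision.diag, HopfExcision.diagOp, onLeft_conv, onRight_conv, conv_assoc]
    refine conv_tw _ (fun c => ?_) (fun c => conv_tw _ (fun c => ?_) (fun c => ?_) c) b <;>
    · ext x y z
      simp [onLeft, onRight]
  have h5 := mem_coinvKer_map h4 h3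
  have h6 : ∀ t, ((TensorProduct.comm k Y' Y).toLinearMap.lTensor Z ∘ₗ
      (TensorProduct.assoc k Z Y' Y).toLinearMap) (((TensorProduct.assoc k Z Y' Y).symm.toLinearMap
        ∘ₗ (TensorProduct.comm k Y Y').toLinearMap.lTensor Z) t) = t := by
    intro t
    refine LinearMap.congr_fun (f := ((TensorProduct.comm k Y' Y).toLinearMap.lTensor Z ∘ₗ
      (TensorProduct.assoc k Z Y' Y).toLinearMap) ∘ₗ
        ((TensorProduct.assoc k Z Y' Y).symm.toLinearMap
        ∘ₗ (TensorProduct.comm k Y Y').toLinearMap.lTensor Z)) (g := LinearMap.id) ?_ t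
    ext x y z
    simp
  rwa [h6] at h5

variable {hS : Function.Bijective (HopfAlgebra.antipode k (A := B))}

/-- `z ⊗ y ↦ z' ⊗ S⁻¹(b) y`, if `σ(z) = b ⊗ z'`. -/
def splitLeft (hS : Function.Bijective (HopfAlgebra.antipode k (A := B)))
    {Z Y : Type v} [AddCommGroup Z] [Module k Z] [AddCommGroup Y] [Module k Y]
    (β : B →ₗ[k] Module.End k Y) (σ : Z →ₗ[k] B ⊗[k] Z) : Z ⊗[k] Y →ₗ[k] Z ⊗[k] Y :=
  (TensorProduct.lift (β ∘ₗ antipodeInv k B hS)).lTensor Z ∘ₗ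
    (TensorProduct.assoc k Z B Y).toLinearMap ∘ₗ
    ((TensorProduct.comm k B Z).toLinearMap ∘ₗ σ).rTensor Y

/-- Mirror image of `mkQ_splitRight` with the projective factor on the left: z' ⊗ S⁻¹(b)y and bz' ⊗
y have the same class. The order of the legs forces S⁻¹ here. -/
theorem mkQ_splitLeft (hζ : IsAct ζ) {σ : Z →ₗ[k] B ⊗[k] Z}
    (hσ : ∀ z, TensorProduct.lift ζ (σ z) = z) :
    (coinvKer (diagOp ζ β)).mkQ ∘ₗ splitLeft hS β σ = (coinvKer (diagOp ζ β)).mkQ := by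
  refine TensorProduct.ext' fun z y => ?_
  have key : ∀ w : B ⊗[k] Z, (coinvKer (diagOp ζ β)).mkQ
      ((TensorProduct.lift (β ∘ₗ antipodeInv k B hS)).lTensor Z
        (TensorProduct.assoc k Z B Y (TensorProduct.comm k B Z w ⊗ₜ y))) =
      (coinvKer (diagOp ζ β)).mkQ (TensorProduct.lift ζ w ⊗ₜ y) := by
    intro w
    induction w with
    | zero => simp
    | add p q hp hq => simp only [TensorProduct.add_tmul, map_add, hp, hq]
    | tmul b z => exact coinv_antipodeInv hζ β b z y
  have := key (σ z)
  rw [hσ] at this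
  exact this

/-- S⁻¹(c₍₂₎b)c₍₁₎y = S⁻¹(b)S⁻¹(c₍₂₎)c₍₁₎y = ε(c)S⁻¹(b)y. -/
theorem splitLeft_diagOp (hβ : IsAct β) {σ : Z →ₗ[k] B ⊗[k] Z}
    (hσ : ∀ b z, σ (ζ b z) = (mulL k B b).rTensor Z (σ z)) (c : B) :
    splitLeft hS β σ ∘ₗ diagOp ζ β c = Coalgebra.counit (R := k) c • splitLeft hS β σ := by
  refine TensorProduct.ext' fun z y => ?_
  have key : ∀ t : B ⊗[k] B, splitLeft hS β σ (LinearMap.mul' k (Module.End k (Z ⊗[k] Y))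
      (TensorProduct.map (onRight Z β) (onLeft Y ζ) t) (z ⊗ₜ y)) =
      splitLeft hS β σ (z ⊗ₜ β (LinearMap.mul' k B (TensorProduct.comm k B B
      ((antipodeInv k B hS).lTensor B t))) y) := by
    intro t
    induction t with
    | zero => simp
    | add p q hp hq =>
      simp only [map_add, LinearMap.add_apply, TensorProduct.tmul_add, hp, hq]
    | tmul p q =>
      simp only [TensorProduct.map_tmul, LinearMap.mul'_apply, Module.End.mul_apply,
        onLeft_tmul, onRight_tmul, LinearMap.comp_apply, LinearMap.rTensor_tmul, splitLeft, hσ,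
        LinearMap.lTensor_tmul, TensorProduct.comm_tmul, LinearEquiv.coe_coe]
      induction σ z with
      | zero => simp
      | add p q hp hq => simp only [TensorProduct.add_tmul, map_add, hp, hq]
      | tmul b w => simp [mulL, antipodeInv_mul, hβ.mul]
  have := key (Coalgebra.comul (R := k) c)
  rw [antipodeInv_mul_comul, Algebra.algebraMap_eq_smul_one, map_smul, hβ.one] at this
  refine this.trans ?_
  simp

theorem splitLeft_nat {f : Y →ₗ[k] Y'} (hf : ∀ b, f ∘ₗ β b = β' b ∘ₗ f)
    (σ : Z →ₗ[k] B ⊗[k] Z) :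
    splitLeft hS β' σ ∘ₗ f.lTensor Z = f.lTensor Z ∘ₗ splitLeft hS β σ := by
  refine TensorProduct.ext' fun z y => ?_
  have hf' : ∀ b z, f (β b z) = β' b (f z) := fun b => LinearMap.congr_fun (hf b)
  simp only [LinearMap.comp_apply, splitLeft, LinearMap.rTensor_tmul, LinearMap.lTensor_tmul]
  induction σ z with
  | zero => simp
  | add p q hp hq => simp only [TensorProduct.add_tmul, map_add, hp, hq]
  | tmul b w => simp [hf']

/-- If `P` is projective, then the functor `Y ↦ k ⊗_B (P ⊗ Y)` is exact. -/
theorem coinv_exact_of_projective (hS : Function.Bijective (HopfAlgebra.antipode k (A := B)))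
    (P : Type v) [AddCommGroup P] [Module k P]
    [Module B P] [IsScalarTower k B P] [Module.Projective B P]
    {Y₁ Y₂ Y₃ : Type v} [AddCommGroup Y₁] [Module k Y₁] [AddCommGroup Y₂] [Module k Y₂]
    [AddCommGroup Y₃] [Module k Y₃] {β₂ : B →ₗ[k] Module.End k Y₂} {β₃ : B →ₗ[k] Module.End k Y₃}
    (h₃ : IsAct β₃) {f : Y₁ →ₗ[k] Y₂} {g : Y₂ →ₗ[k] Y₃}
    (hg : ∀ b, g ∘ₗ β₂ b = β₃ b ∘ₗ g) (hfg : Function.Exact f g) (t : P ⊗[k] Y₂)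
    (ht : g.lTensor P t ∈ coinvKer (diagOp (smulAct k B P) β₃)) :
    ∃ w, t - f.lTensor P w ∈ coinvKer (diagOp (smulAct k B P) β₂) := by
  obtain ⟨σ, h1, h2⟩ := exists_equivariant_section (k := k) (B := B) P
  -- `splitLeft` turns a cocycle modulo coinvariants into a genuine cocycle of the same class, to
  -- which exactness of P ⊗ Y over k applies.
  have h3 := coinvKer_le_ker (splitLeft_diagOp (hS := hS) h₃ h2) ht
  have h4 := LinearMap.congr_fun (splitLeft_nat (hS := hS) hg σ) t
  simp only [LinearMap.comp_apply, LinearMap.mem_ker] at h3 h4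
  rw [h3] at h4
  obtain ⟨w, hw⟩ := (Module.Flat.lTensor_exact P hfg _).1 h4.symm
  refine ⟨w, ?_⟩
  have h6 := LinearMap.congr_fun (mkQ_splitLeft (hS := hS) (β := β₂)
    (isAct_smulAct (k := k) (B := B) P) h1) t
  rw [LinearMap.comp_apply, ← sub_eq_zero, ← map_sub, ← hw] at h6
  have := (Submodule.Quotient.mk_eq_zero _).1 h6
  rw [← neg_mem_iff, neg_sub] at this
  exact this

end Projective

/-! ### Modules of finite projective dimension -/

section ProjectiveDimension

variable {k : Type u} [Field k] {B : Type v} [Ring B]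

/-- As g is surjective and equivariant, relations for X₃ ⊗ Y lift to relations for X₂ ⊗ Y;
subtracting such a lift reduces the claim to exactness over k. -/
theorem coinv_right_exact [Bialgebra k B] {X₁ X₂ X₃ Y : Type v} [AddCommGroup X₁] [Module k X₁]
    [AddCommGroup X₂] [Module k X₂] [AddCommGroup X₃] [Module k X₃] [AddCommGroup Y] [Module k Y]
    {α₂ : B →ₗ[k] Module.End k X₂} {α₃ : B →ₗ[k] Module.End k X₃} (β : B →ₗ[k] Module.End k Y)
    {f : X₁ →ₗ[k] X₂} {g : X₂ →ₗ[k] X₃} (hg : ∀ b, g ∘ₗ α₂ b = α₃ b ∘ₗ g)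
    (hfg : Function.Exact f g) (hs : Function.Surjective g) (t : X₂ ⊗[k] Y)
    (ht : g.rTensor Y t ∈ coinvKer (diagOp α₃ β)) :
    ∃ w, t - f.rTensor Y w ∈ coinvKer (diagOp α₂ β) := by
  obtain ⟨s, hs, he⟩ := exists_mem_coinvKer_lift
    (f := g.rTensor Y) (diagOp_tw (g := LinearMap.id) hg (fun _ => rfl))
    (LinearMap.rTensor_surjective Y hs) ht
  obtain ⟨w, hw⟩ := (Module.Flat.rTensor_exact Y hfg (t - s)).1 (by rw [map_sub, he, sub_self])
  exact ⟨w, by rwa [hw, sub_sub_cancel]⟩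

variable [HopfAlgebra k B]

/-- Dimension shifting for the exactness of `Y ↦ k ⊗_B (X ⊗ Y)`. -/
theorem coinv_exact_of_shortExact
    (hS : Function.Bijective (HopfAlgebra.antipode k (A := B)))
    {Y : ℕ → Type v} [∀ n, AddCommGroup (Y n)] [∀ n, Module k (Y n)]
    {β : ∀ n, B →ₗ[k] Module.End k (Y n)} (hβ : ∀ n, IsAct (β n)) (hflat : ∀ n, CoinvFlat (β n))
    {δ : ∀ n, Y n →ₗ[k] Y (n + 1)} (hδ : ∀ n b, δ n ∘ₗ β n b = β (n + 1) b ∘ₗ δ n)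
    (hex : ∀ n, Function.Exact (δ n) (δ (n + 1)))
    {X₁ P X : Type v} [AddCommGroup X₁] [Module k X₁] [Module B X₁] [IsScalarTower k B X₁]
    [AddCommGroup P] [Module k P] [Module B P] [IsScalarTower k B P] [Module.Projective B P]
    [AddCommGroup X] [Module k X] [Module B X] [IsScalarTower k B X]
    {f : X₁ →ₗ[B] P} {g : P →ₗ[B] X} (hf : Function.Injective f) (hg : Function.Surjective g)
    (hfg : Function.Exact f g)
    (ih : ∀ (n : ℕ) (t : X₁ ⊗[k] Y (n + 1))
      (_ : (δ (n + 1)).lTensor X₁ t ∈ coinvKer (diagOp (smulAct k B X₁) (β (n + 1 + 1)))),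
      ∃ w, t - (δ n).lTensor X₁ w ∈ coinvKer (diagOp (smulAct k B X₁) (β (n + 1))))
    (n : ℕ) (t : X ⊗[k] Y (n + 1))
    (ht : (δ (n + 1)).lTensor X t ∈ coinvKer (diagOp (smulAct k B X) (β (n + 1 + 1)))) :
    ∃ w, t - (δ n).lTensor X w ∈ coinvKer (diagOp (smulAct k B X) (β (n + 1))) := by
  have hδδ : ∀ n {T : Type v} [AddCommGroup T] [Module k T] (x : T ⊗[k] Y n),
      (δ (n + 1)).lTensor T ((δ n).lTensor T x) = 0 := by
    intro n T _ _ x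
    rw [← LinearMap.comp_apply, ← LinearMap.lTensor_comp, (hex n).linearMap_comp_eq_zero,
      LinearMap.lTensor_zero, LinearMap.zero_apply]
  have hδN : ∀ n {T : Type v} [AddCommGroup T] [Module k T] [Module B T] [IsScalarTower k B T]
      {x : T ⊗[k] Y n} (_ : x ∈ coinvKer (diagOp (smulAct k B T) (β n))),
      (δ n).lTensor T x ∈ coinvKer (diagOp (smulAct k B T) (β (n + 1))) :=
    fun n _ _ _ _ _ _ hx =>
      mem_coinvKer_map (diagOp_tw (f := LinearMap.id) (fun _ => rfl) (hδ n)) hx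
  let f' := f.restrictScalars k
  let g' := g.restrictScalars k
  have hf'B : ∀ b, f' ∘ₗ smulAct k B X₁ b = smulAct k B P b ∘ₗ f' :=
    fun b => LinearMap.ext fun x => f.map_smul b x
  have hg'B : ∀ b, g' ∘ₗ smulAct k B P b = smulAct k B X b ∘ₗ g' :=
    fun b => LinearMap.ext fun x => g.map_smul b x
  have hfN : ∀ n {x : X₁ ⊗[k] Y n}
      (_ : x ∈ coinvKer (diagOp (smulAct k B X₁) (β n))),
      f'.rTensor (Y n) x ∈ coinvKer (diagOp (smulAct k B P) (β n)) :=
    fun n _ hx => mem_coinvKer_map (diagOp_tw (g := LinearMap.id) hf'B (fun _ => rfl)) hx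
  have hgN : ∀ n {x : P ⊗[k] Y n}
      (_ : x ∈ coinvKer (diagOp (smulAct k B P) (β n))),
      g'.rTensor (Y n) x ∈ coinvKer (diagOp (smulAct k B X) (β n)) :=
    fun n _ hx => mem_coinvKer_map (diagOp_tw (g := LinearMap.id) hg'B (fun _ => rfl)) hx
  have hfδ : ∀ n x, f'.rTensor (Y (n + 1)) ((δ n).lTensor _ x) =
      (δ n).lTensor _ (f'.rTensor (Y n) x) := fun n x => by
    rw [← LinearMap.comp_apply, ← LinearMap.comp_apply, LinearMap.rTensor_comp_lTensor,
      LinearMap.lTensor_comp_rTensor]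
  have hgδ : ∀ n x, g'.rTensor (Y (n + 1)) ((δ n).lTensor _ x) =
      (δ n).lTensor _ (g'.rTensor (Y n) x) := fun n x => by
    rw [← LinearMap.comp_apply, ← LinearMap.comp_apply, LinearMap.rTensor_comp_lTensor,
      LinearMap.lTensor_comp_rTensor]
  obtain ⟨t, rfl⟩ := LinearMap.rTensor_surjective (Y (n + 1)) (g := g') hg t
  rw [← hgδ] at ht
  -- The coboundary of the lift of t to P ⊗ Y vanishes over X, hence comes from X₁ modulo
  -- coinvariants.
  obtain ⟨w₁, hw₁⟩ := coinv_right_exact (β (n + 1 + 1)) hg'B (f := f') hfg hg _ ht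
  have h1 := hδN _ hw₁
  rw [map_sub, hδδ, zero_sub, neg_mem_iff, ← hfδ] at h1
  -- In P ⊗ Y the image of δw₁ is trivial modulo coinvariants; flatness of Y transfers this to X₁ ⊗
  -- Y.
  have h2 := hflat _ (isAct_smulAct _) (isAct_smulAct _) (f := f')
    (hf) hf'B _ h1
  -- The hypothesis on X₁ is needed one degree higher. Subtracting the image of w₂ from the lift
  -- makes it a cocycle over P without changing its image over X.
  obtain ⟨w₂, hw₂⟩ := ih (n + 1) w₁ h2
  have h3 : (δ (n + 1)).lTensor _ (t - f'.rTensor (Y (n + 1)) w₂) ∈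
      coinvKer (diagOp (smulAct k B P) (β (n + 1 + 1))) := by
    have := add_mem hw₁ (hfN _ hw₂)
    rwa [map_sub, sub_add_sub_cancel, hfδ, ← map_sub] at this
  obtain ⟨w₃, hw₃⟩ := coinv_exact_of_projective hS P (hβ _) (hδ _) (hex n) _ h3
  refine ⟨g'.rTensor (Y n) w₃, ?_⟩
  have h4 := hgN _ hw₃
  have h5 : g'.rTensor (Y (n + 1)) (f'.rTensor (Y (n + 1)) w₂) = 0 := by
    rw [← LinearMap.comp_apply, ← LinearMap.rTensor_comp]
    have : g' ∘ₗ f' = 0 := LinearMap.ext hfg.apply_apply_eq_zero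
    rw [this, LinearMap.rTensor_zero, LinearMap.zero_apply]
  rwa [map_sub, map_sub, h5, sub_zero, hgδ] at h4

theorem hasProjectiveDimensionLE_of_shortExact {R : Type v} [Ring R] {X₁ P X : Type v}
    [AddCommGroup X₁] [Module R X₁] [AddCommGroup P] [Module R P] [Module.Projective R P]
    [AddCommGroup X] [Module R X] {f : X₁ →ₗ[R] P} {g : P →ₗ[R] X} (hf : Function.Injective f)
    (hg : Function.Surjective g) (hfg : Function.Exact f g) {d : ℕ}
    (hX : HasProjectiveDimensionLE (ModuleCat.of R X) (d + 1)) :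
    HasProjectiveDimensionLE (ModuleCat.of R X₁) d := by
  let S : ShortComplex (ModuleCat.{v} R) := ShortComplex.mk (ModuleCat.ofHom f)
    (ModuleCat.ofHom g) (by rw [← ModuleCat.ofHom_comp, hfg.linearMap_comp_eq_zero]; rfl)
  have hSE : S.ShortExact :=
    { exact := (ShortComplex.ShortExact.moduleCat_exact_iff_function_exact S).2 hfg
      mono_f := (ModuleCat.mono_iff_injective _).2 hf
      epi_g := (ModuleCat.epi_iff_surjective _).2 hg }
  have : Projective S.X₂ := (IsProjective.iff_projective (R := R) P).1 inferInstance
  exact (hSE.hasProjectiveDimensionLT_X₃_iff d this).1 hX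

/-- If `X` has finite projective dimension, then `Y ↦ k ⊗_B (X ⊗ Y)` preserves exact complexes
`Y₀ → Y₁ → ⋯` with flat terms. -/
theorem coinv_exact_of_hasProjectiveDimensionLE
    (hS : Function.Bijective (HopfAlgebra.antipode k (A := B)))
    {Y : ℕ → Type v} [∀ n, AddCommGroup (Y n)] [∀ n, Module k (Y n)]
    {β : ∀ n, B →ₗ[k] Module.End k (Y n)} (hβ : ∀ n, IsAct (β n)) (hflat : ∀ n, CoinvFlat (β n))
    {δ : ∀ n, Y n →ₗ[k] Y (n + 1)} (hδ : ∀ n b, δ n ∘ₗ β n b = β (n + 1) b ∘ₗ δ n)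
    (hex : ∀ n, Function.Exact (δ n) (δ (n + 1))) (d : ℕ) :
    ∀ (X : Type v) [AddCommGroup X] [Module k X] [Module B X] [IsScalarTower k B X]
      (_ : HasProjectiveDimensionLE (ModuleCat.of B X) d) (n : ℕ) (t : X ⊗[k] Y (n + 1))
      (_ : (δ (n + 1)).lTensor X t ∈ coinvKer (diagOp (smulAct k B X) (β (n + 1 + 1)))),
      ∃ w, t - (δ n).lTensor X w ∈ coinvKer (diagOp (smulAct k B X) (β (n + 1))) := by
  induction d with
  | zero =>
    intro X _ _ _ _ hX n t ht
    have := (projective_iff_hasProjectiveDimensionLE_zero (ModuleCat.of B X)).2 hX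
    have : Module.Projective B X := (IsProjective.iff_projective X).2 this
    exact coinv_exact_of_projective hS X (hβ _) (hδ _) (hex n) t ht
  | succ d ih =>
    intro X _ _ _ _ hX n t ht
    -- The free module on the set X covers X, and the kernel has projective dimension at most d.
    have hg : Function.Surjective (Finsupp.linearCombination B (id : X → X)) :=
      Finsupp.linearCombination_id_surjective B X
    have hf := (LinearMap.ker (Finsupp.linearCombination B (id : X → X))).injective_subtype
    have hfg := LinearMap.exact_subtype_ker_map (Finsupp.linearCombination B (id : X → X))
    have hker : HasProjectiveDimensionLE
        (ModuleCat.of B (LinearMap.ker (Finsupp.linearCombination B (id : X → X)))) d :=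
      hasProjectiveDimensionLE_of_shortExact hf hg hfg hX
    exact coinv_exact_of_shortExact hS hβ hflat hδ hex hf hg hfg (ih _ hker) n t ht

end ProjectiveDimension

/-! ### The filtration by the number of trailing factors in `K` -/

section Tail

variable {k : Type u} [Field k] {V K C Q : Type v}
  [AddCommGroup V] [Module k V] [AddCommGroup K] [Module k K]
  [AddCommGroup C] [Module k C] [AddCommGroup Q] [Module k Q]

/-- The map applying `e` to the last `a` factors `C` of `V ⊗ C^{⊗n}`. -/
def tailProj (V : Type v) [AddCommGroup V] [Module k V] (e : C →ₗ[k] C) :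
    (a n : ℕ) → (tower k V C n →ₗ[k] tower k V C n)
  | 0, _ => LinearMap.id
  | _ + 1, 0 => LinearMap.id
  | a + 1, n + 1 => (TensorProduct.map (tailProj V e a n) e :
      tower k V C n ⊗[k] C →ₗ[k] tower k V C n ⊗[k] C)

/-- `V ⊗ C^{⊗(n-a-1)} ⊗ Q ⊗ K^{⊗a}`, and zero for `n ≤ a`. -/
def tailQuot (k : Type u) [Field k] (V K C Q : Type v) [AddCommGroup V] [Module k V]
    [AddCommGroup K] [Module k K] [AddCommGroup C] [Module k C] [AddCommGroup Q] [Module k Q] :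
    ℕ → ℕ → ModuleCat.{v} k
  | 0, n => quotTower k V C Q n
  | _ + 1, 0 => ModuleCat.of k PUnit
  | a + 1, n + 1 => ModuleCat.of k (tailQuot k V K C Q a n ⊗[k] K)

/-- `id ⊗ ⋯ ⊗ id ⊗ p ⊗ r ⊗ ⋯ ⊗ r`. -/
def toTailQuot (V : Type v) [AddCommGroup V] [Module k V] (r : C →ₗ[k] K) (p : C →ₗ[k] Q) :
    (a n : ℕ) → (tower k V C n →ₗ[k] tailQuot k V K C Q a n)
  | 0, n => toQuotTower V p n
  | _ + 1, 0 => 0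
  | a + 1, n + 1 => (TensorProduct.map (toTailQuot V r p a n) r :
      tower k V C n ⊗[k] C →ₗ[k] tailQuot k V K C Q a n ⊗[k] K)

/-- `id ⊗ ⋯ ⊗ id ⊗ σ ⊗ i ⊗ ⋯ ⊗ i`. -/
def ofTailQuot (V : Type v) [AddCommGroup V] [Module k V] (i : K →ₗ[k] C) (σ : Q →ₗ[k] C) :
    (a n : ℕ) → (tailQuot k V K C Q a n →ₗ[k] tower k V C n)
  | 0, n => ofQuotTower V σ n
  | _ + 1, 0 => 0
  | a + 1, n + 1 => (TensorProduct.map (ofTailQuot V i σ a n) i :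
      tailQuot k V K C Q a n ⊗[k] K →ₗ[k] tower k V C n ⊗[k] C)

/-- The map `d ⊗ id ⊗ ⋯ ⊗ id`, for `d` the differential of `V ⊗ C^{⊗*} ⊗ Q`. -/
def tailFace (K : Type v) [AddCommGroup K] [Module k K] (ρ : V →ₗ[k] V ⊗[k] C)
    (Δ : C →ₗ[k] C ⊗[k] C) (p : C →ₗ[k] Q) (σ : Q →ₗ[k] C) :
    (a n : ℕ) → (tailQuot k V K C Q a n →ₗ[k] tailQuot k V K C Q a (n + 1))
  | 0, n => quotFace ρ Δ p σ n
  | _ + 1, 0 => 0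
  | a + 1, n + 1 => ((tailFace K ρ Δ p σ a n).rTensor K :
      tailQuot k V K C Q a n ⊗[k] K →ₗ[k] tailQuot k V K C Q a (n + 1) ⊗[k] K)

instance (a : ℕ) : Subsingleton (tailQuot k V K C Q a 0) := by
  cases a <;> exact inferInstanceAs (Subsingleton PUnit)

instance (a : ℕ) : Subsingleton (tailQuot k V K C Q (a + 1) (0 + 1)) :=
  inferInstanceAs (Subsingleton (tailQuot k V K C Q a 0 ⊗[k] K))

theorem map_comp_eq {A A' A'' D D' D'' : Type*} [AddCommGroup A] [Module k A] [AddCommGroup A']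
    [Module k A'] [AddCommGroup A''] [Module k A''] [AddCommGroup D] [Module k D]
    [AddCommGroup D'] [Module k D'] [AddCommGroup D''] [Module k D'']
    {f : A' →ₗ[k] A''} {g : A →ₗ[k] A'} {h : A →ₗ[k] A''} {f' : D' →ₗ[k] D''} {g' : D →ₗ[k] D'}
    {h' : D →ₗ[k] D''} (e : f ∘ₗ g = h) (e' : f' ∘ₗ g' = h') :
    TensorProduct.map f f' ∘ₗ TensorProduct.map g g' = TensorProduct.map h h' := by
  rw [← TensorProduct.map_comp, e, e']

theorem tailProj_idem {e : C →ₗ[k] C} (he : e ∘ₗ e = e) (a n : ℕ) :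
    tailProj V e a n ∘ₗ tailProj V e a n = tailProj V e a n := by
  induction a generalizing n with
  | zero => rfl
  | succ a ih =>
    cases n with
    | zero => rfl
    | succ n => exact map_comp_eq (ih n) he

theorem tailProj_zero (e : C →ₗ[k] C) (a : ℕ) : tailProj V e a 0 = LinearMap.id := by
  cases a <;> rfl

/-- A chain with a factors of the tail in the image of e keeps this property when another such
factor is appended. -/
theorem tailProj_comp_map {e : C →ₗ[k] C} (he : e ∘ₗ e = e) {D : Type v} [AddCommGroup D]
    [Module k D] {f : D →ₗ[k] C} (hf : e ∘ₗ f = f) (a n : ℕ) :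
    tailProj V e a (n + 1) ∘ₗ TensorProduct.map (tailProj V e a n) f =
      TensorProduct.map (tailProj V e a n) f := by
  induction a generalizing n D with
  | zero => rfl
  | succ a ih =>
    cases n with
    | zero => exact map_comp_eq (by rw [tailProj_zero]; rfl) hf
    -- After the last factor is peeled off, the next one carries e, so the induction hypothesis is
    -- used with e in place of f.
    | succ n => exact map_comp_eq (ih he n) hf

/-- Appending a factor killed by p to a tail of length a gives a tail of length a + 1, which is zero
in F_a/F_{a+1}. This is why most faces vanish on the graded pieces. -/
theorem toTailQuot_comp_map {e : C →ₗ[k] C} {p : C →ₗ[k] Q} (hp : p ∘ₗ e = 0)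
    (r : C →ₗ[k] K) {D : Type v} [AddCommGroup D]
    [Module k D] {f : D →ₗ[k] C} (hf : p ∘ₗ f = 0) (a n : ℕ) :
    toTailQuot V r p a (n + 1) ∘ₗ TensorProduct.map (tailProj V e a n) f = 0 := by
  induction a generalizing n D with
  | zero =>
    exact (map_comp_eq rfl hf).trans (TensorProduct.map_zero_right _)
  | succ a ih =>
    cases n with
    | zero => exact LinearMap.ext fun _ => Subsingleton.elim _ _
    | succ n =>
      exact (map_comp_eq (ih hp n) rfl).trans (TensorProduct.map_zero_left _)

theorem toTailQuot_ofTailQuot {i : K →ₗ[k] C} {r : C →ₗ[k] K} {p : C →ₗ[k] Q} {σ : Q →ₗ[k] C}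
    (hr : r ∘ₗ i = LinearMap.id) (hσ : p ∘ₗ σ = LinearMap.id) (a n : ℕ) :
    toTailQuot V r p a n ∘ₗ ofTailQuot V i σ a n = LinearMap.id := by
  induction a generalizing n with
  | zero => exact toQuotTower_ofQuotTower hσ n
  | succ a ih =>
    cases n with
    | zero => exact LinearMap.ext fun _ => Subsingleton.elim _ _
    | succ n => exact (map_comp_eq (ih n) hr).trans TensorProduct.map_id

theorem tailProj_ofTailQuot {e : C →ₗ[k] C} {i : K →ₗ[k] C} (hei : e ∘ₗ i = i)
    (σ : Q →ₗ[k] C) (a n : ℕ) :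
    tailProj V e a n ∘ₗ ofTailQuot V i σ a n = ofTailQuot V i σ a n := by
  induction a generalizing n with
  | zero => rfl
  | succ a ih =>
    cases n with
    | zero => rfl
    | succ n => exact map_comp_eq (ih n) hei

/-- Insert 1 = ir + σp at the factor just before the tail: F_a is the sum of F_{a+1} and a copy of
the graded piece. -/
theorem ofTailQuot_toTailQuot {i : K →ₗ[k] C} {r : C →ₗ[k] K} {p : C →ₗ[k] Q} {σ : Q →ₗ[k] C}
    (hsum : i ∘ₗ r + σ ∘ₗ p = LinearMap.id) (a n : ℕ) :
    ofTailQuot V i σ a n ∘ₗ toTailQuot V r p a n + tailProj V (i ∘ₗ r) (a + 1) n =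
      tailProj V (i ∘ₗ r) a n := by
  induction a generalizing n with
  | zero =>
    cases n with
    | zero => exact LinearMap.ext fun _ => zero_add _
    | succ n =>
      have h1 : (σ.lTensor (tower k V C n)) ∘ₗ p.lTensor (tower k V C n) +
          TensorProduct.map LinearMap.id (i ∘ₗ r) = LinearMap.id := by
        rw [← LinearMap.lTensor_comp]
        refine (LinearMap.lTensor_add _ _ _).symm.trans ?_
        rw [add_comm, hsum, LinearMap.lTensor_id]
      exact h1
  | succ a ih =>
    cases n with
    | zero => exact LinearMap.ext fun _ => zero_add _
    | succ n =>
      have h1 := congrArg (fun t => TensorProduct.map t (i ∘ₗ r)) (ih n)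
      simp only [TensorProduct.map_add_left] at h1
      refine Eq.trans (congrArg₂ (· + ·) ?_ rfl) h1
      exact map_comp_eq rfl rfl

theorem splitLast_comp_map {ΔK : K →ₗ[k] K ⊗[k] K} {ΔC : C →ₗ[k] C ⊗[k] C} {i : K →ₗ[k] C}
    (hi : ΔC ∘ₗ i = TensorProduct.map i i ∘ₗ ΔK) {T T' : Type v} [AddCommGroup T] [Module k T]
    [AddCommGroup T'] [Module k T'] (φ : T →ₗ[k] T') :
    splitLast T' ΔC ∘ₗ TensorProduct.map φ i =
      TensorProduct.map (TensorProduct.map φ i) i ∘ₗ splitLast T ΔK := by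
  apply TensorProduct.ext'
  intro x y
  have h1 := LinearMap.congr_fun hi y
  simp only [LinearMap.comp_apply] at h1
  simp only [LinearMap.comp_apply, splitLast, LinearMap.lTensor_tmul, TensorProduct.map_tmul, h1]
  induction ΔK y with
  | zero => simp
  | add p q hp hq => simp only [TensorProduct.tmul_add, map_add, hp, hq]
  | tmul p q => simp

/-- When the last factor lies in K, its comultiplication is computed in K; the resulting term
visibly ends in two factors from K. -/
theorem faceStep_comp_map {ΔK : K →ₗ[k] K ⊗[k] K} {ΔC : C →ₗ[k] C ⊗[k] C} {i : K →ₗ[k] C}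
    (hi : ΔC ∘ₗ i = TensorProduct.map i i ∘ₗ ΔK) {T : Type v} [AddCommGroup T] [Module k T]
    (φ : T →ₗ[k] T) (s : k) (d : T →ₗ[k] T ⊗[k] C) (r : C →ₗ[k] K) :
    faceStep T ΔC s d ∘ₗ TensorProduct.map φ (i ∘ₗ r) =
      TensorProduct.map (d ∘ₗ φ) (i ∘ₗ r) + s • (TensorProduct.map (TensorProduct.map φ i) i ∘ₗ
        splitLast T ΔK ∘ₗ r.lTensor T) := by
  have h1 : TensorProduct.map φ (i ∘ₗ r) = TensorProduct.map φ i ∘ₗ r.lTensor T :=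
    (map_comp_eq (LinearMap.comp_id _) rfl).symm
  rw [faceStep, LinearMap.add_comp, LinearMap.smul_comp]
  congr 1
  · exact map_comp_eq rfl (LinearMap.id_comp _)
  · rw [h1, ← LinearMap.comp_assoc, splitLast_comp_map hi, LinearMap.comp_assoc]

/-- Stability of the tail condition when one more factor is added: the old faces preserve it by
`h1`, and the new comultiplication by `h2`. -/
theorem map_faceStep_map {ΔK : K →ₗ[k] K ⊗[k] K} {ΔC : C →ₗ[k] C ⊗[k] C} {i : K →ₗ[k] C}
    (hi : ΔC ∘ₗ i = TensorProduct.map i i ∘ₗ ΔK) {r : C →ₗ[k] K} (hr : r ∘ₗ i = LinearMap.id)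
    {T : Type v} [AddCommGroup T] [Module k T] {φ : T →ₗ[k] T} {φ' : T ⊗[k] C →ₗ[k] T ⊗[k] C}
    {d : T →ₗ[k] T ⊗[k] C} (h1 : φ' ∘ₗ d ∘ₗ φ = d ∘ₗ φ)
    (h2 : φ' ∘ₗ TensorProduct.map φ i = TensorProduct.map φ i) (s : k) :
    TensorProduct.map φ' (i ∘ₗ r) ∘ₗ faceStep T ΔC s d ∘ₗ TensorProduct.map φ (i ∘ₗ r) =
      faceStep T ΔC s d ∘ₗ TensorProduct.map φ (i ∘ₗ r) := by
  have hei : (i ∘ₗ r) ∘ₗ i = i := by rw [LinearMap.comp_assoc, hr, LinearMap.comp_id]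
  have hee : (i ∘ₗ r) ∘ₗ (i ∘ₗ r) = i ∘ₗ r := by rw [← LinearMap.comp_assoc, hei]
  rw [faceStep_comp_map hi, LinearMap.comp_add, LinearMap.comp_smul, map_comp_eq h1 hee,
    ← LinearMap.comp_assoc, map_comp_eq h2 hei]

/-- On the graded piece the new comultiplication lengthens the tail and dies by `h2`, so only the
old differential survives, tensored with the identity of K. -/
theorem map_faceStep_map_eq {ΔK : K →ₗ[k] K ⊗[k] K} {ΔC : C →ₗ[k] C ⊗[k] C} {i : K →ₗ[k] C}
    (hi : ΔC ∘ₗ i = TensorProduct.map i i ∘ₗ ΔK) {r : C →ₗ[k] K} (hr : r ∘ₗ i = LinearMap.id)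
    {T G G' : Type v} [AddCommGroup T] [Module k T] [AddCommGroup G] [Module k G]
    [AddCommGroup G'] [Module k G'] {φ : T →ₗ[k] T} {g : T →ₗ[k] G} {g' : T ⊗[k] C →ₗ[k] G'}
    {δ : G →ₗ[k] G'} {d : T →ₗ[k] T ⊗[k] C} (h1 : g' ∘ₗ d ∘ₗ φ = δ ∘ₗ g)
    (h2 : g' ∘ₗ TensorProduct.map φ i = 0) (s : k) :
    TensorProduct.map g' r ∘ₗ faceStep T ΔC s d ∘ₗ TensorProduct.map φ (i ∘ₗ r) =
      δ.rTensor K ∘ₗ TensorProduct.map g r := by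
  have hre : r ∘ₗ (i ∘ₗ r) = r := by rw [← LinearMap.comp_assoc, hr, LinearMap.id_comp]
  rw [faceStep_comp_map hi, LinearMap.comp_add, LinearMap.comp_smul, map_comp_eq h1 hre,
    ← LinearMap.comp_assoc, map_comp_eq h2 hr, TensorProduct.map_zero_left, LinearMap.zero_comp,
    smul_zero, add_zero]
  exact (map_comp_eq rfl (LinearMap.id_comp r)).symm

theorem tailProj_faceSum {ΔK : K →ₗ[k] K ⊗[k] K} {ΔC : C →ₗ[k] C ⊗[k] C} {i : K →ₗ[k] C}
    (hi : ΔC ∘ₗ i = TensorProduct.map i i ∘ₗ ΔK) {r : C →ₗ[k] K} (hr : r ∘ₗ i = LinearMap.id)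
    {ρ : V →ₗ[k] V ⊗[k] C} (hρ : (i ∘ₗ r).lTensor V ∘ₗ ρ = ρ) (a n : ℕ) :
    tailProj V (i ∘ₗ r) a (n + 1) ∘ₗ faceSum ρ ΔC n ∘ₗ tailProj V (i ∘ₗ r) a n =
      faceSum ρ ΔC n ∘ₗ tailProj V (i ∘ₗ r) a n := by
  have hei : (i ∘ₗ r) ∘ₗ i = i := by rw [LinearMap.comp_assoc, hr, LinearMap.comp_id]
  have hee : (i ∘ₗ r) ∘ₗ (i ∘ₗ r) = i ∘ₗ r := by rw [← LinearMap.comp_assoc, hei]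
  induction a generalizing n with
  | zero => rfl
  | succ a ih =>
    cases n with
    | zero =>
      -- In degree zero the only face is the coaction, and its new factor lies in K by `hρ`.
      change TensorProduct.map (tailProj V (i ∘ₗ r) a 0) (i ∘ₗ r) ∘ₗ ρ = ρ
      rw [tailProj_zero]
      exact hρ
    | succ n =>
      exact map_faceStep_map hi hr (ih n) (tailProj_comp_map hee hei a n) _

theorem toTailQuot_faceSum {ΔK : K →ₗ[k] K ⊗[k] K} {ΔC : C →ₗ[k] C ⊗[k] C} {i : K →ₗ[k] C}
    (hi : ΔC ∘ₗ i = TensorProduct.map i i ∘ₗ ΔK) {r : C →ₗ[k] K} (hr : r ∘ₗ i = LinearMap.id)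
    {p : C →ₗ[k] Q} {σ : Q →ₗ[k] C} (hpi : p ∘ₗ i = 0)
    (hsum : i ∘ₗ r + σ ∘ₗ p = LinearMap.id)
    {ρ : V →ₗ[k] V ⊗[k] C} (hρ : p.lTensor V ∘ₗ ρ = 0) (a n : ℕ) :
    toTailQuot V r p a (n + 1) ∘ₗ faceSum ρ ΔC n ∘ₗ tailProj V (i ∘ₗ r) a n =
      tailFace K ρ ΔC p σ a n ∘ₗ toTailQuot V r p a n := by
  induction a generalizing n with
  | zero => exact (quotFace_toQuotTower hi hpi hsum hρ n).symm
  | succ a ih =>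
    cases n with
    | zero => exact LinearMap.ext fun _ => Subsingleton.elim _ _
    | succ n =>
      have hpe : p ∘ₗ i ∘ₗ r = 0 := by rw [← LinearMap.comp_assoc, hpi, LinearMap.zero_comp]
      exact map_faceStep_map_eq hi hr (ih n) (toTailQuot_comp_map hpe r hpi a n) _

theorem tailFace_exact {ρ : V →ₗ[k] V ⊗[k] C} {Δ : C →ₗ[k] C ⊗[k] C} {p : C →ₗ[k] Q}
    {σ : Q →ₗ[k] C}
    (h : ∀ n, Function.Exact (quotFace ρ Δ p σ n) (quotFace ρ Δ p σ (n + 1))) (a n : ℕ) :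
    Function.Exact (tailFace K ρ Δ p σ a n) (tailFace K ρ Δ p σ a (n + 1)) := by
  induction a generalizing n with
  | zero => exact h n
  | succ a ih =>
    cases n with
    | zero =>
      intro y
      rw [Subsingleton.elim y 0]
      exact ⟨fun _ => ⟨0, map_zero _⟩, fun _ => map_zero _⟩
    | succ n => exact Module.Flat.rTensor_exact K (ih n)

theorem tailProj_towerMap {i : K →ₗ[k] C} {e : C →ₗ[k] C} (hei : e ∘ₗ i = i) (a n : ℕ) :
    tailProj V e a n ∘ₗ towerMap i n = towerMap i n := by
  induction a generalizing n with
  | zero => rfl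
  | succ a ih =>
    cases n with
    | zero => rfl
    | succ n => exact map_comp_eq (ih n) hei

/-- In degree n the projection onto F_n acts on every factor C, so its image is that of V ⊗ K^{⊗n}.
-/
theorem tailProj_self (i : K →ₗ[k] C) (r : C →ₗ[k] K) (n : ℕ) :
    tailProj V (i ∘ₗ r) n n = towerMap i n ∘ₗ towerMap r n := by
  induction n with
  | zero => rfl
  | succ n ih => exact (map_comp_eq ih.symm rfl).symm

theorem map_assoc_rTensor {T : Type v} [AddCommGroup T] [Module k T] {l : T →ₗ[k] C ⊗[k] T}
    {φ : T →ₗ[k] T} {e : C →ₗ[k] C} (h : TensorProduct.map e φ ∘ₗ l = l ∘ₗ φ) (f : C →ₗ[k] C) :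
    TensorProduct.map e (TensorProduct.map φ f) ∘ₗ
      ((TensorProduct.assoc k C T C).toLinearMap ∘ₗ l.rTensor C) =
      ((TensorProduct.assoc k C T C).toLinearMap ∘ₗ l.rTensor C) ∘ₗ TensorProduct.map φ f := by
  apply TensorProduct.ext'
  intro x y
  have h1 := LinearMap.congr_fun h x
  simp only [LinearMap.comp_apply] at h1
  simp only [LinearMap.comp_apply, LinearMap.rTensor_tmul, TensorProduct.map_tmul, ← h1]
  induction l x with
  | zero => simp
  | add p q hp hq => simp only [TensorProduct.add_tmul, map_add, hp, hq]
  | tmul p q => simp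

/-- The coaction only involves the first factor V, where its values are fixed by e, so it does not
interfere with the tail. -/
theorem tailProj_towerCoact {e : C →ₗ[k] C} {l : V →ₗ[k] C ⊗[k] V} (hl : e.rTensor V ∘ₗ l = l)
    (a n : ℕ) : TensorProduct.map e (tailProj V e a n) ∘ₗ towerCoact l n =
      towerCoact l n ∘ₗ tailProj V e a n := by
  induction n generalizing a with
  | zero =>
    rw [tailProj_zero]
    exact hl
  | succ n ih =>
    cases a with
    | zero =>
      have := map_assoc_rTensor (T := tower k V C n) (ih 0) LinearMap.id
      change TensorProduct.map e (TensorProduct.map LinearMap.id LinearMap.id) ∘ₗ _ =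
        _ ∘ₗ TensorProduct.map LinearMap.id LinearMap.id at this
      rw [TensorProduct.map_id] at this
      exact this
    | succ a => exact map_assoc_rTensor (ih a) e

end Tail

/-! ### Diagonal actions on the graded pieces, and their flatness -/

section TailAction

variable {k : Type u} [Field k] {B : Type v} [Ring B] {V K C Q : Type v}
  [AddCommGroup V] [Module k V] [AddCommGroup K] [Module k K]
  [AddCommGroup C] [Module k C] [AddCommGroup Q] [Module k Q]

/-- The diagonal action on `V ⊗ C^{⊗(n-1)} ⊗ Q`. -/
def quotAct [Bialgebra k B] (α : B →ₗ[k] Module.End k V) (βC : B →ₗ[k] Module.End k C)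
    (βQ : B →ₗ[k] Module.End k Q) : (n : ℕ) → (B →ₗ[k] Module.End k (quotTower k V C Q n))
  | 0 => 0
  | n + 1 => (diag (towerAct α βC n) βQ : B →ₗ[k] Module.End k (tower k V C n ⊗[k] Q))

/-- The diagonal action on `V ⊗ C^{⊗(n-a-1)} ⊗ Q ⊗ K^{⊗a}`. -/
def tailAct [Bialgebra k B] (α : B →ₗ[k] Module.End k V) (βK : B →ₗ[k] Module.End k K)
    (βC : B →ₗ[k] Module.End k C) (βQ : B →ₗ[k] Module.End k Q) :
    (a n : ℕ) → (B →ₗ[k] Module.End k (tailQuot k V K C Q a n))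
  | 0, n => quotAct α βC βQ n
  | _ + 1, 0 => 0
  | a + 1, n + 1 => (diag (tailAct α βK βC βQ a n) βK :
      B →ₗ[k] Module.End k (tailQuot k V K C Q a n ⊗[k] K))

theorem isAct_of_subsingleton [Algebra k B] [Subsingleton V] (α : B →ₗ[k] Module.End k V) :
    IsAct α :=
  ⟨LinearMap.ext fun _ => Subsingleton.elim _ _, fun _ _ =>
    LinearMap.ext fun _ => Subsingleton.elim _ _⟩

theorem comp_eq_of_subsingleton [Algebra k B] [Subsingleton V] {f : V →ₗ[k] C}
    (α : B →ₗ[k] Module.End k V) (β : B →ₗ[k] Module.End k C) (b : B) :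
    f ∘ₗ α b = β b ∘ₗ f :=
  LinearMap.ext fun x => by rw [Subsingleton.elim x 0, map_zero, map_zero]

instance : Subsingleton (quotTower k V C Q 0) := inferInstanceAs (Subsingleton PUnit)

section Bialgebra

variable [Bialgebra k B] {α : B →ₗ[k] Module.End k V} {βK : B →ₗ[k] Module.End k K}
  {βC : B →ₗ[k] Module.End k C} {βQ : B →ₗ[k] Module.End k Q}

theorem IsAct.tailAct (hα : IsAct α) (hK : IsAct βK) (hC : IsAct βC) (hQ : IsAct βQ) (a n : ℕ) :
    IsAct (tailAct α βK βC βQ a n) := by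
  induction a generalizing n with
  | zero =>
    cases n with
    | zero => exact isAct_of_subsingleton _
    | succ n => exact (hα.towerAct hC n).diag hQ
  | succ a ih =>
    cases n with
    | zero => exact isAct_of_subsingleton _
    | succ n => exact (ih n).diag hK

theorem toQuotTower_tw {p : C →ₗ[k] Q} (hp : ∀ b, p ∘ₗ βC b = βQ b ∘ₗ p) (n : ℕ) (b : B) :
    toQuotTower V p n ∘ₗ towerAct α βC n b = quotAct α βC βQ n b ∘ₗ toQuotTower V p n := by
  cases n with
  | zero => exact LinearMap.ext fun _ => Subsingleton.elim _ _
  | succ n => exact diag_tw (f := LinearMap.id) (fun _ => rfl) hp b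

theorem ofQuotTower_tw {σ : Q →ₗ[k] C} (hσ : ∀ b, σ ∘ₗ βQ b = βC b ∘ₗ σ) (n : ℕ) (b : B) :
    ofQuotTower V σ n ∘ₗ quotAct α βC βQ n b = towerAct α βC n b ∘ₗ ofQuotTower V σ n := by
  cases n with
  | zero => exact comp_eq_of_subsingleton _ _ b
  | succ n => exact diag_tw (f := LinearMap.id) (fun _ => rfl) hσ b

theorem toTailQuot_tw {r : C →ₗ[k] K} (hr : ∀ b, r ∘ₗ βC b = βK b ∘ₗ r) {p : C →ₗ[k] Q}
    (hp : ∀ b, p ∘ₗ βC b = βQ b ∘ₗ p) (a n : ℕ) (b : B) :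
    toTailQuot V r p a n ∘ₗ towerAct α βC n b =
      tailAct α βK βC βQ a n b ∘ₗ toTailQuot V r p a n := by
  induction a generalizing n b with
  | zero => exact toQuotTower_tw hp n b
  | succ a ih =>
    cases n with
    | zero => exact LinearMap.ext fun _ => Subsingleton.elim _ _
    | succ n => exact diag_tw (ih n) hr b

theorem ofTailQuot_tw {i : K →ₗ[k] C} (hi : ∀ b, i ∘ₗ βK b = βC b ∘ₗ i) {σ : Q →ₗ[k] C}
    (hσ : ∀ b, σ ∘ₗ βQ b = βC b ∘ₗ σ) (a n : ℕ) (b : B) :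
    ofTailQuot V i σ a n ∘ₗ tailAct α βK βC βQ a n b =
      towerAct α βC n b ∘ₗ ofTailQuot V i σ a n := by
  induction a generalizing n b with
  | zero => exact ofQuotTower_tw hσ n b
  | succ a ih =>
    cases n with
    | zero => exact comp_eq_of_subsingleton _ _ b
    | succ n => exact diag_tw (ih n) hi b

theorem tailFace_tw {ρ : V →ₗ[k] V ⊗[k] C} {Δ : C →ₗ[k] C ⊗[k] C}
    (hρ : ∀ b, ρ ∘ₗ α b = diag α βC b ∘ₗ ρ) (hΔ : ∀ b, Δ ∘ₗ βC b = diag βC βC b ∘ₗ Δ)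
    {p : C →ₗ[k] Q} (hp : ∀ b, p ∘ₗ βC b = βQ b ∘ₗ p) {σ : Q →ₗ[k] C}
    (hσ : ∀ b, σ ∘ₗ βQ b = βC b ∘ₗ σ) (a n : ℕ) (b : B) :
    tailFace K ρ Δ p σ a n ∘ₗ tailAct α βK βC βQ a n b =
      tailAct α βK βC βQ a (n + 1) b ∘ₗ tailFace K ρ Δ p σ a n := by
  induction a generalizing n b with
  | zero =>
    change (toQuotTower V p (n + 1) ∘ₗ faceSum ρ Δ n ∘ₗ ofQuotTower V σ n) ∘ₗ
      quotAct α βC βQ n b = quotAct α βC βQ (n + 1) b ∘ₗ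
      (toQuotTower V p (n + 1) ∘ₗ faceSum ρ Δ n ∘ₗ ofQuotTower V σ n)
    rw [LinearMap.comp_assoc, LinearMap.comp_assoc, ofQuotTower_tw hσ,
      ← LinearMap.comp_assoc (ofQuotTower V σ n), faceSum_tw hΔ hρ, LinearMap.comp_assoc,
      ← LinearMap.comp_assoc, toQuotTower_tw hp, LinearMap.comp_assoc]
  | succ a ih =>
    cases n with
    | zero => exact comp_eq_of_subsingleton _ _ b
    | succ n => exact diag_tw (g := LinearMap.id) (ih n) (fun _ => rfl) b

end Bialgebra

variable [HopfAlgebra k B] {α : B →ₗ[k] Module.End k V} {βK : B →ₗ[k] Module.End k K}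
  {βC : B →ₗ[k] Module.End k C} {βQ : B →ₗ[k] Module.End k Q}

theorem CoinvFlat.towerAct (hα : CoinvFlat α) (hC : IsAct βC) (n : ℕ) :
    CoinvFlat (towerAct α βC n) := by
  induction n with
  | zero => exact hα
  | succ n ih => exact ih.diag hC

/-- By `CoinvFlat.diag`, flatness of the first tensor factor V alone makes all the graded pieces
flat. -/
theorem CoinvFlat.tailAct (hα : CoinvFlat α) (hK : IsAct βK) (hC : IsAct βC) (hQ : IsAct βQ)
    (a n : ℕ) : CoinvFlat (tailAct α βK βC βQ a n) := by
  induction a generalizing n with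
  | zero =>
    cases n with
    | zero => exact coinvFlat_of_subsingleton _
    | succ n => exact (hα.towerAct hC n).diag hQ
  | succ a ih =>
    cases n with
    | zero => exact coinvFlat_of_subsingleton _
    | succ n => exact (ih n).diag hK

end TailAction

/-! ### The filtered complex -/

section Filtration

variable {k : Type u} [Field k] {B : Type v} [Ring B] [HopfAlgebra k B]
  {X M K C Q : Type v} [AddCommGroup X] [Module k X] [Module B X] [IsScalarTower k B X]
  [AddCommGroup M] [Module k M] [Module B M] [IsScalarTower k B M]
  [AddCommGroup K] [Module k K] [Module B K] [IsScalarTower k B K] [NUCoalgebra k K]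
  [AddCommGroup C] [Module k C] [Module B C] [IsScalarTower k B C] [NUCoalgebra k C]
  [AddCommGroup Q] [Module k Q] [Module B Q] [IsScalarTower k B Q] [NUCoalgebra k Q]

/-- The left coaction of M takes values in K ⊗ M, and multiplying by x₍₋₁₎ stays in K. So on F_a the
last face appends a factor from K to a tail of length a; r and i make this visible through
naturality of `twist`. -/
theorem lastFace_tailProj (P : LeftComodule k B X) (N : EquivariantBicomodule k B C M)
    (i : ModuleCoalgebraHom k B K C) (r : C →ₗ[k] K)
    (hl : (i.lin ∘ₗ r).rTensor M ∘ₗ N.coactL = N.coactL) (a n : ℕ) :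
    lastFace P N n ∘ₗ (tailProj M (i.lin ∘ₗ r) a n).lTensor X =
      (TensorProduct.map (tailProj M (i.lin ∘ₗ r) a n) i.lin).lTensor X ∘ₗ
        twist P.coact (r.rTensor (tower k M C n) ∘ₗ towerCoact N.coactL n) := by
  refine twist_nat P.coact (fun b c => i.map_smul b c) ?_
  rw [← tailProj_towerCoact hl, ← LinearMap.comp_assoc]
  congr 1
  exact map_comp_eq rfl (LinearMap.comp_id _)

theorem lTensor_chtwD_comp (P : LeftComodule k B X) (N : EquivariantBicomodule k B C M)
    (n : ℕ) {Z : Type v} [AddCommGroup Z] [Module k Z] (f : tower k M C (n + 1) →ₗ[k] Z)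
    (g : tower k M C n →ₗ[k] tower k M C n) :
    f.lTensor X ∘ₗ chtwD P N n ∘ₗ g.lTensor X =
      (f ∘ₗ faceSum N.coactR NUCoalgebra.comul n ∘ₗ g).lTensor X + (-1 : k) ^ (n + 1) •
        (f.lTensor X ∘ₗ lastFace P N n ∘ₗ g.lTensor X) := by
  rw [chtwD, LinearMap.add_comp, LinearMap.smul_comp, LinearMap.comp_add, LinearMap.comp_smul,
    LinearMap.lTensor_comp, LinearMap.lTensor_comp]

/-- F_a is a subcomplex: the untwisted faces are treated by `tailProj_faceSum`, the last one by
`lastFace_tailProj`. -/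
theorem tailProj_chtwD (P : LeftComodule k B X) (N : EquivariantBicomodule k B C M)
    (i : ModuleCoalgebraHom k B K C) {r : C →ₗ[k] K} (hr : r ∘ₗ i.lin = LinearMap.id)
    (hl : (i.lin ∘ₗ r).rTensor M ∘ₗ N.coactL = N.coactL)
    (hρ : (i.lin ∘ₗ r).lTensor M ∘ₗ N.coactR = N.coactR) (a n : ℕ) :
    (tailProj M (i.lin ∘ₗ r) a (n + 1)).lTensor X ∘ₗ chtwD P N n ∘ₗ
        (tailProj M (i.lin ∘ₗ r) a n).lTensor X =
      chtwD P N n ∘ₗ (tailProj M (i.lin ∘ₗ r) a n).lTensor X := by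
  have hei : (i.lin ∘ₗ r) ∘ₗ i.lin = i.lin := by rw [LinearMap.comp_assoc, hr, LinearMap.comp_id]
  have hee : (i.lin ∘ₗ r) ∘ₗ (i.lin ∘ₗ r) = i.lin ∘ₗ r := by rw [← LinearMap.comp_assoc, hei]
  have h1 : (tailProj M (i.lin ∘ₗ r) a (n + 1)).lTensor X ∘ₗ
      (TensorProduct.map (tailProj M (i.lin ∘ₗ r) a n) i.lin).lTensor X =
      (TensorProduct.map (tailProj M (i.lin ∘ₗ r) a n) i.lin).lTensor X :=
    (LinearMap.lTensor_comp X _ _).symm.trans (congrArg _ (tailProj_comp_map hee hei a n))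
  have h2 : (tailProj M (i.lin ∘ₗ r) a (n + 1)).lTensor X ∘ₗ lastFace P N n ∘ₗ
      (tailProj M (i.lin ∘ₗ r) a n).lTensor X =
      lastFace P N n ∘ₗ (tailProj M (i.lin ∘ₗ r) a n).lTensor X :=
    (congrArg ((tailProj M (i.lin ∘ₗ r) a (n + 1)).lTensor X ∘ₗ ·)
      (lastFace_tailProj P N i r hl a n)).trans ((LinearMap.comp_assoc _ _ _).symm.trans
      ((congrArg (· ∘ₗ _) h1).trans (lastFace_tailProj P N i r hl a n).symm))
  rw [lTensor_chtwD_comp, tailProj_faceSum (LinearMap.ext i.map_comul) hr hρ, h2, chtwD,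
    LinearMap.add_comp, LinearMap.smul_comp, LinearMap.lTensor_comp]

/-- The last face sends F_a into F_{a+1} and so vanishes on the graded piece. The induced
differential is untwisted, with X as a mere tensor factor; this is what lets X be treated as a
B-module only. -/
theorem toTailQuot_chtwD (P : LeftComodule k B X) (N : EquivariantBicomodule k B C M)
    (i : ModuleCoalgebraHom k B K C) {r : C →ₗ[k] K} (hr : r ∘ₗ i.lin = LinearMap.id)
    {p : C →ₗ[k] Q} {σ : Q →ₗ[k] C} (hpi : p ∘ₗ i.lin = 0)
    (hsum : i.lin ∘ₗ r + σ ∘ₗ p = LinearMap.id)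
    (hl : (i.lin ∘ₗ r).rTensor M ∘ₗ N.coactL = N.coactL)
    (hρ : p.lTensor M ∘ₗ N.coactR = 0) (a n : ℕ) :
    (toTailQuot M r p a (n + 1)).lTensor X ∘ₗ chtwD P N n ∘ₗ
        (tailProj M (i.lin ∘ₗ r) a n).lTensor X =
      (tailFace K N.coactR NUCoalgebra.comul p σ a n).lTensor X ∘ₗ
        (toTailQuot M r p a n).lTensor X := by
  have hpe : p ∘ₗ i.lin ∘ₗ r = 0 := by rw [← LinearMap.comp_assoc, hpi, LinearMap.zero_comp]
  have h1 : (toTailQuot M r p a (n + 1)).lTensor X ∘ₗ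
      (TensorProduct.map (tailProj M (i.lin ∘ₗ r) a n) i.lin).lTensor X = 0 :=
    (LinearMap.lTensor_comp X _ _).symm.trans ((congrArg (LinearMap.lTensor X)
      (toTailQuot_comp_map hpe r hpi a n)).trans (LinearMap.lTensor_zero X))
  have h2 : (toTailQuot M r p a (n + 1)).lTensor X ∘ₗ lastFace P N n ∘ₗ
      (tailProj M (i.lin ∘ₗ r) a n).lTensor X = 0 :=
    (congrArg ((toTailQuot M r p a (n + 1)).lTensor X ∘ₗ ·)
      (lastFace_tailProj P N i r hl a n)).trans ((LinearMap.comp_assoc _ _ _).symm.trans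
      ((congrArg (· ∘ₗ _) h1).trans (LinearMap.zero_comp _)))
  rw [lTensor_chtwD_comp, toTailQuot_faceSum (LinearMap.ext i.map_comul) hr hpi hsum hρ, h2,
    smul_zero, add_zero, LinearMap.lTensor_comp]

end Filtration

/-! ### Reduction to the subcomplex -/

/-- One step down a split filtration, modulo the submodules N. Here Φ and Φ' project onto
consecutive steps F ⊃ F', T is the graded piece, A the projection to it and β its section. If z ∈ F
has boundary in F' modulo N, its class in T is a cocycle modulo L; lifting a primitive through β and
subtracting its boundary moves z into F'. -/
theorem exists_sub_mem_of_filtration {k : Type*} [Ring k] {U₀ U₁ U₂ T₀ T₁ T₂ : Type*}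
    [AddCommGroup U₀] [Module k U₀] [AddCommGroup U₁] [Module k U₁] [AddCommGroup U₂] [Module k U₂]
    [AddCommGroup T₀] [Module k T₀] [AddCommGroup T₁] [Module k T₁] [AddCommGroup T₂] [Module k T₂]
    {d₀ : U₀ →ₗ[k] U₁} {d₁ : U₁ →ₗ[k] U₂} {δ₀ : T₀ →ₗ[k] T₁} {δ₁ : T₁ →ₗ[k] T₂}
    {A₀ : U₀ →ₗ[k] T₀} {A₁ : U₁ →ₗ[k] T₁} {A₂ : U₂ →ₗ[k] T₂} {β₀ : T₀ →ₗ[k] U₀}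
    {β₁ : T₁ →ₗ[k] U₁} {Φ₀ : U₀ →ₗ[k] U₀} {Φ₁ Φ₁' : U₁ →ₗ[k] U₁} {Φ₂' : U₂ →ₗ[k] U₂}
    {N₁ : Submodule k U₁} {N₂ : Submodule k U₂} {L₁ : Submodule k T₁} {L₂ : Submodule k T₂}
    (hA₀ : A₁ ∘ₗ d₀ ∘ₗ Φ₀ = δ₀ ∘ₗ A₀) (hA₁ : A₂ ∘ₗ d₁ ∘ₗ Φ₁ = δ₁ ∘ₗ A₁)
    (hAβ : A₀ ∘ₗ β₀ = LinearMap.id) (hΦβ : Φ₀ ∘ₗ β₀ = β₀) (hd : Φ₁ ∘ₗ d₀ ∘ₗ Φ₀ = d₀ ∘ₗ Φ₀)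
    (hsum : β₁ ∘ₗ A₁ + Φ₁' = Φ₁) (hAΦ : A₂ ∘ₗ Φ₂' = 0) (hidem : Φ₁' ∘ₗ Φ₁' = Φ₁')
    (hN : ∀ x ∈ N₂, A₂ x ∈ L₂) (hL : ∀ x ∈ L₁, β₁ x ∈ N₁)
    (hex : ∀ t, δ₁ t ∈ L₂ → ∃ u, t - δ₀ u ∈ L₁) {z : U₁} (hz : Φ₁ z = z) {w : U₂}
    (hw : Φ₂' w = w) (h : d₁ z - w ∈ N₂) : ∃ y z', Φ₁' z' = z' ∧ z - d₀ y - z' ∈ N₁ := by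
  have h1 : A₂ w = 0 := by rw [← hw]; exact LinearMap.congr_fun hAΦ w
  have h2 : A₂ (d₁ z) = δ₁ (A₁ z) := by
    have := LinearMap.congr_fun hA₁ z
    simpa only [LinearMap.comp_apply, hz] using this
  have h3 : δ₁ (A₁ z) ∈ L₂ := by
    have := hN _ h
    rwa [map_sub, h1, sub_zero, h2] at this
  obtain ⟨u, hu⟩ := hex _ h3
  have h4 : Φ₀ (β₀ u) = β₀ u := LinearMap.congr_fun hΦβ u
  have h5 : A₁ (d₀ (β₀ u)) = δ₀ u := by
    have := LinearMap.congr_fun hA₀ (β₀ u)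
    simp only [LinearMap.comp_apply, h4] at this
    rw [this]
    exact congrArg δ₀ (LinearMap.congr_fun hAβ u)
  have h6 : Φ₁ (d₀ (β₀ u)) = d₀ (β₀ u) := by
    have := LinearMap.congr_fun hd (β₀ u)
    simpa only [LinearMap.comp_apply, h4] using this
  -- The difference between the corrected chain and its F'-part is β of its class in T, which lies
  -- in L, and β carries L into N.
  refine ⟨β₀ u, Φ₁' (z - d₀ (β₀ u)), LinearMap.congr_fun hidem _, ?_⟩
  have h7 := LinearMap.congr_fun hsum (z - d₀ (β₀ u))
  simp only [LinearMap.add_apply, LinearMap.comp_apply, map_sub Φ₁, hz, h6] at h7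
  rw [← h5, ← map_sub] at hu
  have h8 := hL _ hu
  rwa [← sub_eq_of_eq_add h7.symm] at h8

section Filtration

variable {k : Type u} [Field k] {B : Type v} [Ring B] [HopfAlgebra k B]
  {hS : Function.Bijective (HopfAlgebra.antipode k (A := B))}
  {X M K C Q : Type v} [AddCommGroup X] [Module k X] [Module B X] [IsScalarTower k B X]
  [AddCommGroup M] [Module k M] [Module B M] [IsScalarTower k B M]
  [AddCommGroup K] [Module k K] [Module B K] [IsScalarTower k B K] [NUCoalgebra k K]
  [AddCommGroup C] [Module k C] [Module B C] [IsScalarTower k B C] [NUCoalgebra k C]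
  [ModuleCoalgebra k B C]
  [AddCommGroup Q] [Module k Q] [Module B Q] [IsScalarTower k B Q] [NUCoalgebra k Q]

theorem restrictScalars_tw {D E : Type v} [AddCommGroup D] [Module k D] [Module B D]
    [IsScalarTower k B D] [AddCommGroup E] [Module k E] [Module B E] [IsScalarTower k B E]
    (f : D →ₗ[B] E) (b : B) :
    f.restrictScalars k ∘ₗ smulAct k B D b = smulAct k B E b ∘ₗ f.restrictScalars k :=
  LinearMap.ext fun c => f.map_smul b c

/-- Modulo boundaries and coinvariants, one more factor `C` can be moved into `K`. -/
theorem exists_sub_chtwD_tailProj_succ (P : LeftComodule k B X)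
    (hS : Function.Bijective (HopfAlgebra.antipode k (A := B)))
    (N : EquivariantBicomodule k B C M)
    (i : ModuleCoalgebraHom k B K C) (p : ModuleCoalgebraHom k B C Q)
    {r : C →ₗ[B] K} {σ : Q →ₗ[B] C}
    (hr : r.restrictScalars k ∘ₗ i.lin = LinearMap.id) (hpi : p.lin ∘ₗ i.lin = 0)
    (hσ : p.lin ∘ₗ σ.restrictScalars k = LinearMap.id)
    (hsum : i.lin ∘ₗ r.restrictScalars k + σ.restrictScalars k ∘ₗ p.lin = LinearMap.id)
    (hl : (i.lin ∘ₗ r.restrictScalars k).rTensor M ∘ₗ N.coactL = N.coactL)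
    (hρ : (i.lin ∘ₗ r.restrictScalars k).lTensor M ∘ₗ N.coactR = N.coactR)
    (hρ' : p.lin.lTensor M ∘ₗ N.coactR = 0)
    (hM : Module.Projective B M) (hQ : HCounital k Q) {d : ℕ}
    (hX : HasProjectiveDimensionLE (ModuleCat.of B X) d) (a n : ℕ)
    {z : X ⊗[k] tower k M C (n + 1)}
    (hz : (tailProj M (i.lin ∘ₗ r.restrictScalars k) a (n + 1)).lTensor X z = z)
    {w : X ⊗[k] tower k M C (n + 1 + 1)}
    (hw : (tailProj M (i.lin ∘ₗ r.restrictScalars k) (a + 1) (n + 1 + 1)).lTensor X w = w)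
    (h : chtwD P N (n + 1) z - w ∈ coinvKer (chtwAct k B X C M (n + 1 + 1))) :
    ∃ y z', (tailProj M (i.lin ∘ₗ r.restrictScalars k) (a + 1) (n + 1)).lTensor X z' = z' ∧
      z - chtwD P N n y - z' ∈ coinvKer (chtwAct k B X C M (n + 1)) := by
  have hei : (i.lin ∘ₗ r.restrictScalars k) ∘ₗ i.lin = i.lin := by
    rw [LinearMap.comp_assoc, hr, LinearMap.comp_id]
  have hee : (i.lin ∘ₗ r.restrictScalars k) ∘ₗ (i.lin ∘ₗ r.restrictScalars k) =
      i.lin ∘ₗ r.restrictScalars k := by rw [← LinearMap.comp_assoc, hei]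
  have hpe : p.lin ∘ₗ i.lin ∘ₗ r.restrictScalars k = 0 := by
    rw [← LinearMap.comp_assoc, hpi, LinearMap.zero_comp]
  have hinj : Function.Injective i.lin := fun x y hxy => by
    have := congrArg (r.restrictScalars k) hxy
    simpa using (LinearMap.congr_fun hr x).symm.trans (this.trans (LinearMap.congr_fun hr y))
  have hexact : Function.Exact i.lin p.lin := by
    refine fun y => ⟨fun hy => ⟨r y, ?_⟩, ?_⟩
    · have := LinearMap.congr_fun hsum y
      simpa [hy] using this
    · rintro ⟨x, rfl⟩
      exact LinearMap.congr_fun hpi x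
  have hsq : ∀ n, faceSum N.coactR NUCoalgebra.comul (n + 1) ∘ₗ
      faceSum N.coactR NUCoalgebra.comul n = 0 :=
    faceSum_sq NUCoalgebra.coassoc N.coactR N.coassocR
  have hquot := quotFace_exact (V := M) (LinearMap.ext i.map_comul) (LinearMap.ext p.map_comul)
    hσ hinj hexact hsum hQ.1 hQ.2 hρ' hsq
  have hΔ : ∀ b, NUCoalgebra.comul ∘ₗ smulAct k B C b =
      diag (smulAct k B C) (smulAct k B C) b ∘ₗ NUCoalgebra.comul :=
    fun b => LinearMap.ext (ModuleCoalgebra.comul_smul (k := k) b)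
  have hρt : ∀ b, N.coactR ∘ₗ smulAct k B M b =
      diag (smulAct k B M) (smulAct k B C) b ∘ₗ N.coactR :=
    fun b => LinearMap.ext (N.coactR_smul b)
  have itw := restrictScalars_tw (k := k) i.toLinearMap
  have ptw := restrictScalars_tw (k := k) p.toLinearMap
  have rtw := restrictScalars_tw (k := k) r
  have σtw := restrictScalars_tw (k := k) σ
  -- The graded piece is X ⊗ Y with Y exact by `tailFace_exact` and flat because M is projective;
  -- this is where the projective dimension of X enters.
  have hcx := coinv_exact_of_hasProjectiveDimensionLE hS
    (Y := fun n => tailQuot k M K C Q a n)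
    (β := tailAct (smulAct k B M) (smulAct k B K) (smulAct k B C) (smulAct k B Q) a)
    (fun n => (isAct_smulAct M).tailAct (isAct_smulAct K) (isAct_smulAct C) (isAct_smulAct Q) a n)
    (fun n => (coinvFlat_smulAct M).tailAct (isAct_smulAct K) (isAct_smulAct C)
      (isAct_smulAct Q) a n)
    (δ := tailFace K N.coactR NUCoalgebra.comul p.lin (σ.restrictScalars k) a)
    (fun n b => tailFace_tw hρt hΔ ptw σtw a n b) (tailFace_exact hquot a) d X hX n
  refine exists_sub_mem_of_filtration
    (A₀ := (toTailQuot M (r.restrictScalars k) p.lin a n).lTensor X)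
    (β₀ := (ofTailQuot M i.lin (σ.restrictScalars k) a n).lTensor X)
    (β₁ := (ofTailQuot M i.lin (σ.restrictScalars k) a (n + 1)).lTensor X)
    (toTailQuot_chtwD P N i hr hpi hsum hl hρ' a n)
    (toTailQuot_chtwD P N i hr hpi hsum hl hρ' a (n + 1)) ?_ ?_
    (tailProj_chtwD P N i hr hl hρ a n) ?_ ?_ ?_
    (fun x hx => mem_coinvKer_map (fun b => diagOp_tw (f := LinearMap.id) (fun _ => rfl)
      (toTailQuot_tw rtw ptw a (n + 1 + 1)) b) hx)
    (fun x hx => mem_coinvKer_map (fun b => diagOp_tw (f := LinearMap.id) (fun _ => rfl)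
      (ofTailQuot_tw itw σtw a (n + 1)) b) hx) hcx hz hw h
  · rw [← LinearMap.lTensor_comp, toTailQuot_ofTailQuot hr hσ, LinearMap.lTensor_id]
  · rw [← LinearMap.lTensor_comp, tailProj_ofTailQuot hei]
  · rw [← LinearMap.lTensor_comp, ← LinearMap.lTensor_add, ofTailQuot_toTailQuot hsum]
  · exact (LinearMap.lTensor_comp X _ _).symm.trans ((congrArg (LinearMap.lTensor X)
      (toTailQuot_comp_map hpe _ hpe a (n + 1))).trans (LinearMap.lTensor_zero X))
  · rw [← LinearMap.lTensor_comp, tailProj_idem hee]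

end Filtration

/-! ### An elementwise criterion for quasi-isomorphisms -/

section QuasiIsoCriterion

variable {R : Type u} [Ring R]

/-- The fibre product of A and Y over Z surjects onto A as soon as lifts exist pointwise; this turns
element chases into refinements. -/
theorem exists_epi_lift {A Y Z : ModuleCat.{v} R} (x : A ⟶ Z) (g : Y ⟶ Z)
    (h : ∀ a : A, ∃ y : Y, x.hom a = g.hom y) :
    ∃ (A' : ModuleCat.{v} R) (π : A' ⟶ A) (_ : Epi π) (y : A' ⟶ Y), π ≫ x = y ≫ g := by
  let S := LinearMap.ker (x.hom ∘ₗ LinearMap.fst R A Y - g.hom ∘ₗ LinearMap.snd R A Y)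
  refine ⟨ModuleCat.of R S, ModuleCat.ofHom (LinearMap.fst R A Y ∘ₗ S.subtype),
    (ModuleCat.epi_iff_surjective _).2 fun a => ?_,
    ModuleCat.ofHom (LinearMap.snd R A Y ∘ₗ S.subtype), ?_⟩
  · obtain ⟨y, hy⟩ := h a
    exact ⟨⟨(a, y), sub_eq_zero.2 hy⟩, rfl⟩
  · ext ⟨s, hs⟩
    exact sub_eq_zero.1 hs

variable {K L : CochainComplex (ModuleCat.{v} R) ℕ} (f : K ⟶ L)

/-- For injective f the hypotheses say that the cokernel of f is zero in degree 0 and exact in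
positive degrees. -/
theorem quasiIso_of_injective_of_exists_sub_mem_range
    (hinj : ∀ n, Function.Injective (f.f n).hom) (h₀ : Function.Surjective (f.f 0).hom)
    (h : ∀ n (z : L.X (n + 1)), (L.d (n + 1) (n + 1 + 1)).hom z ∈ LinearMap.range (f.f _).hom →
      ∃ y, z - (L.d n (n + 1)).hom y ∈ LinearMap.range (f.f (n + 1)).hom) : QuasiIso f := by
  have hdd : ∀ a b c (y : L.X a), (L.d b c).hom ((L.d a b).hom y) = 0 := fun a b c y =>
    LinearMap.congr_fun (congrArg ModuleCat.Hom.hom (L.d_comp_d a b c)) y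
  have hcomm : ∀ a b (x : K.X a), (L.d a b).hom ((f.f a).hom x) =
      (f.f b).hom ((K.d a b).hom x) := fun a b x =>
    LinearMap.congr_fun (congrArg ModuleCat.Hom.hom (f.comm a b)) x
  -- For injectivity on cohomology: a boundary of L lying in K is already the boundary of an element
  -- of K, since its primitive can be changed by a coboundary until it lies in K.
  have key : ∀ n (z : L.X n), (L.d n (n + 1)).hom z ∈ LinearMap.range (f.f (n + 1)).hom →
      ∃ x, (L.d n (n + 1)).hom z = (L.d n (n + 1)).hom ((f.f n).hom x) := by
    rintro (_ | n) z hz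
    · obtain ⟨x, rfl⟩ := h₀ z
      exact ⟨x, rfl⟩
    · obtain ⟨y, x, hx⟩ := h n z hz
      exact ⟨x, by rw [hx, map_sub, hdd, sub_zero]⟩
  refine ⟨fun j => (quasiIsoAt_iff_isIso_homologyMap f j).2 ?_⟩
  have hm : Mono (HomologicalComplex.homologyMap f j) := by
    obtain ⟨i, hi⟩ : ∃ i, (ComplexShape.up ℕ).prev j = i := ⟨_, rfl⟩
    rw [HomologicalComplex.mono_homologyMap_iff_up_to_refinements f i j _ hi rfl]
    intro A x₂ hx₂ y₁ hy₁
    refine exists_epi_lift _ _ fun a => ?_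
    have ha := LinearMap.congr_fun (congrArg ModuleCat.Hom.hom hy₁) a
    change (f.f j).hom (x₂.hom a) = (L.d i j).hom (y₁.hom a) at ha
    cases j with
    | zero =>
      rw [L.shape _ _ (by simp)] at ha
      exact ⟨0, (hinj 0 (ha.trans (map_zero (f.f 0).hom).symm)).trans (map_zero _).symm⟩
    | succ n =>
      obtain rfl : n = i := (CochainComplex.prev_nat_succ n).symm.trans hi
      obtain ⟨x, hx⟩ := key n (y₁.hom a) ⟨_, ha⟩
      exact ⟨x, hinj _ (by rw [ha, hx, hcomm])⟩
  have he : Epi (HomologicalComplex.homologyMap f j) := by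
    obtain ⟨i, hi⟩ : ∃ i, (ComplexShape.up ℕ).prev j = i := ⟨_, rfl⟩
    rw [HomologicalComplex.epi_homologyMap_iff_up_to_refinements f i j (j + 1) hi
      (CochainComplex.next ℕ j)]
    intro A y₂ hy₂
    -- For surjectivity on cohomology: each cocycle of L is a cocycle of K plus a coboundary;
    -- injectivity of f shows that the part in K is again a cocycle.
    have hex : ∀ a : A, ∃ t : LinearMap.ker (K.d j (j + 1)).hom × L.X i,
        y₂.hom a = (f.f j).hom t.1 + (L.d i j).hom t.2 := by
      intro a
      have ha : (L.d j (j + 1)).hom (y₂.hom a) = 0 :=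
        LinearMap.congr_fun (congrArg ModuleCat.Hom.hom hy₂) a
      suffices ∃ x y, y₂.hom a = (f.f j).hom x + (L.d i j).hom y by
        obtain ⟨x, y, hxy⟩ := this
        refine ⟨⟨⟨x, hinj _ ?_⟩, y⟩, hxy⟩
        rw [← hcomm, map_zero, ← ha, hxy, map_add, hdd, add_zero]
      cases j with
      | zero =>
        obtain ⟨x, hx⟩ := h₀ (y₂.hom a)
        exact ⟨x, 0, by rw [hx, map_zero, add_zero]⟩
      | succ n =>
        obtain rfl : n = i := (CochainComplex.prev_nat_succ n).symm.trans hi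
        obtain ⟨y, x, hx⟩ := h n (y₂.hom a) (by rw [ha]; exact zero_mem _)
        exact ⟨x, y, by rw [hx, sub_add_cancel]⟩
    obtain ⟨A', π, hπ, y, hy⟩ := exists_epi_lift (Y := ModuleCat.of R
      (LinearMap.ker (K.d j (j + 1)).hom × L.X i)) y₂ (ModuleCat.ofHom
      (LinearMap.coprod ((f.f j).hom ∘ₗ Submodule.subtype _) (L.d i j).hom)) hex
    refine ⟨A', π, hπ, ModuleCat.ofHom (Submodule.subtype _ ∘ₗ LinearMap.fst _ _ _ ∘ₗ y.hom), ?_,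
      ModuleCat.ofHom (LinearMap.snd _ _ _ ∘ₗ y.hom), ?_⟩
    · ext a
      exact (y.hom a).1.2
    · rw [hy]
      rfl
  exact isIso_of_mono_of_epi _

end QuasiIsoCriterion

/-! ### Descending the filtration -/

section Excision

variable {k : Type u} [Field k] {B : Type v} [Ring B] [HopfAlgebra k B]
  {hS : Function.Bijective (HopfAlgebra.antipode k (A := B))}
  {X M K C Q : Type v} [AddCommGroup X] [Module k X] [Module B X] [IsScalarTower k B X]
  [AddCommGroup M] [Module k M] [Module B M] [IsScalarTower k B M]
  [AddCommGroup K] [Module k K] [Module B K] [IsScalarTower k B K] [NUCoalgebra k K]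
  [AddCommGroup C] [Module k C] [Module B C] [IsScalarTower k B C] [NUCoalgebra k C]
  [ModuleCoalgebra k B C]
  [AddCommGroup Q] [Module k Q] [Module B Q] [IsScalarTower k B Q] [NUCoalgebra k Q]

/-- Iterating the single step a times leads from F_0, which is everything, to F_a; the target w of
the boundary lies in all F_a and so never obstructs. -/
theorem exists_sub_chtwD_tailProj (P : AntiYetterDrinfeld k B hS X)
    (N : EquivariantBicomodule k B C M)
    (i : ModuleCoalgebraHom k B K C) (p : ModuleCoalgebraHom k B C Q)
    {r : C →ₗ[B] K} {σ : Q →ₗ[B] C}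
    (hr : r.restrictScalars k ∘ₗ i.lin = LinearMap.id) (hpi : p.lin ∘ₗ i.lin = 0)
    (hσ : p.lin ∘ₗ σ.restrictScalars k = LinearMap.id)
    (hsum : i.lin ∘ₗ r.restrictScalars k + σ.restrictScalars k ∘ₗ p.lin = LinearMap.id)
    (hl : (i.lin ∘ₗ r.restrictScalars k).rTensor M ∘ₗ N.coactL = N.coactL)
    (hρ : (i.lin ∘ₗ r.restrictScalars k).lTensor M ∘ₗ N.coactR = N.coactR)
    (hρ' : p.lin.lTensor M ∘ₗ N.coactR = 0)
    (hM : Module.Projective B M) (hQ : HCounital k Q) {d : ℕ}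
    (hX : HasProjectiveDimensionLE (ModuleCat.of B X) d) (n : ℕ)
    {z : X ⊗[k] tower k M C (n + 1)} {w : X ⊗[k] tower k M C (n + 1 + 1)}
    (hw : ∀ a, (tailProj M (i.lin ∘ₗ r.restrictScalars k) a (n + 1 + 1)).lTensor X w = w)
    (h : chtwD P.toLeftComodule N (n + 1) z - w ∈ coinvKer (chtwAct k B X C M (n + 1 + 1)))
    (a : ℕ) :
    ∃ y z', (tailProj M (i.lin ∘ₗ r.restrictScalars k) a (n + 1)).lTensor X z' = z' ∧
      z - chtwD P.toLeftComodule N n y - z' ∈ coinvKer (chtwAct k B X C M (n + 1)) := by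
  induction a with
  | zero =>
    refine ⟨0, z, LinearMap.congr_fun (LinearMap.lTensor_id X _) z, ?_⟩
    rw [map_zero, sub_zero, sub_self]
    exact zero_mem _
  | succ a ih =>
    obtain ⟨y, z', hz', hy⟩ := ih
    have hd := LinearMap.congr_fun (chtwD_sq P.toLeftComodule N n) y
    rw [LinearMap.comp_apply, LinearMap.zero_apply] at hd
    -- The chain has changed by a boundary, killed by d² = 0, and by an element of `coinvKer`, which
    -- the differential preserves.
    have h' : chtwD P.toLeftComodule N (n + 1) z' - w ∈
        coinvKer (chtwAct k B X C M (n + 1 + 1)) := by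
      have := sub_mem h (chtwD_coinv P N (n + 1) hy)
      rw [map_sub, map_sub, hd, sub_zero] at this
      rwa [sub_sub_sub_cancel_left] at this
    obtain ⟨y', z'', hz'', hy'⟩ := exists_sub_chtwD_tailProj_succ P.toLeftComodule hS N i p hr hpi
      hσ hsum hl hρ hρ' hM hQ hX a n hz' (hw (a + 1)) h'
    refine ⟨y + y', z'', hz'', ?_⟩
    have := add_mem hy hy'
    rw [map_add]
    convert this using 1
    abel

/-- Modulo coinvariants, a chain whose differential lies in `CH^tw_*(K, M; X)` differs from an
element of `CH^tw_*(K, M; X)` by a boundary. -/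
theorem exists_sub_chtwD_mem (P : AntiYetterDrinfeld k B hS X)
    (N : EquivariantBicomodule k B C M)
    (i : ModuleCoalgebraHom k B K C) (p : ModuleCoalgebraHom k B C Q)
    {r : C →ₗ[B] K} {σ : Q →ₗ[B] C}
    (hr : r.restrictScalars k ∘ₗ i.lin = LinearMap.id) (hpi : p.lin ∘ₗ i.lin = 0)
    (hσ : p.lin ∘ₗ σ.restrictScalars k = LinearMap.id)
    (hsum : i.lin ∘ₗ r.restrictScalars k + σ.restrictScalars k ∘ₗ p.lin = LinearMap.id)
    (hl : (i.lin ∘ₗ r.restrictScalars k).rTensor M ∘ₗ N.coactL = N.coactL)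
    (hρ : (i.lin ∘ₗ r.restrictScalars k).lTensor M ∘ₗ N.coactR = N.coactR)
    (hρ' : p.lin.lTensor M ∘ₗ N.coactR = 0)
    (hM : Module.Projective B M) (hQ : HCounital k Q) {d : ℕ}
    (hX : HasProjectiveDimensionLE (ModuleCat.of B X) d) (n : ℕ)
    {z : X ⊗[k] tower k M C (n + 1)} {w : X ⊗[k] tower k M K (n + 1 + 1)}
    (h : chtwD P.toLeftComodule N (n + 1) z - (towerMap i.lin _).lTensor X w ∈
      coinvKer (chtwAct k B X C M (n + 1 + 1))) :
    ∃ y x, z - chtwD P.toLeftComodule N n y - (towerMap i.lin (n + 1)).lTensor X x ∈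
      coinvKer (chtwAct k B X C M (n + 1)) := by
  have hei : (i.lin ∘ₗ r.restrictScalars k) ∘ₗ i.lin = i.lin := by
    rw [LinearMap.comp_assoc, hr, LinearMap.comp_id]
  have hw : ∀ a, (tailProj M (i.lin ∘ₗ r.restrictScalars k) a (n + 1 + 1)).lTensor X
      ((towerMap i.lin _).lTensor X w) = (towerMap i.lin _).lTensor X w := fun a => by
    rw [← LinearMap.lTensor_comp_apply, tailProj_towerMap hei]
  -- In degree n + 1 there are n + 1 factors C, so a = n + 1 puts all of them in K.
  obtain ⟨y, z', hz', hy⟩ := exists_sub_chtwD_tailProj P N i p hr hpi hσ hsum hl hρ hρ' hM hQ hX n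
    hw h (n + 1)
  refine ⟨y, (towerMap (r.restrictScalars k) (n + 1)).lTensor X z', ?_⟩
  rwa [← LinearMap.lTensor_comp_apply, ← tailProj_self, hz']

end Excision

/-! ### The equivariant splitting and injectivity -/

section Splitting

variable {k : Type u} [Field k] {B : Type v} [Ring B] [HopfAlgebra k B]
  {hS : Function.Bijective (HopfAlgebra.antipode k (A := B))}
  {X M K C : Type v} [AddCommGroup X] [Module k X] [Module B X] [IsScalarTower k B X]
  [AddCommGroup M] [Module k M] [Module B M] [IsScalarTower k B M]
  [AddCommGroup K] [Module k K] [Module B K] [IsScalarTower k B K] [NUCoalgebra k K]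
  [ModuleCoalgebra k B K]
  [AddCommGroup C] [Module k C] [Module B C] [IsScalarTower k B C] [NUCoalgebra k C]
  [ModuleCoalgebra k B C]

/-- σ lifts the identity of the projective module Q, and r is i⁻¹ applied to 1 - σp, whose values
lie in the kernel of p. -/
theorem exists_splitting {R K C Q : Type*} [Ring R] [AddCommGroup K] [Module R K]
    [AddCommGroup C] [Module R C] [AddCommGroup Q] [Module R Q] [Module.Projective R Q]
    {i : K →ₗ[R] C} {p : C →ₗ[R] Q} (hi : Function.Injective i) (hp : Function.Surjective p)
    (hex : Function.Exact i p) : ∃ (r : C →ₗ[R] K) (σ : Q →ₗ[R] C), r ∘ₗ i = LinearMap.id ∧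
      p ∘ₗ σ = LinearMap.id ∧ i ∘ₗ r + σ ∘ₗ p = LinearMap.id := by
  obtain ⟨σ, hσ⟩ := Module.projective_lifting_property p LinearMap.id hp
  have hmem : ∀ c, (LinearMap.id - σ ∘ₗ p : C →ₗ[R] C) c ∈ LinearMap.range i := fun c =>
    (hex _).1 (by
      rw [LinearMap.sub_apply, map_sub]
      exact sub_eq_zero.2 (LinearMap.congr_fun hσ (p c)).symm)
  let r : C →ₗ[R] K := (LinearEquiv.ofInjective i hi).symm.toLinearMap ∘ₗ
    LinearMap.codRestrict (LinearMap.range i) (LinearMap.id - σ ∘ₗ p) hmem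
  have hr : ∀ c, i (r c) = c - σ (p c) := fun c =>
    congrArg Subtype.val ((LinearEquiv.ofInjective i hi).apply_symm_apply
      (LinearMap.codRestrict (LinearMap.range i) (LinearMap.id - σ ∘ₗ p) hmem c))
  refine ⟨r, σ, LinearMap.ext fun x => hi ?_, hσ, LinearMap.ext fun c => ?_⟩
  · rw [LinearMap.comp_apply, hr, hex.apply_apply_eq_zero, map_zero, sub_zero]
    rfl
  · rw [LinearMap.add_apply, LinearMap.comp_apply, hr]
    exact sub_add_cancel c _

theorem towerMap_comp_eq_id {i : K →ₗ[k] C} {r : C →ₗ[k] K} (hr : r ∘ₗ i = LinearMap.id) (n : ℕ) :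
    towerMap (M := M) r n ∘ₗ towerMap i n = LinearMap.id := by
  induction n with
  | zero => rfl
  | succ n ih => exact (map_comp_eq ih hr).trans TensorProduct.map_id

/-- r is B-linear, so id ⊗ r ⊗ ⋯ ⊗ r descends to coinvariants as a left inverse in each degree; it
need not be a chain map. -/
theorem coinvCHtwMap_f_injective (P : AntiYetterDrinfeld k B hS X) (i : ModuleCoalgebraHom k B K C)
    (N : EquivariantBicomodule k B K M) {r : C →ₗ[B] K}
    (hr : r.restrictScalars k ∘ₗ i.lin = LinearMap.id) (n : ℕ) :
    Function.Injective ((coinvCHtwMap P i N).f n).hom := by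
  have hr' : (towerMap (M := M) (r.restrictScalars k) n).lTensor X ∘ₗ
      (towerMap i.lin n).lTensor X = LinearMap.id := by
    rw [← LinearMap.lTensor_comp, towerMap_comp_eq_id hr, LinearMap.lTensor_id]
  have htw : ∀ b, (towerMap (M := M) (r.restrictScalars k) n).lTensor X ∘ₗ
      chtwAct k B X C M n b = chtwAct k B X K M n b ∘ₗ
        (towerMap (M := M) (r.restrictScalars k) n).lTensor X :=
    diagOp_tw (f := LinearMap.id) (fun _ => rfl)
      (towerMap_tw (restrictScalars_tw (k := k) r) n)
  change Function.Injective (Submodule.mapQ (coinvKer (chtwAct k B X K M n))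
    (coinvKer (chtwAct k B X C M n)) ((towerMap (M := M) i.lin n).lTensor X)
    (coinv_le_of_tw (chtwMap_tw i n)))
  refine (injective_iff_map_eq_zero _).2 fun x hx => ?_
  obtain ⟨x, rfl⟩ := Submodule.mkQ_surjective _ x
  rw [Submodule.mkQ_apply, Submodule.mapQ_apply, Submodule.Quotient.mk_eq_zero] at hx
  rw [Submodule.mkQ_apply, Submodule.Quotient.mk_eq_zero]
  have := mem_coinvKer_map htw hx
  rwa [← LinearMap.comp_apply, hr'] at this

end Splitting

end

end HopfExcision


/-! ### The excision theorem -/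

theorem mainTheorem3 {k : Type u} {B X K C Q : Type v} [Field k] [Ring B] [HopfAlgebra k B]
    (hS : Function.Bijective (HopfAlgebra.antipode k (A := B)))
    [AddCommGroup X] [Module k X] [Module B X] [IsScalarTower k B X]
    (P : HopfExcision.AntiYetterDrinfeld k B hS X)
    [AddCommGroup K] [Module k K] [Module B K] [IsScalarTower k B K]
    [HopfExcision.NUCoalgebra k K] [HopfExcision.ModuleCoalgebra k B K]
    [AddCommGroup C] [Module k C] [Module B C] [IsScalarTower k B C]
    [HopfExcision.NUCoalgebra k C] [HopfExcision.ModuleCoalgebra k B C]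
    [AddCommGroup Q] [Module k Q] [Module B Q] [IsScalarTower k B Q]
    [HopfExcision.NUCoalgebra k Q] [HopfExcision.ModuleCoalgebra k B Q]
    (i : HopfExcision.ModuleCoalgebraHom k B K C) (p : HopfExcision.ModuleCoalgebraHom k B C Q)
    (hi : Function.Injective i.toLinearMap) (hp : Function.Surjective p.toLinearMap)
    (hex : Function.Exact i.toLinearMap p.toLinearMap)
    (hK : HopfExcision.HCounital k K) (hC : HopfExcision.HCounital k C)
    (hQ : HopfExcision.HCounital k Q)
    (hX : ∃ d : ℕ, HasProjectiveDimensionLE (ModuleCat.of B X) d)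
    (hCproj : Module.Projective B C) (hQproj : Module.Projective B Q) :
    (∀ n : ℕ, Function.Injective
      ((HopfExcision.coinvCHtwMap P i (HopfExcision.EquivariantBicomodule.self k B K)).f n).hom) ∧
    QuasiIso (HopfExcision.coinvCHtwMap P i (HopfExcision.EquivariantBicomodule.self k B K)) := by
  open HopfExcision in
  obtain ⟨d, hX⟩ := hX
  obtain ⟨r, σ, hri, hpσ, hirσp⟩ := exists_splitting hi hp hex
  have hr : r.restrictScalars k ∘ₗ i.lin = LinearMap.id :=
    LinearMap.ext fun x => LinearMap.congr_fun hri x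
  have hpi : p.lin ∘ₗ i.lin = 0 := LinearMap.ext fun x => hex.apply_apply_eq_zero x
  have hσ : p.lin ∘ₗ σ.restrictScalars k = LinearMap.id :=
    LinearMap.ext fun x => LinearMap.congr_fun hpσ x
  have hsum : i.lin ∘ₗ r.restrictScalars k + σ.restrictScalars k ∘ₗ p.lin = LinearMap.id :=
    LinearMap.ext fun x => LinearMap.congr_fun hirσp x
  have hei : (i.lin ∘ₗ r.restrictScalars k) ∘ₗ i.lin = i.lin := by
    rw [LinearMap.comp_assoc, hr, LinearMap.comp_id]
  have hKproj : Module.Projective B K := Module.Projective.of_split i.toLinearMap r hri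
  have hl : (i.lin ∘ₗ r.restrictScalars k).rTensor K ∘ₗ
      ((EquivariantBicomodule.self k B K).push i).coactL =
      ((EquivariantBicomodule.self k B K).push i).coactL := by
    change _ ∘ₗ i.lin.rTensor K ∘ₗ NUCoalgebra.comul = i.lin.rTensor K ∘ₗ NUCoalgebra.comul
    rw [← LinearMap.comp_assoc, ← LinearMap.rTensor_comp, hei]
  have hρ : (i.lin ∘ₗ r.restrictScalars k).lTensor K ∘ₗ
      ((EquivariantBicomodule.self k B K).push i).coactR =
      ((EquivariantBicomodule.self k B K).push i).coactR := by
    change _ ∘ₗ i.lin.lTensor K ∘ₗ NUCoalgebra.comul = i.lin.lTensor K ∘ₗ NUCoalgebra.comul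
    rw [← LinearMap.comp_assoc, ← LinearMap.lTensor_comp, hei]
  have hρ' : p.lin.lTensor K ∘ₗ ((EquivariantBicomodule.self k B K).push i).coactR = 0 := by
    change _ ∘ₗ i.lin.lTensor K ∘ₗ NUCoalgebra.comul = 0
    rw [← LinearMap.comp_assoc, ← LinearMap.lTensor_comp, hpi, LinearMap.lTensor_zero,
      LinearMap.zero_comp]
  have hinj := coinvCHtwMap_f_injective P i (EquivariantBicomodule.self k B K) hr
  refine ⟨hinj, quasiIso_of_injective_of_exists_sub_mem_range _ hinj ?_ ?_⟩
  -- In degree zero there are no factors C: both sides are the coinvariants of X ⊗ K, and the map is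
  -- the identity.
  · intro z
    obtain ⟨z, rfl⟩ := Submodule.mkQ_surjective _ z
    exact ⟨Submodule.Quotient.mk z, congrArg Submodule.Quotient.mk
      (LinearMap.congr_fun (LinearMap.lTensor_id (R := k) X K) z)⟩
  · rintro n z ⟨w, hw⟩
    obtain ⟨z, rfl⟩ := Submodule.mkQ_surjective _ z
    obtain ⟨w, rfl⟩ := Submodule.mkQ_surjective _ w
    simp only [coinvCHtw, CochainComplex.of_d] at hw ⊢
    -- Representatives are chosen, and an equality in coinvariants becomes membership in `coinvKer`.
    have hw' : chtwD P.toLeftComodule ((EquivariantBicomodule.self k B K).push i) (n + 1) z -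
        (towerMap i.lin _).lTensor X w ∈ coinvKer (chtwAct k B X C K (n + 1 + 1)) :=
      (Submodule.Quotient.eq _).1 hw.symm
    obtain ⟨y, x, hyx⟩ := exists_sub_chtwD_mem P ((EquivariantBicomodule.self k B K).push i) i p
      hr hpi hσ hsum hl hρ hρ' hKproj hQ hX n hw'
    exact ⟨Submodule.Quotient.mk y, Submodule.Quotient.mk x,
      ((Submodule.Quotient.eq _).2 hyx).symm⟩
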